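/- **Setting.** Let $n\in\mathbb N$, $\alpha\in(\tfrac13,\tfrac12)$, $T>0$, and let $f\colon\mathbb R^n\to\mathbb R^n$ and $g\colon\mathbb R^n\to\mathbb R^{n\times n}$ be smooth; set $\hat f(u)=f(u)+u$. Let $\mathcal D^\alpha$ be the space of rough paths $(X,\mathbf X)$ on $[0,2\pi]$: $X\colon[0,2\pi]\to\mathbb R^n$ is $\alpha$-Hölder continuous, $\mathbf X\colon[0,2\pi]^2\to\mathbb R^{n\times n}$ is continuous, vanishes on the diagonal, satisfies $\mathbf X^{ij}_{x,z}-\mathbf X^{ij}_{y,z}-\mathbf X^{ij}_{x,y}=(X^i_y-X^i_x)(X^j_z-X^j_y)$ for all $x,y,z$, and $\sup_{x\ne y}|\mathbf X_{x,y}|/|x-y|^{2\alpha}<\infty$. Let $\Psi=(\Psi_t)_{t\ge0}$ be a $\mathcal D^\alpha$-valued process on a probability space, with path component $\psi_t$ and area component $\boldsymbol\Psi_t$, whose sample paths are almost surely continuous from $[0,T]$ to $\mathcal D^\alpha$, for the distance $\|X-\bar X\|_\infty+\|X-\bar X\|_\alpha+\|\mathbf X-\bar{\mathbf X}\|_{2\alpha}$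 (for instance the canonical lift of the stationary solution of $d\psi=(\partial_x^2-1)\psi\,dt+\sigma\,dW$, with $W$ a cylindrical Wiener process on $L^2([0,2\pi],\mathbb R^n)$). Consider $$du=\partial_x^2u\,dt+f(u)\,dt+g(u)\,\partial_xu\,dt+\sigma\,dW$$ on $[0,2\pi]$ with periodic boundary conditions. **Rough integral.** For a real-valued path $Y$ on $[0,2\pi]$ with derivative process $Y'$ with values in $\mathbb R^{n}$, $$\int_0^{2\pi}Y\,dX^j=\lim_{|\mathcal P|\to0}\sum_{[x,y]\in\mathcal P}\Bigl(Y_x\,(X^j_y-X^j_x)+\sum_kY'^{\,k}_x\,\mathbf X^{kj}_{x,y}\Bigr),$$ the limit being over partitions $\mathcal P$ of $[0,2\pi]$ with mesh tending to $0$. Below, $\int_0^{2\pi}\varphi(x)\,g(u_s(x))\,d\Psi_s(x)\in\mathbb R^n$ has $i$-th component $\sum_j\int_0^{2\pi}\varphi\,g_{ij}(u_s)\,d\Psi^j_s$, where $\varphi\,g_{ij}(u_s)$ has derivative process $(\varphi\,\partial_kg_{ij}(u_s))_k$. **Solutions.** Let $u$ be a process on $[0,T]\times[0,2\pi]$ with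 values in $\mathbb R^n$, and $v_t=u_t-\psi_t$. Both notions below require that, almost surely, $u$ is continuous and $v\in C([0,T],C([0,2\pi]))\cap L^1([0,T],C^1([0,2\pi]))$. Write $\langle w,\varphi\rangle=\int_0^{2\pi}\varphi(x)w(x)\,dx$. * $u$ is a *weak solution* if, almost surely, for every smooth $2\pi$-periodic $\varphi\colon\mathbb R\to\mathbb R$ and every $t\in[0,T]$, $$\langle v_t,\varphi\rangle=\langle u_0-\psi_0,\varphi\rangle+\int_0^t\langle(\partial_x^2-1)\varphi,v_s\rangle\,ds+\int_0^t\langle\varphi,g(u_s)\partial_xv_s\rangle\,ds+\int_0^t\!\int_0^{2\pi}\varphi(x)g(u_s(x))\,d\Psi_s(x)\,ds+\int_0^t\langle\varphi,\hat f(u_s)\rangle\,ds .$$ * $u$ is a *mild solution* if, almost surely, for every $x\in[0,2\pi]$ and $t\in(0,T]$, $$v_t(x)=\bigl(S_t(u_0-\psi_0)\bigr)(x)+\int_0^t\bigl(S_{t-s}\bigl(g(u_s)\partial_xv_s+\hat f(u_s)\bigr)\bigr)(x)\,ds+\int_0^t\!\int_0^{2\pi}p_{t-s}(x-y)\,g(u_s(y))\,d\Psi_s(y)\,ds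 ,$$ where $S_t$ is the semigroup generated by $\partial_x^2-1$ with periodic boundary conditions, that is, $(S_tw)(x)=\int_0^{2\pi}p_t(x-y)w(y)\,dy$ with $p_t(x)=\frac1{2\pi}\sum_{k\in\mathbb Z}e^{-t-k^2t}e^{ikx}$. In each identity it is understood that the rough integrals exist for almost every $s\in(0,t)$ and that the integrands in $s$ are Lebesgue integrable. **Proposition.** The process $u$ is a mild solution if and only if it is a weak solution. -/

import Mathlib

open Set Filter Topology MeasureTheory
open scoped Matrix

noncomputable section

namespace RoughBurgers

/-- The Euclidean space `ℝⁿ`. -/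
abbrev E (n : ℕ) : Type := EuclideanSpace ℝ (Fin n)

/-- The spatial interval `[0, 2π]`. It plays the role of the "time" interval of the rough paths. -/
def I : Set ℝ := Icc 0 (2 * Real.pi)

/-! ### Rough paths -/

/-- The space `𝒟^α` of rough paths on `[0, 2π]` with values in `ℝⁿ`: a path `X` together with an
area process `𝐗`, where `area x y i j` stands for `∫_x^y (X^i_z - X^i_x) dX^j_z`. Only the values
on `[0, 2π]` are meaningful. -/
structure RoughPath (n : ℕ) (α : ℝ) where
  /-- the path `X` -/
  path : ℝ → E n
  /-- the area process `𝐗` -/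
  area : ℝ → ℝ → Matrix (Fin n) (Fin n) ℝ
  continuous_path : ContinuousOn path I
  continuous_area : ContinuousOn (fun q : ℝ × ℝ => area q.1 q.2) (I ×ˢ I)
  area_diag : ∀ x ∈ I, area x x = 0
  /-- the algebraic relations `𝐗_{s,t} - 𝐗_{u,t} - 𝐗_{s,u} = δX_{s,u} ⊗ δX_{u,t}` -/
  chen : ∀ s ∈ I, ∀ u ∈ I, ∀ t ∈ I, ∀ i j : Fin n,
    area s t i j - area u t i j - area s u i j = (path u i - path s i) * (path t j - path u j)
  holder_path : ∃ C : ℝ, ∀ x ∈ I, ∀ y ∈ I, ‖path x - path y‖ ≤ C * |x - y| ^ α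
  holder_area : ∃ C : ℝ, ∀ x ∈ I, ∀ y ∈ I, ∀ i j : Fin n, |area x y i j| ≤ C * |x - y| ^ (2 * α)

/-- `X` and `Y` are at distance at most `ε` in `𝒟^α`: the sup norm and the `α`-Hölder seminorm of
the difference of the paths, and the `2α`-Hölder seminorm of the difference of the areas, are all
bounded by `ε`. -/
def RoughPath.Close {n : ℕ} {α : ℝ} (X Y : RoughPath n α) (ε : ℝ) : Prop :=
  (∀ x ∈ I, ‖X.path x - Y.path x‖ ≤ ε) ∧
  (∀ x ∈ I, ∀ y ∈ I,
    ‖(X.path x - Y.path x) - (X.path y - Y.path y)‖ ≤ ε * |x - y| ^ α) ∧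
  (∀ x ∈ I, ∀ y ∈ I, ∀ i j : Fin n,
    |X.area x y i j - Y.area x y i j| ≤ ε * |x - y| ^ (2 * α))

/-- `Ψ` is continuous as a map from `[0, T]` to `𝒟^α`. -/
def ContinuousInRoughPaths {n : ℕ} {α : ℝ} (T : ℝ) (Ψ : ℝ → RoughPath n α) : Prop :=
  ∀ t ∈ Icc 0 T, ∀ ε > 0, ∀ᶠ s in 𝓝[Icc 0 T] t, (Ψ s).Close (Ψ t) ε

/-! ### Rough integrals -/

/-- The second order approximation `Y_x δX_{x,y} + Y'_x 𝐗_{x,y}` of `∫_x^y Y dX ∈ ℝⁿ`, for a real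
valued path `Y` with derivative process `Y'` (with values in `ℝ^{1 × n}`). -/
def germ {n : ℕ} {α : ℝ} (X : RoughPath n α) (Y : ℝ → ℝ) (Y' : ℝ → Fin n → ℝ) (x y : ℝ) : E n :=
  WithLp.toLp 2 fun j =>
    Y x * (X.path y j - X.path x j) + ∑ k : Fin n, Y' x k * X.area x y k j

/-- `J` is the rough integral `∫_0^{2π} Y dX`, that is, the limit of the compensated Riemann sums
along the partitions `0 = τ 0 ≤ τ 1 ≤ ⋯ ≤ τ N = 2π` whose mesh tends to zero. -/
def HasRoughIntegral {n : ℕ} {α : ℝ} (X : RoughPath n α) (Y : ℝ → ℝ) (Y' : ℝ → Fin n → ℝ)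
    (J : E n) : Prop :=
  ∀ ε > 0, ∃ δ > 0, ∀ (N : ℕ) (τ : ℕ → ℝ), Monotone τ → τ 0 = 0 → τ N = 2 * Real.pi →
    (∀ i < N, τ (i + 1) - τ i < δ) →
      ‖∑ i ∈ Finset.range N, germ X Y Y' (τ i) (τ (i + 1)) - J‖ < ε

open Classical in
/-- The rough integral `∫_0^{2π} Y dX`, with the value `0` where it does not exist. -/
def roughIntegral {n : ℕ} {α : ℝ} (X : RoughPath n α) (Y : ℝ → ℝ) (Y' : ℝ → Fin n → ℝ) : E n :=
  if h : ∃ J, HasRoughIntegral X Y Y' J then h.choose else 0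

/-- The partial derivative `∂_k g_{ij}(w)`. -/
def partialG {n : ℕ} (g : E n → Matrix (Fin n) (Fin n) ℝ) (i j k : Fin n) (w : E n) : ℝ :=
  fderiv ℝ (fun z : E n => g z i j) w (EuclideanSpace.single k 1)

/-- For `u = v + X` with `v` of class `C¹`, the path `φ g_{ij}(u)` is controlled by `X`, with
derivative process `φ ∂_k g_{ij}(u)` (`1 ≤ k ≤ n`). This says that all the rough integrals
`∫_0^{2π} φ g_{ij}(u) dX` exist. -/
def RoughTermExists {n : ℕ} {α : ℝ} (g : E n → Matrix (Fin n) (Fin n) ℝ) (X : RoughPath n α)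
    (u : ℝ → E n) (φ : ℝ → ℝ) : Prop :=
  ∀ i j : Fin n, ∃ J : E n,
    HasRoughIntegral X (fun x => φ x * g (u x) i j) (fun x k => φ x * partialG g i j k (u x)) J

/-- The rough integral `∫_0^{2π} φ(x) g(u(x)) dX(x) ∈ ℝⁿ`, whose `i`-th component is
`∑_j ∫_0^{2π} φ(x) g_{ij}(u(x)) dX^j(x)`. -/
def roughTerm {n : ℕ} {α : ℝ} (g : E n → Matrix (Fin n) (Fin n) ℝ) (X : RoughPath n α)
    (u : ℝ → E n) (φ : ℝ → ℝ) : E n :=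
  WithLp.toLp 2 fun i => ∑ j : Fin n,
    roughIntegral X (fun x => φ x * g (u x) i j) (fun x k => φ x * partialG g i j k (u x)) j

/-! ### Function spaces, pairing, heat semigroup -/

/-- The spatial derivative of a function on `[0, 2π]` (one-sided at the end points). -/
def dx {n : ℕ} (w : ℝ → E n) (x : ℝ) : E n := derivWithin w I x

/-- The norm `‖w‖_∞ + ‖∂_x w‖_∞` of `C¹([0, 2π], ℝⁿ)`. -/
def normC1 {n : ℕ} (w : ℝ → E n) : ℝ := (⨆ x : I, ‖w x‖) + ⨆ x : I, ‖dx w x‖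

/-- `v` belongs to `C([0,T], C([0,2π], ℝⁿ)) ∩ L¹([0,T], C¹([0,2π], ℝⁿ))`. -/
def InSolutionSpace {n : ℕ} (T : ℝ) (v : ℝ → ℝ → E n) : Prop :=
  ContinuousOn (fun q : ℝ × ℝ => v q.1 q.2) (Icc 0 T ×ˢ I) ∧
  (∀ᵐ t ∂(volume.restrict (Icc 0 T)), ContDiffOn ℝ 1 (v t) I) ∧
  IntegrableOn (fun t => normC1 (v t)) (Icc 0 T)

/-- The pairing `⟨φ, w⟩ = ∫_0^{2π} φ(x) w(x) dx ∈ ℝⁿ`. -/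
def pairing {n : ℕ} (φ : ℝ → ℝ) (w : ℝ → E n) : E n := ∫ x in (0)..(2 * Real.pi), φ x • w x

/-- The heat kernel `p_t(x) = (2π)⁻¹ ∑_{k ∈ ℤ} exp(-t - k² t) e^{ikx}` of the operator `∂_x² - 1`
with periodic boundary conditions on `[0, 2π]` (for `t > 0`). -/
def heatKernel (t x : ℝ) : ℝ :=
  (2 * Real.pi)⁻¹ * ∑' k : ℤ, Real.exp (-t - (k : ℝ) ^ 2 * t) * Real.cos (k * x)

/-- The semigroup `S_t` generated by `∂_x² - 1` with periodic boundary conditions (for `t > 0`):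
`(S_t w)(x) = ∫_0^{2π} p_t(x - y) w(y) dy`. -/
def semigroup {n : ℕ} (t : ℝ) (w : ℝ → E n) (x : ℝ) : E n :=
  pairing (fun y => heatKernel t (x - y)) w

/-! ### The equation -/

/-- `f̂(u) = f(u) + u`. -/
def fHat {n : ℕ} (f : E n → E n) (u : E n) : E n := f u + u

/-- The function `x ↦ g(u(x)) ∂_x v(x)`. -/
def transport {n : ℕ} (g : E n → Matrix (Fin n) (Fin n) ℝ) (u v : ℝ → E n) (x : ℝ) : E n :=
  WithLp.toLp 2 (g (u x) *ᵥ (dx v x).ofLp)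

/-- The function `v_t = u_t - ψ_t`. -/
def shifted {n : ℕ} {α : ℝ} (Ψ : ℝ → RoughPath n α) (u : ℝ → ℝ → E n) (t x : ℝ) : E n :=
  u t x - (Ψ t).path x

/-- The weak formulation tested against `φ` at time `t`: all the terms are well defined, and the
identity holds. Here `v = u - ψ`. -/
def WeakIdentity {n : ℕ} {α : ℝ} (f : E n → E n) (g : E n → Matrix (Fin n) (Fin n) ℝ)
    (Ψ : ℝ → RoughPath n α) (u v : ℝ → ℝ → E n) (φ : ℝ → ℝ) (t : ℝ) : Prop :=
  (∀ᵐ s ∂(volume.restrict (Ioc 0 t)), RoughTermExists g (Ψ s) (u s) φ) ∧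
  IntervalIntegrable
    (fun s => pairing (fun x => iteratedDeriv 2 φ x - φ x) (v s)) volume 0 t ∧
  IntervalIntegrable (fun s => pairing φ (transport g (u s) (v s))) volume 0 t ∧
  IntervalIntegrable (fun s => roughTerm g (Ψ s) (u s) φ) volume 0 t ∧
  IntervalIntegrable (fun s => pairing φ (fun x => fHat f (u s x))) volume 0 t ∧
  pairing φ (v t) =
    pairing φ (fun x => u 0 x - (Ψ 0).path x)
      + (∫ s in (0)..t, pairing (fun x => iteratedDeriv 2 φ x - φ x) (v s))
      + (∫ s in (0)..t, pairing φ (transport g (u s) (v s)))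
      + (∫ s in (0)..t, roughTerm g (Ψ s) (u s) φ)
      + ∫ s in (0)..t, pairing φ (fun x => fHat f (u s x))

/-- The mild formulation at the point `x` and time `t`: all the terms are well defined, and the
identity holds. Here `v = u - ψ`. -/
def MildIdentity {n : ℕ} {α : ℝ} (f : E n → E n) (g : E n → Matrix (Fin n) (Fin n) ℝ)
    (Ψ : ℝ → RoughPath n α) (u v : ℝ → ℝ → E n) (t x : ℝ) : Prop :=
  (∀ᵐ s ∂(volume.restrict (Ioc 0 t)),
    RoughTermExists g (Ψ s) (u s) (fun y => heatKernel (t - s) (x - y))) ∧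
  IntervalIntegrable
    (fun s => semigroup (t - s) (fun y => transport g (u s) (v s) y + fHat f (u s y)) x)
    volume 0 t ∧
  IntervalIntegrable
    (fun s => roughTerm g (Ψ s) (u s) (fun y => heatKernel (t - s) (x - y))) volume 0 t ∧
  v t x =
    semigroup t (fun y => u 0 y - (Ψ 0).path y) x
      + (∫ s in (0)..t,
          semigroup (t - s) (fun y => transport g (u s) (v s) y + fHat f (u s y)) x)
      + ∫ s in (0)..t, roughTerm g (Ψ s) (u s) (fun y => heatKernel (t - s) (x - y))

variable {Ω : Type*} [MeasurableSpace Ω]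

/-- The process `u` is a weak solution on `[0, T]`: it has continuous sample paths, `v = u - ψ` is
in the solution space, and, almost surely, the weak formulation holds for every smooth periodic
test function and every time. -/
def IsWeakSolution (P : Measure Ω) {n : ℕ} {α : ℝ} (T : ℝ) (f : E n → E n)
    (g : E n → Matrix (Fin n) (Fin n) ℝ) (Ψ : Ω → ℝ → RoughPath n α) (u : Ω → ℝ → ℝ → E n) :
    Prop :=
  ∀ᵐ ω ∂P,
    ContinuousOn (fun q : ℝ × ℝ => u ω q.1 q.2) (Icc 0 T ×ˢ I) ∧
    InSolutionSpace T (shifted (Ψ ω) (u ω)) ∧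
    ∀ φ : ℝ → ℝ, ContDiff ℝ (⊤ : ℕ∞) φ → Function.Periodic φ (2 * Real.pi) → ∀ t ∈ Icc 0 T,
      WeakIdentity f g (Ψ ω) (u ω) (shifted (Ψ ω) (u ω)) φ t

/-- The process `u` is a mild solution on `[0, T]`: it has continuous sample paths, `v = u - ψ` is
in the solution space, and, almost surely, the mild formulation holds at every point of `[0, 2π]`
and every positive time. -/
def IsMildSolution (P : Measure Ω) {n : ℕ} {α : ℝ} (T : ℝ) (f : E n → E n)
    (g : E n → Matrix (Fin n) (Fin n) ℝ) (Ψ : Ω → ℝ → RoughPath n α) (u : Ω → ℝ → ℝ → E n) :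
    Prop :=
  ∀ᵐ ω ∂P,
    ContinuousOn (fun q : ℝ × ℝ => u ω q.1 q.2) (Icc 0 T ×ˢ I) ∧
    InSolutionSpace T (shifted (Ψ ω) (u ω)) ∧
    ∀ x ∈ I, ∀ t ∈ Ioc 0 T, MildIdentity f g (Ψ ω) (u ω) (shifted (Ψ ω) (u ω)) t x

end RoughBurgers

end

/-!
The equivalence is pathwise: for almost every sample path, both formulations are shown to be
equivalent to Duhamel's formula for every mode `cos (k x + θ)`,
`⟨v_t, m⟩ = e^{-(1+k²)t} ⟨v_0, m⟩ + ∫_0^t e^{-(1+k²)(t-s)} F_s(m) ds` with `m = cos (k · + θ)`,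
where `F_s(φ)` is the sum of the transport term, the rough term and the reaction term tested
against `φ`. Each of the three is a linear functional of `φ` which is bounded in the Lipschitz norm,
with a bound which is integrable in `s` (`LipFamily`).

*Weak formulation.* Tested against one mode, the weak identity is an integrated scalar linear
equation, and `integral_equation_iff_duhamel` solves it. Conversely, a smooth periodic function is a
series of modes whose Lipschitz norms are summable (`exists_mode_expansion`), and so the identity
extends from modes to all test functions (`LipFamily.integral_series`).

*Mild formulation.* The heat semigroup acts diagonally on modes (`integral_mode_smul_heatKernel`).
By Fubini's theorem, testing the mild identity against a mode gives Duhamel's formula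
(`LipFamily.pairing_integral_heat`). Conversely, Duhamel's formula says that both sides of the mild
identity have the same pairings with all modes. By completeness of the modes
(`eq_zero_of_pairing_mode_eq_zero`) they agree, since both are continuous in `x`.

*The estimate behind this.* The function `s ↦ F_s(p_{t-s}(x - ·))` has to be integrable near
`s = t`, but the `C¹` norm of `v_s`, which enters the bound of the rough integral, is only integrable
in `s`. A bound containing a product of `‖v_s‖_{C¹}` with a negative power of `t - s` would therefore
not do. The rough integral of the heat kernel is bounded by a constant times
`√τ ^ (α - 1) + ‖v_s‖_{C¹}`, with `τ = t - s` (`exists_roughIntegral_heatKernel_bound`): the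
interval is cut into cells of the parabolic scale `√τ`, the bound of the sewing lemma (`exists_sewing`)
is used on each cell, and the contributions are summed with the Gaussian decay of the kernel
(`heatKernel_cell_bounds`), which Poisson summation provides (`heatKernel_hasSum_gauss`).
-/

namespace RoughBurgers

/-! ### Trigonometric modes and functionals bounded in the Lipschitz norm -/

/-- The mode `y ↦ cos (k y + θ)`. Allowing all phases `θ` makes this family contain the sines and
the translates of the modes, so that real Fourier series and heat kernels are single series. -/
noncomputable def mode (k : ℤ) (θ y : ℝ) : ℝ := Real.cos (k * y + θ)

/-- On `[0, 2π]`, the function `φ` is bounded by `A` and Lipschitz with constant `B`. -/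
def LipBound (φ : ℝ → ℝ) (A B : ℝ) : Prop :=
  (∀ y ∈ I, |φ y| ≤ A) ∧ ∀ y ∈ I, ∀ z ∈ I, |φ y - φ z| ≤ B * |y - z|

/-- The function `φ` is Lipschitz continuous on `[0, 2π]`. -/
def IsLip (φ : ℝ → ℝ) : Prop := ∃ A B, LipBound φ A B

/-- The functional `F` is linear on Lipschitz functions, and bounded there by `V` times the
Lipschitz norm. -/
structure LipFunctional {n : ℕ} (F : (ℝ → ℝ) → E n) (V : ℝ) : Prop where
  map_add : ∀ φ ψ, IsLip φ → IsLip ψ → F (fun y => φ y + ψ y) = F φ + F ψ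
  map_smul : ∀ (c : ℝ) φ, IsLip φ → F (fun y => c * φ y) = c • F φ
  bound : ∀ φ A B, LipBound φ A B → ‖F φ‖ ≤ V * (A + B)

theorem zero_mem_I : (0 : ℝ) ∈ I := ⟨le_rfl, by positivity⟩

theorem two_pi_mem_I : 2 * Real.pi ∈ I := ⟨by positivity, le_rfl⟩

theorem LipBound.nonneg {φ : ℝ → ℝ} {A B : ℝ} (h : LipBound φ A B) : 0 ≤ A ∧ 0 ≤ B := by
  refine ⟨(abs_nonneg _).trans (h.1 0 zero_mem_I), ?_⟩
  have := (abs_nonneg _).trans (h.2 0 zero_mem_I _ two_pi_mem_I)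
  have hp : 0 < |0 - 2 * Real.pi| := abs_pos.2 (by linarith [Real.pi_pos])
  nlinarith

theorem LipBound.add {φ ψ : ℝ → ℝ} {A B A' B' : ℝ} (h : LipBound φ A B) (h' : LipBound ψ A' B') :
    LipBound (fun y => φ y + ψ y) (A + A') (B + B') := by
  refine ⟨fun y hy => (abs_add_le _ _).trans (add_le_add (h.1 y hy) (h'.1 y hy)),
    fun y hy z hz => ?_⟩
  have h1 := h.2 y hy z hz
  have h2 := h'.2 y hy z hz
  calc |φ y + ψ y - (φ z + ψ z)| = |(φ y - φ z) + (ψ y - ψ z)| := by ring_nf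
    _ ≤ _ := abs_add_le _ _
    _ ≤ _ := by linarith

theorem LipBound.smul {φ : ℝ → ℝ} {A B : ℝ} (c : ℝ) (h : LipBound φ A B) :
    LipBound (fun y => c * φ y) (|c| * A) (|c| * B) := by
  refine ⟨fun y hy => ?_, fun y hy z hz => ?_⟩
  · rw [abs_mul]
    exact mul_le_mul_of_nonneg_left (h.1 y hy) (abs_nonneg c)
  · rw [← mul_sub, abs_mul, mul_assoc]
    exact mul_le_mul_of_nonneg_left (h.2 y hy z hz) (abs_nonneg c)

theorem IsLip.add {φ ψ : ℝ → ℝ} (h : IsLip φ) (h' : IsLip ψ) : IsLip (fun y => φ y + ψ y) := by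
  obtain ⟨A, B, h⟩ := h
  obtain ⟨A', B', h'⟩ := h'
  exact ⟨_, _, h.add h'⟩

theorem IsLip.smul {φ : ℝ → ℝ} (c : ℝ) (h : IsLip φ) : IsLip (fun y => c * φ y) := by
  obtain ⟨A, B, h⟩ := h
  exact ⟨_, _, h.smul c⟩

theorem lipBound_zero : LipBound (fun _ => 0) 0 0 := by
  constructor <;> intros <;> simp

theorem IsLip.sum {ι : Type*} (S : Finset ι) (f : ι → ℝ → ℝ) (h : ∀ k, IsLip (f k)) :
    IsLip (fun y => ∑ k ∈ S, f k y) := by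
  classical
  induction S using Finset.induction_on with
  | empty => simpa using ⟨0, 0, lipBound_zero⟩
  | insert a S ha ih =>
    simp only [Finset.sum_insert ha]
    exact (h a).add ih

theorem IsLip.continuousOn {φ : ℝ → ℝ} (h : IsLip φ) : ContinuousOn φ I := by
  obtain ⟨A, B, h⟩ := h
  have : LipschitzOnWith (Real.toNNReal B) φ I := by
    refine LipschitzOnWith.of_dist_le_mul fun y hy z hz => ?_
    rw [Real.dist_eq, Real.dist_eq]
    refine (h.2 y hy z hz).trans ?_
    gcongr
    exact Real.le_coe_toNNReal B
  exact this.continuousOn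

theorem isLip_of_contDiff {φ : ℝ → ℝ} (h : ContDiff ℝ 1 φ) : IsLip φ := by
  obtain ⟨K, hK⟩ := h.contDiffOn.exists_lipschitzOnWith one_ne_zero (convex_Icc 0 (2 * Real.pi))
    isCompact_Icc
  obtain ⟨A, hA⟩ := isCompact_Icc.exists_bound_of_continuousOn (s := I) h.continuous.continuousOn
  refine ⟨A, K, hA, fun y hy z hz => ?_⟩
  simpa [Real.dist_eq] using hK.dist_le_mul y hy z hz

theorem mode_lipBound (k : ℤ) (θ : ℝ) : LipBound (mode k θ) 1 |(k : ℝ)| := by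
  refine ⟨fun y _ => Real.abs_cos_le_one _, fun y _ z _ => ?_⟩
  have := Real.abs_cos_sub_cos_le (k * y + θ) (k * z + θ)
  simp only [mode]
  refine this.trans (le_of_eq ?_)
  rw [← abs_mul]
  ring_nf

theorem continuous_mode (k : ℤ) (θ : ℝ) : Continuous (mode k θ) := by
  unfold mode; fun_prop

theorem isLip_mode (k : ℤ) (θ : ℝ) : IsLip (mode k θ) := ⟨_, _, mode_lipBound k θ⟩

namespace LipFunctional

variable {n : ℕ} {F G : (ℝ → ℝ) → E n} {V W : ℝ}

theorem map_zero (h : LipFunctional F V) : F (fun _ => 0) = 0 := by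
  simpa using h.map_smul 0 (fun _ => 0) ⟨0, 0, lipBound_zero⟩

theorem map_sub (h : LipFunctional F V) {φ ψ : ℝ → ℝ} (hφ : IsLip φ) (hψ : IsLip ψ) :
    F (fun y => φ y - ψ y) = F φ - F ψ := by
  have h1 := h.map_add φ _ hφ (hψ.smul (-1))
  rw [h.map_smul _ _ hψ] at h1
  simpa [sub_eq_add_neg] using h1

theorem map_sum (h : LipFunctional F V) {ι : Type*} (S : Finset ι) (f : ι → ℝ → ℝ)
    (hf : ∀ k, IsLip (f k)) : F (fun y => ∑ k ∈ S, f k y) = ∑ k ∈ S, F (f k) := by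
  classical
  induction S using Finset.induction_on with
  | empty => simpa using h.map_zero
  | insert a S ha ih =>
    simp only [Finset.sum_insert ha]
    rw [h.map_add _ _ (hf a) (IsLip.sum S f hf), ih]

theorem add (hF : LipFunctional F V) (hG : LipFunctional G W) :
    LipFunctional (fun φ => F φ + G φ) (V + W) where
  map_add φ ψ h h' := by
    simp only [hF.map_add φ ψ h h', hG.map_add φ ψ h h']; abel
  map_smul c φ h := by simp only [hF.map_smul c φ h, hG.map_smul c φ h, smul_add]
  bound φ A B h := by
    have h1 := hF.bound φ A B h
    have h2 := hG.bound φ A B h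
    calc _ ≤ ‖F φ‖ + ‖G φ‖ := norm_add_le _ _
      _ ≤ _ := by linarith

theorem mono (hF : LipFunctional F V) (h : V ≤ W) : LipFunctional F W where
  map_add := hF.map_add
  map_smul := hF.map_smul
  bound φ A B hφ := by
    obtain ⟨h0, h1⟩ := hφ.nonneg
    exact (hF.bound φ A B hφ).trans (by gcongr)

theorem norm_mode_le (h : LipFunctional F V) (k : ℤ) (θ : ℝ) :
    ‖F (mode k θ)‖ ≤ V * (1 + |(k : ℝ)|) := h.bound _ _ _ (mode_lipBound k θ)

end LipFunctional

theorem lipBound_tail {φ : ℝ → ℝ} {r θ : ℤ → ℝ} (hr : Summable fun k : ℤ => (1 + |(k : ℝ)|) * |r k|)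
    (hφ : ∀ y ∈ I, HasSum (fun k => r k * mode k (θ k) y) (φ y)) (S : Finset ℤ) :
    LipBound (fun y => φ y - ∑ k ∈ S, r k * mode k (θ k) y)
      (∑' k : {k // k ∉ S}, (1 + |((k : ℤ) : ℝ)|) * |r k|)
      (∑' k : {k // k ∉ S}, (1 + |((k : ℤ) : ℝ)|) * |r k|) := by
  have hs : HasSum (fun k : {k // k ∉ S} => (1 + |((k : ℤ) : ℝ)|) * |r k|)
      (∑' k : {k // k ∉ S}, (1 + |((k : ℤ) : ℝ)|) * |r k|) :=
    (hr.comp_injective Subtype.val_injective).hasSum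
  have ht : ∀ y ∈ I, HasSum (fun k : {k // k ∉ S} => r k * mode k (θ k) y)
      (φ y - ∑ k ∈ S, r k * mode k (θ k) y) := by
    intro y hy
    rw [Finset.hasSum_compl_iff (f := fun k => r k * mode k (θ k) y) S]
    simpa using hφ y hy
  constructor
  · intro y hy
    rw [← Real.norm_eq_abs]
    refine (ht y hy).norm_le_of_bounded hs fun k => ?_
    rw [Real.norm_eq_abs, abs_mul, mul_comm]
    gcongr
    exact ((mode_lipBound k (θ k)).1 y hy).trans (by simp)
  · intro y hy z hz
    rw [← Real.norm_eq_abs]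
    refine ((ht y hy).sub (ht z hz)).norm_le_of_bounded (hs.mul_right _) fun k => ?_
    rw [Real.norm_eq_abs, ← mul_sub, abs_mul]
    calc |r k| * |mode k (θ k) y - mode k (θ k) z|
        ≤ |r k| * (|((k : ℤ) : ℝ)| * |y - z|) := by
          gcongr; exact (mode_lipBound k (θ k)).2 y hy z hz
      _ ≤ |r k| * ((1 + |((k : ℤ) : ℝ)|) * |y - z|) := by gcongr; simp
      _ = _ := by ring

theorem isLip_of_hasSum {φ : ℝ → ℝ} {r θ : ℤ → ℝ}
    (hr : Summable fun k : ℤ => (1 + |(k : ℝ)|) * |r k|)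
    (hφ : ∀ y ∈ I, HasSum (fun k => r k * mode k (θ k) y) (φ y)) : IsLip φ :=
  ⟨_, _, by simpa using lipBound_tail hr hφ ∅⟩

/-- A functional bounded in the Lipschitz norm can be applied term by term to a series of modes
whose coefficients decay fast enough for the series to converge in that norm. -/
theorem LipFunctional.hasSum {n : ℕ} {F : (ℝ → ℝ) → E n} {V : ℝ} (h : LipFunctional F V)
    {φ : ℝ → ℝ} {r θ : ℤ → ℝ} (hr : Summable fun k : ℤ => (1 + |(k : ℝ)|) * |r k|)
    (hφ : ∀ y ∈ I, HasSum (fun k => r k * mode k (θ k) y) (φ y)) :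
    HasSum (fun k => r k • F (mode k (θ k))) (F φ) := by
  have hlip : ∀ k, IsLip (fun y => r k * mode k (θ k) y) := fun k => (isLip_mode _ _).smul _
  have hd : ∀ S : Finset ℤ, ‖∑ k ∈ S, r k • F (mode k (θ k)) - F φ‖ ≤
      V * (∑' k : {k // k ∉ S}, (1 + |((k : ℤ) : ℝ)|) * |r k| +
        ∑' k : {k // k ∉ S}, (1 + |((k : ℤ) : ℝ)|) * |r k|) := by
    intro S
    have h1 := h.bound _ _ _ (lipBound_tail hr hφ S)
    rw [h.map_sub (isLip_of_hasSum hr hφ) (IsLip.sum S _ hlip), h.map_sum S _ hlip] at h1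
    rw [norm_sub_rev]
    simpa only [h.map_smul _ _ (isLip_mode _ _)] using h1
  have h0 := tendsto_tsum_compl_atTop_zero (fun k : ℤ => (1 + |(k : ℝ)|) * |r k|)
  have h1 := (h0.add h0).const_mul V
  rw [add_zero, mul_zero] at h1
  rw [HasSum, SummationFilter.unconditional_filter, tendsto_iff_norm_sub_tendsto_zero]
  exact squeeze_zero (fun _ => norm_nonneg _) hd h1

/-! ### Orthogonality and completeness of the modes -/

theorem integral_mode (k : ℤ) (θ : ℝ) :
    ∫ x in (0)..(2 * Real.pi), mode k θ x = if k = 0 then 2 * Real.pi * Real.cos θ else 0 := by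
  split_ifs with h
  · subst h; simp [mode]
  · have hk : (k : ℝ) ≠ 0 := by exact_mod_cast h
    simp only [mode]
    rw [intervalIntegral.integral_comp_mul_add (fun y => Real.cos y) hk, integral_cos]
    have : (k : ℝ) * (2 * Real.pi) + θ = θ + k * (2 * Real.pi) := by ring
    rw [this, Real.sin_add_int_mul_two_pi]
    simp

theorem integral_mode_mul (l k : ℤ) (θ η : ℝ) :
    ∫ x in (0)..(2 * Real.pi), mode l θ x * mode k η x =
      Real.pi * ((if l + k = 0 then Real.cos (θ + η) else 0) +
        if l - k = 0 then Real.cos (θ - η) else 0) := by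
  have h : ∀ x, mode l θ x * mode k η x =
      (1 / 2) * mode (l + k) (θ + η) x + (1 / 2) * mode (l - k) (θ - η) x := by
    intro x
    simp only [mode]
    push_cast
    have e1 : ((l : ℝ) + k) * x + (θ + η) = (l * x + θ) + (k * x + η) := by ring
    have e2 : ((l : ℝ) - k) * x + (θ - η) = (l * x + θ) - (k * x + η) := by ring
    rw [e1, e2, Real.cos_add (l * x + θ), Real.cos_sub (l * x + θ)]
    ring
  simp only [h]
  rw [intervalIntegral.integral_add, intervalIntegral.integral_const_mul,
    intervalIntegral.integral_const_mul, integral_mode, integral_mode]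
  · split_ifs <;> ring
  · exact ((continuous_mode _ _).const_mul _).intervalIntegrable _ _
  · exact ((continuous_mode _ _).const_mul _).intervalIntegrable _ _

theorem mode_eq (k : ℤ) (θ y : ℝ) :
    mode k θ y = Real.cos θ * mode k 0 y + -Real.sin θ * mode k (-(Real.pi / 2)) y := by
  simp only [mode, add_zero, ← sub_eq_add_neg, Real.cos_sub_pi_div_two, Real.cos_add]
  ring

/-- The values of a functional on the modes of frequency `k` are determined by those on the
cosine and the sine. -/
theorem LipFunctional.apply_mode {n : ℕ} {F : (ℝ → ℝ) → E n} {V : ℝ} (h : LipFunctional F V)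
    (k : ℤ) (θ : ℝ) :
    F (mode k θ) = Real.cos θ • F (mode k 0) + (-Real.sin θ) • F (mode k (-(Real.pi / 2))) := by
  rw [← h.map_smul _ _ (isLip_mode _ _), ← h.map_smul _ _ (isLip_mode _ _),
    ← h.map_add _ _ ((isLip_mode _ _).smul _) ((isLip_mode _ _).smul _)]
  congr 1
  ext y
  exact mode_eq k θ y

theorem mode_neg (k : ℤ) (θ : ℝ) : mode (-k) θ = mode k (-θ) := by
  ext y
  simp only [mode]
  rw [← Real.cos_neg]
  push_cast
  ring_nf

theorem LipFunctional.apply_mode_translate {n : ℕ} {F : (ℝ → ℝ) → E n} {V : ℝ}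
    (h : LipFunctional F V) (k : ℤ) (x : ℝ) :
    F (mode k (-(k * x))) = mode k 0 x • F (mode k 0) +
      mode k (-(Real.pi / 2)) x • F (mode k (-(Real.pi / 2))) := by
  rw [h.apply_mode]
  simp [mode, ← sub_eq_add_neg, Real.cos_sub_pi_div_two]

theorem LipFunctional.integral_mode_smul {n : ℕ} {F : (ℝ → ℝ) → E n} {V : ℝ}
    (h : LipFunctional F V) (l k : ℤ) (θ : ℝ) :
    ∫ x in (0)..(2 * Real.pi), mode l θ x • F (mode k (-(k * x))) =
      (if k = l then Real.pi • F (mode l θ) else 0) +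
        if k = -l then Real.pi • F (mode l θ) else 0 := by
  simp only [h.apply_mode_translate, smul_add, smul_smul]
  rw [intervalIntegral.integral_add, intervalIntegral.integral_smul_const,
    intervalIntegral.integral_smul_const, integral_mode_mul, integral_mode_mul]
  · have e1 : l + k = 0 ↔ k = -l := by omega
    have e2 : l - k = 0 ↔ k = l := by omega
    simp only [e1, e2, h.apply_mode l θ, add_zero, sub_zero, ← sub_eq_add_neg, sub_neg_eq_add,
      Real.cos_sub_pi_div_two, Real.cos_add_pi_div_two]
    have e3 : mode (-l) 0 = mode l 0 := by rw [mode_neg, neg_zero]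
    have e4 : F (mode (-l) (-(Real.pi / 2))) = -F (mode l (-(Real.pi / 2))) := by
      rw [mode_neg, h.apply_mode l]; simp
    by_cases c1 : k = l <;> by_cases c2 : k = -l
    · have : l = 0 := by omega
      subst this
      subst c1
      rw [neg_zero] at e4
      have e5 : F (mode 0 (-(Real.pi / 2))) = 0 := by
        have : (2 : ℝ) • F (mode 0 (-(Real.pi / 2))) = 0 := by
          rw [two_smul]; nth_rewrite 1 [e4]; simp
        simpa using this
      simp only [e5, if_true, neg_zero, smul_zero, add_zero]
      module
    · subst c1
      simp only [c2, if_true, if_false]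
      module
    · subst c2
      simp only [c1, if_true, if_false, e3, e4]
      module
    · simp only [c1, c2, if_false]
      simp
  all_goals
    refine Continuous.intervalIntegrable ?_ _ _
    exact ((continuous_mode _ _).mul (continuous_mode _ _)).smul continuous_const

theorem pairing_apply {n : ℕ} {φ : ℝ → ℝ} {w : ℝ → E n}
    (h : IntervalIntegrable (fun x => φ x • w x) volume 0 (2 * Real.pi)) (i : Fin n) :
    pairing φ w i = ∫ x in (0)..(2 * Real.pi), φ x * w x i := by
  have := (EuclideanSpace.proj (𝕜 := ℝ) i).intervalIntegral_comp_comm h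
  simpa [pairing] using this.symm

theorem two_pi_pos : (0 : ℝ) < 2 * Real.pi := by positivity

theorem uIcc_two_pi : uIcc 0 (2 * Real.pi) = I := uIcc_of_le two_pi_pos.le

/-- The modes form a complete system: a continuous function whose pairings with all of them vanish
is zero. -/
theorem eq_zero_of_pairing_mode_eq_zero {n : ℕ} {w : ℝ → E n} (hw : ContinuousOn w I)
    (h : ∀ k θ, pairing (mode k θ) w = 0) : ∀ x ∈ I, w x = 0 := by
  intro x hx
  ext i
  set v : ℝ → ℝ := fun x => w x i with hv
  have hvc : ContinuousOn v I :=
    (EuclideanSpace.proj (𝕜 := ℝ) i).continuous.comp_continuousOn hw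
  have hint : ∀ k θ, IntervalIntegrable (fun x => mode k θ x * v x) volume 0 (2 * Real.pi) := by
    intro k θ
    apply ContinuousOn.intervalIntegrable
    rw [uIcc_two_pi]
    exact (continuous_mode k θ).continuousOn.mul hvc
  have hm : ∀ k θ, ∫ x in (0)..(2 * Real.pi), mode k θ x * v x = 0 := by
    intro k θ
    rw [← pairing_apply, h k θ]; · rfl
    apply ContinuousOn.intervalIntegrable
    rw [uIcc_two_pi]
    exact (continuous_mode k θ).continuousOn.smul hw
  have hf : ContinuousOn (fun x => (v x : ℂ)) I := Complex.continuous_ofReal.comp_continuousOn hvc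
  have hc : ∀ k : ℤ, fourierCoeffOn two_pi_pos (fun x => (v x : ℂ)) k = 0 := by
    intro k
    rw [fourierCoeffOn_eq_integral]
    have e : ∀ x : ℝ, fourier (-k) (x : AddCircle (2 * Real.pi - 0)) • (v x : ℂ) =
        ((mode k 0 x * v x : ℝ) : ℂ) +
          (-Complex.I) * ((mode k (-(Real.pi / 2)) x * v x : ℝ) : ℂ) := by
      intro x
      have hp : (Real.pi : ℂ) ≠ 0 := by exact_mod_cast Real.pi_ne_zero
      have : 2 * (Real.pi : ℂ) * Complex.I * ((-k : ℤ) : ℂ) * x / ((2 * Real.pi - 0 : ℝ) : ℂ) =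
          ((-(k * x) : ℝ) : ℂ) * Complex.I := by
        push_cast
        field_simp
        ring
      rw [fourier_coe_apply, this, Complex.exp_mul_I, ← Complex.ofReal_cos, ← Complex.ofReal_sin]
      simp only [mode, ← sub_eq_add_neg, Real.cos_sub_pi_div_two, Real.cos_neg, Real.sin_neg,
        add_zero, smul_eq_mul]
      push_cast
      ring
    simp only [e]
    rw [intervalIntegral.integral_add, intervalIntegral.integral_const_mul,
      intervalIntegral.integral_ofReal, intervalIntegral.integral_ofReal, hm, hm]
    · simp
    · exact ⟨(hint _ _).1.ofReal, (hint _ _).2.ofReal⟩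
    · exact IntervalIntegrable.const_mul ⟨(hint _ _).1.ofReal, (hint _ _).2.ofReal⟩ _
  have hL2 : MemLp (fun x => (v x : ℂ)) 2 (volume.restrict (Ioc 0 (2 * Real.pi))) := by
    obtain ⟨C, hC⟩ := isCompact_Icc.exists_bound_of_continuousOn (s := I) hf
    refine MemLp.of_bound ((hf.mono Ioc_subset_Icc_self).aestronglyMeasurable measurableSet_Ioc) C ?_
    filter_upwards [ae_restrict_mem measurableSet_Ioc] with x hx
    exact hC x (Ioc_subset_Icc_self hx)
  have hs := tsum_sq_fourierCoeffOn two_pi_pos hL2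
  simp only [hc, norm_zero, ne_eq, OfNat.ofNat_ne_zero, not_false_eq_true, zero_pow, tsum_zero,
    Complex.norm_real] at hs
  have hs' : ∫ x in (0)..(2 * Real.pi), ‖v x‖ ^ 2 = 0 := by
    have h2 : ((2 * Real.pi - 0)⁻¹ : ℝ) ≠ 0 := by
      rw [sub_zero]; exact inv_ne_zero two_pi_pos.ne'
    exact (smul_eq_zero.1 hs.symm).resolve_left h2
  rw [intervalIntegral.integral_eq_zero_iff_of_nonneg_ae] at hs'
  · rw [Ioc_eq_empty (not_lt.2 two_pi_pos.le), union_empty, restrict_Ioc_eq_restrict_Icc] at hs'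
    have hz : v =ᵐ[volume.restrict (Icc 0 (2 * Real.pi))] fun _ => 0 := by
      filter_upwards [hs'] with x hx
      simpa using hx
    exact Measure.eqOn_Icc_of_ae_eq volume two_pi_pos.ne hz hvc continuousOn_const hx
  · exact Eventually.of_forall fun x => by positivity
  · apply ContinuousOn.intervalIntegrable
    rw [uIcc_two_pi]
    exact hvc.norm.pow 2

/-! ### The heat kernel as a series of modes -/

/-- The Fourier coefficient `(2π)⁻¹ exp(-t - k² t)` of the heat kernel. -/
noncomputable def heatCoeff (k : ℤ) (t : ℝ) : ℝ :=
  (2 * Real.pi)⁻¹ * Real.exp (-t - (k : ℝ) ^ 2 * t)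

theorem heatCoeff_nonneg (k : ℤ) (t : ℝ) : 0 ≤ heatCoeff k t := by
  unfold heatCoeff; positivity

theorem summable_heatCoeff {t : ℝ} (ht : 0 < t) :
    Summable fun k : ℤ => (1 + |(k : ℝ)|) * |heatCoeff k t| := by
  have hnat : Summable fun m : ℕ => (1 + (m : ℝ)) * |heatCoeff m t| := by
    have h0 := Real.summable_pow_mul_exp_neg_nat_mul 0 ht
    have h1 := Real.summable_pow_mul_exp_neg_nat_mul 1 ht
    refine Summable.of_nonneg_of_le (fun m => by positivity) (fun m => ?_)
      ((h0.add h1).mul_left (2 * Real.pi)⁻¹)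
    rw [abs_of_nonneg (heatCoeff_nonneg _ _), heatCoeff]
    have : Real.exp (-t - ((m : ℤ) : ℝ) ^ 2 * t) ≤ Real.exp (-t * m) := by
      apply Real.exp_le_exp.2
      have hm : (m : ℝ) ≤ (m : ℝ) ^ 2 := by exact_mod_cast Nat.le_self_pow two_ne_zero m
      push_cast
      nlinarith
    calc (1 + (m : ℝ)) * ((2 * Real.pi)⁻¹ * Real.exp (-t - ((m : ℤ) : ℝ) ^ 2 * t))
        ≤ (1 + (m : ℝ)) * ((2 * Real.pi)⁻¹ * Real.exp (-t * m)) := by gcongr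
      _ = _ := by ring
  refine Summable.of_nat_of_neg ?_ ?_
  · simpa using hnat
  · refine hnat.congr fun m => ?_
    simp [heatCoeff]

theorem heatKernel_hasSum {t : ℝ} (ht : 0 < t) (x y : ℝ) :
    HasSum (fun k => heatCoeff k t * mode k (-(k * x)) y) (heatKernel t (x - y)) := by
  have h : Summable fun k : ℤ => Real.exp (-t - (k : ℝ) ^ 2 * t) * Real.cos (k * (x - y)) := by
    refine Summable.of_norm_bounded ((summable_heatCoeff ht).mul_left (2 * Real.pi)) fun k => ?_
    rw [Real.norm_eq_abs, abs_mul, abs_of_pos (Real.exp_pos _),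
      abs_of_nonneg (heatCoeff_nonneg k t), heatCoeff]
    have e : 2 * Real.pi * ((1 + |(k : ℝ)|) * ((2 * Real.pi)⁻¹ * Real.exp (-t - (k : ℝ) ^ 2 * t))) =
        Real.exp (-t - (k : ℝ) ^ 2 * t) * (1 + |(k : ℝ)|) := by
      have := Real.pi_ne_zero
      field_simp
    rw [e]
    gcongr
    exact (Real.abs_cos_le_one _).trans (by simp)
  have e : (fun k : ℤ => heatCoeff k t * mode k (-(k * x)) y) = fun k : ℤ =>
      (2 * Real.pi)⁻¹ * (Real.exp (-t - (k : ℝ) ^ 2 * t) * Real.cos (k * (x - y))) := by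
    funext k
    rw [heatCoeff, mode, mul_assoc, ← Real.cos_neg]
    ring_nf
  rw [e]
  exact h.hasSum.mul_left _

theorem isLip_heatKernel {t : ℝ} (ht : 0 < t) (x : ℝ) : IsLip fun y => heatKernel t (x - y) :=
  isLip_of_hasSum (summable_heatCoeff ht) fun y _ => heatKernel_hasSum ht x y

namespace LipFunctional

variable {n : ℕ} {F : (ℝ → ℝ) → E n} {V : ℝ}

theorem hasSum_heatKernel (h : LipFunctional F V) {t : ℝ} (ht : 0 < t) (x : ℝ) :
    HasSum (fun k => heatCoeff k t • F (mode k (-(k * x)))) (F fun y => heatKernel t (x - y)) :=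
  h.hasSum (summable_heatCoeff ht) fun y _ => heatKernel_hasSum ht x y

theorem norm_heat_term_le (h : LipFunctional F V) (k : ℤ) (t θ : ℝ) :
    ‖heatCoeff k t • F (mode k θ)‖ ≤ V * ((1 + |(k : ℝ)|) * |heatCoeff k t|) := by
  rw [norm_smul, Real.norm_eq_abs]
  calc _ ≤ |heatCoeff k t| * (V * (1 + |(k : ℝ)|)) := by gcongr; exact h.norm_mode_le _ _
    _ = _ := by ring

theorem continuous_apply_mode (h : LipFunctional F V) (k : ℤ) :
    Continuous fun θ => F (mode k θ) := by
  have : (fun θ => F (mode k θ)) = fun θ =>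
      Real.cos θ • F (mode k 0) + (-Real.sin θ) • F (mode k (-(Real.pi / 2))) :=
    funext fun θ => h.apply_mode k θ
  rw [this]
  fun_prop

theorem continuous_apply_translate (h : LipFunctional F V) (k : ℤ) :
    Continuous fun x : ℝ => F (mode k (-(k * x))) :=
  (h.continuous_apply_mode k).comp (show Continuous fun x : ℝ => -((k : ℝ) * x) by fun_prop)

theorem continuous_heatKernel (h : LipFunctional F V) {t : ℝ} (ht : 0 < t) :
    Continuous fun x => F fun y => heatKernel t (x - y) := by
  have e : (fun x => F fun y => heatKernel t (x - y)) =
      fun x => ∑' k : ℤ, heatCoeff k t • F (mode k (-(k * x))) :=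
    funext fun x => (h.hasSum_heatKernel ht x).tsum_eq.symm
  rw [e]
  refine continuous_tsum (fun k => ?_) ((summable_heatCoeff ht).mul_left V)
    fun k x => h.norm_heat_term_le k t _
  exact (h.continuous_apply_translate k).const_smul (heatCoeff k t)

/-- The heat semigroup acts diagonally on the modes. -/
theorem integral_mode_smul_heatKernel (h : LipFunctional F V) {t : ℝ} (ht : 0 < t) (l : ℤ)
    (θ : ℝ) :
    ∫ x in (0)..(2 * Real.pi), mode l θ x • F (fun y => heatKernel t (x - y)) =
      Real.exp (-t - (l : ℝ) ^ 2 * t) • F (mode l θ) := by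
  have hs : HasSum
      (fun k : ℤ => ∫ x in (0)..(2 * Real.pi),
        mode l θ x • heatCoeff k t • F (mode k (-(k * x))))
      (∫ x in (0)..(2 * Real.pi), mode l θ x • F (fun y => heatKernel t (x - y))) := by
    refine intervalIntegral.hasSum_integral_of_dominated_convergence
      (fun k _ => V * ((1 + |(k : ℝ)|) * |heatCoeff k t|)) (fun k => ?_) (fun k => ?_) ?_ ?_ ?_
    · refine Continuous.aestronglyMeasurable ?_
      exact (continuous_mode l θ).smul
        ((h.continuous_apply_translate k).const_smul (heatCoeff k t))
    · refine Eventually.of_forall fun x _ => ?_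
      rw [norm_smul]
      have h1 : ‖mode l θ x‖ ≤ 1 := Real.abs_cos_le_one _
      calc _ ≤ 1 * (V * ((1 + |(k : ℝ)|) * |heatCoeff k t|)) :=
            mul_le_mul h1 (h.norm_heat_term_le k t _) (norm_nonneg _) zero_le_one
        _ = _ := one_mul _
    · exact Eventually.of_forall fun x _ => (summable_heatCoeff ht).mul_left V
    · exact intervalIntegrable_const
    · exact Eventually.of_forall fun x _ => (h.hasSum_heatKernel ht x).const_smul _
  have hterm : ∀ k : ℤ, (∫ x in (0)..(2 * Real.pi),
      mode l θ x • heatCoeff k t • F (mode k (-(k * x)))) =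
      (if k = l then (heatCoeff l t * Real.pi) • F (mode l θ) else 0) +
        if k = -l then (heatCoeff l t * Real.pi) • F (mode l θ) else 0 := by
    intro k
    simp only [smul_comm _ (heatCoeff k t)]
    rw [intervalIntegral.integral_smul, h.integral_mode_smul, smul_add, smul_ite, smul_ite,
      smul_zero, smul_smul]
    congr 1
    · split_ifs with hk
      · rw [hk]
      · rfl
    · split_ifs with hk
      · rw [hk]; simp [heatCoeff]
      · rfl
  simp only [hterm] at hs
  rw [hs.unique ((hasSum_ite_eq l _).add (hasSum_ite_eq (-l) _)), ← add_smul, heatCoeff]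
  congr 1
  have := Real.pi_ne_zero
  field_simp
  norm_num

end LipFunctional

/-! ### Smooth periodic functions as series of modes -/

theorem fourier_two_pi (k : ℤ) (x : ℝ) :
    fourier k (x : AddCircle (2 * Real.pi - 0)) = Complex.exp (((k * x : ℝ) : ℂ) * Complex.I) := by
  have hp : (Real.pi : ℂ) ≠ 0 := by exact_mod_cast Real.pi_ne_zero
  rw [fourier_coe_apply]
  congr 1
  push_cast
  field_simp
  ring

theorem periodic_deriv {φ : ℝ → ℝ} {c : ℝ} (h : Function.Periodic φ c) :
    Function.Periodic (deriv φ) c := by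
  intro x
  have : (fun y => φ (y + c)) = φ := funext h
  rw [← deriv_comp_add_const, this]

theorem fourierCoeffOn_deriv {φ : ℝ → ℝ} (hφ : ContDiff ℝ 1 φ)
    (hp : Function.Periodic φ (2 * Real.pi)) (k : ℤ) :
    fourierCoeffOn two_pi_pos (fun x => ((deriv φ x : ℝ) : ℂ)) k =
      Complex.I * k * fourierCoeffOn two_pi_pos (fun x => (φ x : ℂ)) k := by
  have hd : ∀ x, HasDerivAt (fun x => (φ x : ℂ)) ((deriv φ x : ℝ) : ℂ) x := fun x =>
    (hφ.differentiable one_ne_zero x).hasDerivAt.ofReal_comp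
  have hc : Continuous fun x => ((deriv φ x : ℝ) : ℂ) :=
    Complex.continuous_ofReal.comp (hφ.continuous_deriv le_rfl)
  have hpi : (Real.pi : ℂ) ≠ 0 := by exact_mod_cast Real.pi_ne_zero
  have h0 : φ (2 * Real.pi) = φ 0 := by simpa using hp 0
  by_cases hk : k = 0
  · subst hk
    rw [fourierCoeffOn_eq_integral]
    simp only [neg_zero, fourier_zero, one_smul]
    rw [intervalIntegral.integral_eq_sub_of_hasDerivAt (fun x _ => hd x)
      (hc.intervalIntegrable _ _), h0]
    simp
  · have hk' : (k : ℂ) ≠ 0 := by exact_mod_cast hk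
    rw [fourierCoeffOn_of_hasDerivAt two_pi_pos hk (fun x _ => hd x) (hc.intervalIntegrable _ _),
      h0, sub_self, mul_zero]
    push_cast
    field_simp
    ring

theorem fourierCoeffOn_bound {φ : ℝ → ℝ} (hφ : Continuous φ) :
    ∃ C, ∀ k, ‖fourierCoeffOn two_pi_pos (fun x => (φ x : ℂ)) k‖ ≤ C := by
  obtain ⟨C, hC⟩ := isCompact_Icc.exists_bound_of_continuousOn (s := I) hφ.continuousOn
  refine ⟨‖(1 / (2 * Real.pi - 0))‖ * (C * |2 * Real.pi - 0|), fun k => ?_⟩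
  rw [fourierCoeffOn_eq_integral, norm_smul]
  gcongr
  refine intervalIntegral.norm_integral_le_of_norm_le_const fun x hx => ?_
  rw [uIoc_of_le two_pi_pos.le] at hx
  rw [norm_smul, fourier_two_pi, Complex.norm_exp_ofReal_mul_I, one_mul, Complex.norm_real]
  exact hC x (Ioc_subset_Icc_self hx)

theorem summable_one_div_one_add_sq : Summable fun k : ℤ => 1 / (1 + (k : ℝ) ^ 2) := by
  have hnat : Summable fun m : ℕ => 1 / (1 + (m : ℝ) ^ 2) := by
    have h2 := (Real.summable_one_div_nat_pow (p := 2)).2 one_lt_two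
    refine (summable_nat_add_iff 1).1 ?_
    refine Summable.of_nonneg_of_le (fun m => by positivity) (fun m => ?_)
      ((summable_nat_add_iff 1).2 h2)
    exact one_div_le_one_div_of_le (by positivity) (by linarith)
  refine Summable.of_nat_of_neg ?_ ?_ <;> simpa using hnat

/-- If the Fourier coefficients of a periodic function are summable, then the function is the sum of
the real parts of its Fourier series. -/
theorem hasSum_mode_of_summable {φ : ℝ → ℝ} (hφ : Continuous φ)
    (hp : Function.Periodic φ (2 * Real.pi))
    (hs : Summable (fourierCoeffOn two_pi_pos (fun x => (φ x : ℂ)))) (y : ℝ) :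
    HasSum (fun k : ℤ => (fourierCoeffOn two_pi_pos (fun x => (φ x : ℂ)) k *
      Complex.exp (((k * y : ℝ) : ℂ) * Complex.I)).re) (φ y) := by
  have hp' : Function.Periodic (fun x => (φ x : ℂ)) (2 * Real.pi - 0) := by
    intro x
    have := hp x
    simp only [sub_zero, this]
  have hT : Fact (0 < 2 * Real.pi - 0) := ⟨by simpa using two_pi_pos⟩
  have hcont : Continuous hp'.lift :=
    continuous_coinduced_dom.2 (Complex.continuous_ofReal.comp hφ)
  let G : C(AddCircle (2 * Real.pi - 0), ℂ) := ⟨hp'.lift, hcont⟩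
  have hG : ∀ x : ℝ, G x = φ x := fun x => rfl
  have hco : fourierCoeff G = fourierCoeffOn two_pi_pos (fun x => (φ x : ℂ)) := by
    ext k
    rw [fourierCoeff_eq_intervalIntegral _ _ 0, fourierCoeffOn_eq_integral]
    simp only [hG]
    rw [zero_add]
    congr 2
    rw [sub_zero]
  have := has_pointwise_sum_fourier_series_of_summable (f := G) (by rw [hco]; exact hs) (y : AddCircle _)
  rw [hG, hco] at this
  have h2 := Complex.hasSum_re this
  simpa only [fourier_two_pi, smul_eq_mul, Complex.ofReal_re] using h2

/-- The real part of a term of a Fourier series is a multiple of a mode, whose phase is the argument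
of the coefficient. -/
theorem re_mul_exp (c : ℂ) (k : ℤ) (y : ℝ) :
    (c * Complex.exp (((k * y : ℝ) : ℂ) * Complex.I)).re = ‖c‖ * mode k c.arg y := by
  conv_lhs => rw [← Complex.norm_mul_exp_arg_mul_I c, mul_assoc, ← Complex.exp_add, ← add_mul,
    ← Complex.ofReal_add, Complex.re_ofReal_mul, Complex.exp_ofReal_mul_I_re, add_comm]
  rfl

/-- A smooth periodic function and its second derivative are series of modes with rapidly
decreasing coefficients. -/
theorem exists_mode_expansion {φ : ℝ → ℝ} (hφ : ContDiff ℝ (⊤ : ℕ∞) φ)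
    (hp : Function.Periodic φ (2 * Real.pi)) :
    ∃ r θ : ℤ → ℝ, (Summable fun k : ℤ => (1 + |(k : ℝ)|) * |r k|) ∧
      (Summable fun k : ℤ => (1 + |(k : ℝ)|) * |(1 + (k : ℝ) ^ 2) * r k|) ∧
      (∀ y, HasSum (fun k => r k * mode k (θ k) y) (φ y)) ∧
      ∀ y, HasSum (fun k : ℤ => -((1 + (k : ℝ) ^ 2) * r k) * mode k (θ k) y)
        (iteratedDeriv 2 φ y - φ y) := by
  have hsm : ∀ m : ℕ, ContDiff ℝ (⊤ : ℕ∞) (iteratedDeriv m φ) := by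
    intro m
    induction m with
    | zero => simpa using hφ
    | succ m ih =>
      rw [iteratedDeriv_succ]
      exact ((contDiff_succ_iff_deriv (n := ((⊤ : ℕ∞) : WithTop ℕ∞))).1 (by simpa using ih)).2.2
  have hper : ∀ m : ℕ, Function.Periodic (iteratedDeriv m φ) (2 * Real.pi) := by
    intro m
    induction m with
    | zero => simpa using hp
    | succ m ih => rw [iteratedDeriv_succ]; exact periodic_deriv ih
  set c : ℕ → ℤ → ℂ := fun m => fourierCoeffOn two_pi_pos (fun x => ((iteratedDeriv m φ x : ℝ) : ℂ))
    with hc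
  have hrec : ∀ m k, c m k = (Complex.I * k) ^ m * c 0 k := by
    intro m k
    induction m with
    | zero => simp
    | succ m ih =>
      have := fourierCoeffOn_deriv ((hsm m).of_le (by exact_mod_cast le_top)) (hper m) k
      rw [← iteratedDeriv_succ] at this
      rw [hc] at ih ⊢
      simp only at ih ⊢
      rw [this, ih]
      ring
  have hnorm : ∀ m k, ‖c m k‖ = |(k : ℝ)| ^ m * ‖c 0 k‖ := by
    intro m k
    rw [hrec, norm_mul, norm_pow, norm_mul, Complex.norm_I, one_mul]
    simp
  obtain ⟨C0, hC0⟩ := fourierCoeffOn_bound (hsm 0).continuous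
  obtain ⟨C6, hC6⟩ := fourierCoeffOn_bound (hsm 6).continuous
  have hdecay : ∀ k : ℤ, (1 + |(k : ℝ)|) * ((1 + (k : ℝ) ^ 2) * ‖c 0 k‖) ≤
      (8 * (C0 + C6)) * (1 / (1 + (k : ℝ) ^ 2)) := by
    intro k
    have h0 : ‖c 0 k‖ ≤ C0 := hC0 k
    have h6 : |(k : ℝ)| ^ 6 * ‖c 0 k‖ ≤ C6 := by rw [← hnorm]; exact hC6 k
    rw [mul_one_div, le_div_iff₀ (by positivity)]
    set a := |(k : ℝ)| with ha
    have ha0 : 0 ≤ a := abs_nonneg _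
    rw [← sq_abs (k : ℝ), ← ha]
    have key : (1 + a) * (1 + a ^ 2) * (1 + a ^ 2) ≤ 8 * (1 + a ^ 6) := by
      rcases le_total a 1 with h | h
      · have h2 : a ^ 2 ≤ 1 := pow_le_one₀ ha0 h
        calc (1 + a) * (1 + a ^ 2) * (1 + a ^ 2) ≤ (1 + 1) * (1 + 1) * (1 + 1) := by gcongr
          _ ≤ 8 * (1 + a ^ 6) := by nlinarith [pow_nonneg ha0 6]
      · have h2 : a ≤ a ^ 2 := by nlinarith
        have h3 : 1 ≤ a ^ 2 := by nlinarith
        calc (1 + a) * (1 + a ^ 2) * (1 + a ^ 2)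
            ≤ (a ^ 2 + a ^ 2) * (a ^ 2 + a ^ 2) * (a ^ 2 + a ^ 2) := by gcongr
          _ ≤ 8 * (1 + a ^ 6) := by ring_nf; linarith
    calc _ = ((1 + a) * (1 + a ^ 2) * (1 + a ^ 2)) * ‖c 0 k‖ := by ring
      _ ≤ (8 * (1 + a ^ 6)) * ‖c 0 k‖ := by gcongr
      _ ≤ _ := by linarith
  have hsum2 : Summable fun k : ℤ => (1 + |(k : ℝ)|) * |(1 + (k : ℝ) ^ 2) * ‖c 0 k‖| := by
    refine Summable.of_nonneg_of_le (fun k => by positivity) (fun k => ?_)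
      (summable_one_div_one_add_sq.mul_left (8 * (C0 + C6)))
    rw [abs_of_nonneg (a := (1 + (k : ℝ) ^ 2) * ‖c 0 k‖) (by positivity)]
    exact hdecay k
  have hsum0 : Summable fun k : ℤ => (1 + |(k : ℝ)|) * |‖c 0 k‖| := by
    refine Summable.of_nonneg_of_le (fun k => by positivity) (fun k => ?_) hsum2
    rw [abs_mul]
    gcongr
    exact le_mul_of_one_le_left (abs_nonneg _) (le_abs.2 (Or.inl (by nlinarith [sq_nonneg (k : ℝ)])))
  have hs0 : Summable (c 0) := by
    refine Summable.of_norm_bounded hsum0 fun k => ?_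
    rw [abs_of_nonneg (norm_nonneg _)]
    exact le_mul_of_one_le_left (norm_nonneg _) (by simp)
  have hs2 : Summable (c 2) := by
    refine Summable.of_norm_bounded hsum2 fun k => ?_
    rw [hnorm, sq_abs, abs_of_nonneg (a := (1 + (k : ℝ) ^ 2) * ‖c 0 k‖) (by positivity)]
    calc (k : ℝ) ^ 2 * ‖c 0 k‖ ≤ (1 + (k : ℝ) ^ 2) * ‖c 0 k‖ := by gcongr; linarith
      _ ≤ _ := le_mul_of_one_le_left (by positivity) (by simp)
  have h0 : ∀ y, HasSum (fun k => ‖c 0 k‖ * mode k (c 0 k).arg y) (φ y) := by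
    intro y
    have := hasSum_mode_of_summable (hsm 0).continuous (hper 0) hs0 y
    simp only [re_mul_exp] at this
    have e0 : iteratedDeriv 0 φ y = φ y := by rw [iteratedDeriv_zero]
    rw [← e0]
    exact this
  refine ⟨fun k => ‖c 0 k‖, fun k => (c 0 k).arg, hsum0, hsum2, h0, fun y => ?_⟩
  have h2 := (hasSum_mode_of_summable (hsm 2).continuous (hper 2) hs2 y).sub (h0 y)
  refine h2.congr_fun ?_
  intro k
  have e : fourierCoeffOn two_pi_pos (fun x => ((iteratedDeriv 2 φ x : ℝ) : ℂ)) k =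
      ((-(k : ℝ) ^ 2 : ℝ) : ℂ) * c 0 k := by
    have := hrec 2 k
    rw [mul_pow, Complex.I_sq] at this
    refine this.trans ?_
    push_cast
    ring
  rw [e, mul_assoc, Complex.re_ofReal_mul, re_mul_exp]
  ring

/-! ### Linear equations with integrable forcing -/

theorem integral_exp_decay (l r t : ℝ) :
    ∫ s in r..t, l * Real.exp (-(l * (s - r))) = 1 - Real.exp (-(l * (t - r))) := by
  have hd : ∀ s ∈ uIcc r t, HasDerivAt (fun s => -Real.exp (-(l * (s - r))))
      (l * Real.exp (-(l * (s - r)))) s := by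
    intro s _
    have h1 : HasDerivAt (fun s : ℝ => -(l * (s - r))) (-(l * 1)) s :=
      (((hasDerivAt_id s).sub_const r).const_mul l).neg
    have h2 := h1.exp.neg
    exact h2.congr_deriv (by ring)
  rw [intervalIntegral.integral_eq_sub_of_hasDerivAt hd
    (Continuous.intervalIntegrable (by fun_prop) _ _)]
  simp
  ring

/-- The convolution of an integrable forcing with an exponential solves the corresponding linear
equation in integrated form; this is an exchange of integrals over the triangle `r ≤ s ≤ t`. -/
theorem integral_exp_convolution {F : Type*} [NormedAddCommGroup F] [NormedSpace ℝ F]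
    [CompleteSpace F] {b : ℝ → F} {t : ℝ} (ht : 0 ≤ t)
    (hb : IntervalIntegrable b volume 0 t) (l : ℝ) :
    ∫ s in (0)..t, l • ∫ r in (0)..s, Real.exp (-(l * (s - r))) • b r =
      (∫ r in (0)..t, b r) - ∫ r in (0)..t, Real.exp (-(l * (t - r))) • b r := by
  set μ := volume.restrict (Ioc 0 t) with hμ
  have hb' : Integrable b μ := (intervalIntegrable_iff_integrableOn_Ioc_of_le ht).1 hb
  let f : ℝ → ℝ → F := fun s r =>
    {z : ℝ × ℝ | z.2 ≤ z.1}.indicator (fun z => (l * Real.exp (-(l * (z.1 - z.2)))) • b z.2) (s, r)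
  have hm : MeasurableSet {z : ℝ × ℝ | z.2 ≤ z.1} := measurableSet_le measurable_snd measurable_fst
  have hint : Integrable (Function.uncurry f) (μ.prod μ) := by
    have : Function.uncurry f = {z : ℝ × ℝ | z.2 ≤ z.1}.indicator
        (fun z => (l * Real.exp (-(l * (z.1 - z.2)))) • b z.2) := rfl
    rw [this]
    refine Integrable.indicator ?_ hm
    have hc : Continuous fun z : ℝ × ℝ => l * Real.exp (-(l * (z.1 - z.2))) := by fun_prop
    obtain ⟨C, hC⟩ := (isCompact_Icc.prod isCompact_Icc).exists_bound_of_continuousOn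
      (s := Icc 0 t ×ˢ Icc 0 t) hc.continuousOn
    refine Integrable.bdd_smul (φ := fun z : ℝ × ℝ => l * Real.exp (-(l * (z.1 - z.2))))
      (hb'.comp_snd μ) C hc.aestronglyMeasurable ?_
    have h1 : ∀ᵐ z ∂(μ.prod μ), z.1 ∈ Ioc 0 t :=
      Measure.quasiMeasurePreserving_fst.ae (ae_restrict_mem measurableSet_Ioc)
    have h2 : ∀ᵐ z ∂(μ.prod μ), z.2 ∈ Ioc 0 t :=
      Measure.quasiMeasurePreserving_snd.ae (ae_restrict_mem measurableSet_Ioc)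
    filter_upwards [h1, h2] with z hz1 hz2
    exact hC z ⟨Ioc_subset_Icc_self hz1, Ioc_subset_Icc_self hz2⟩
  have hswap := integral_integral_swap hint
  have hl : ∀ s ∈ Ioc 0 t, ∫ r, f s r ∂μ =
      l • ∫ r in (0)..s, Real.exp (-(l * (s - r))) • b r := by
    intro s hs
    have e : ∀ r, f s r = (Iic s).indicator (fun r => l • Real.exp (-(l * (s - r))) • b r) r := by
      intro r
      simp only [f, indicator_apply, mem_ofPred_eq, mem_Iic, mul_smul]
    simp only [e]
    rw [hμ, setIntegral_indicator measurableSet_Iic, Ioc_inter_Iic, min_eq_right hs.2,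
      integral_smul, intervalIntegral.integral_of_le hs.1.le]
  have hr : ∀ r ∈ Ioc 0 t, ∫ s, f s r ∂μ = b r - Real.exp (-(l * (t - r))) • b r := by
    intro r hr
    have e : ∀ s, f s r = (Ici r).indicator (fun s => (l * Real.exp (-(l * (s - r)))) • b r) s := by
      intro s
      simp only [f, indicator_apply, mem_ofPred_eq, mem_Ici]
    simp only [e]
    have e2 : Ioc 0 t ∩ Ici r = Icc r t := by
      ext s
      simp only [mem_inter_iff, mem_Ioc, mem_Ici, mem_Icc]
      constructor
      · rintro ⟨⟨_, h⟩, h'⟩; exact ⟨h', h⟩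
      · rintro ⟨h', h⟩; exact ⟨⟨hr.1.trans_le h', h⟩, h'⟩
    rw [hμ, setIntegral_indicator measurableSet_Ici, e2, integral_Icc_eq_integral_Ioc,
      ← intervalIntegral.integral_of_le hr.2, intervalIntegral.integral_smul_const,
      integral_exp_decay, sub_smul, one_smul]
  rw [intervalIntegral.integral_of_le ht, intervalIntegral.integral_of_le ht,
    intervalIntegral.integral_of_le ht, ← integral_sub hb', ← setIntegral_congr_fun
    measurableSet_Ioc (fun s hs => hl s hs), hswap, setIntegral_congr_fun measurableSet_Ioc
    (fun s hs => hr s hs)]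
  have := hb.continuousOn_smul (f := fun r => Real.exp (-(l * (t - r)))) (by fun_prop)
  exact (intervalIntegrable_iff_integrableOn_Ioc_of_le ht).1 this

theorem continuousOn_exp_convolution {F : Type*} [NormedAddCommGroup F] [NormedSpace ℝ F]
    [CompleteSpace F] {b : ℝ → F} {T : ℝ} (hT : 0 ≤ T)
    (hb : IntervalIntegrable b volume 0 T) (l : ℝ) :
    ContinuousOn (fun t => ∫ s in (0)..t, Real.exp (-(l * (t - s))) • b s) (Icc 0 T) := by
  have e : ∀ t, ∫ s in (0)..t, Real.exp (-(l * (t - s))) • b s =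
      Real.exp (-(l * t)) • ∫ s in (0)..t, Real.exp (l * s) • b s := by
    intro t
    rw [← intervalIntegral.integral_smul]
    congr 1
    ext s
    rw [smul_smul, ← Real.exp_add]
    ring_nf
  simp only [e]
  refine ContinuousOn.smul (by fun_prop) ?_
  have hi := hb.continuousOn_smul (f := fun r => Real.exp (l * r)) (by fun_prop)
  have := intervalIntegral.continuousOn_primitive_interval
    (f := fun s => Real.exp (l * s) • b s) (μ := volume) (a := 0) (b := T) (by
      rw [uIcc_of_le hT, integrableOn_Icc_iff_integrableOn_Ioc]
      exact (intervalIntegrable_iff_integrableOn_Ioc_of_le hT).1 hi)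
  rwa [uIcc_of_le hT] at this

theorem eq_zero_of_integral_equation {F : Type*} [NormedAddCommGroup F] [NormedSpace ℝ F]
    [CompleteSpace F] {d : ℝ → F} {T : ℝ} (hT : 0 ≤ T) (hd : ContinuousOn d (Icc 0 T)) (l : ℝ)
    (h : ∀ t ∈ Icc 0 T, d t = -(∫ s in (0)..t, l • d s)) : ∀ t ∈ Icc 0 T, d t = 0 := by
  set D : ℝ → F := fun t => d (projIcc 0 T hT t) with hD
  have hDc : Continuous D := by
    have := (continuousOn_iff_continuous_domRestrict.1 hd).comp (continuous_projIcc (h := hT))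
    exact this
  have hDd : ∀ t ∈ Icc 0 T, D t = d t := fun t ht => by simp [hD, projIcc_of_mem hT ht]
  have h' : ∀ t ∈ Icc 0 T, d t = -(l • ∫ s in (0)..t, D s) := by
    intro t ht
    rw [h t ht, intervalIntegral.integral_smul]
    congr 2
    refine intervalIntegral.integral_congr fun s hs => ?_
    rw [uIcc_of_le ht.1] at hs
    exact (hDd s ⟨hs.1, hs.2.trans ht.2⟩).symm
  have hP : ∀ t, HasDerivAt (fun t => ∫ s in (0)..t, D s) (D t) t := fun t =>
    (hDc.integral_hasStrictDerivAt 0 t).hasDerivAt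
  -- `exp (l t)` is an integrating factor for the primitive of `d`
  have hE : ∀ t, HasDerivAt (fun t => Real.exp (l * t) • ∫ s in (0)..t, D s)
      (Real.exp (l * t) • D t + (Real.exp (l * t) * l) • ∫ s in (0)..t, D s) t := by
    intro t
    have h1 : HasDerivAt (fun t : ℝ => Real.exp (l * t)) (Real.exp (l * t) * l) t := by
      have h2 : HasDerivAt (fun t : ℝ => l * t) (l * 1) t := (hasDerivAt_id t).const_mul l
      simpa using h2.exp
    exact h1.smul (hP t)
  intro t ht
  have hc := constant_of_has_deriv_right_zero (a := 0) (b := T)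
    (f := fun t => Real.exp (l * t) • ∫ s in (0)..t, D s)
    (fun t _ => (hE t).continuousAt.continuousWithinAt) (fun x hx => by
      have hx' : x ∈ Icc 0 T := Ico_subset_Icc_self hx
      have h0 : Real.exp (l * x) • D x + (Real.exp (l * x) * l) • ∫ s in (0)..x, D s = 0 := by
        rw [hDd x hx', h' x hx']
        module
      have := (hE x).hasDerivWithinAt (s := Ici x)
      rwa [h0] at this) t ht
  have h0 : ∫ s in (0)..t, D s = 0 := by
    simpa [(Real.exp_pos _).ne'] using hc
  rw [h' t ht, h0]
  simp

/-- The equation `y' = -l y + b` in integrated form is equivalent to Duhamel's formula. -/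
theorem integral_equation_iff_duhamel {F : Type*} [NormedAddCommGroup F] [NormedSpace ℝ F]
    [CompleteSpace F] {y b : ℝ → F} {T : ℝ} (hT : 0 ≤ T) (hy : ContinuousOn y (Icc 0 T))
    (hb : IntervalIntegrable b volume 0 T) (l : ℝ) :
    (∀ t ∈ Icc 0 T, y t = y 0 - (∫ s in (0)..t, l • y s) + ∫ s in (0)..t, b s) ↔
      ∀ t ∈ Icc 0 T, y t = Real.exp (-(l * t)) • y 0 +
        ∫ s in (0)..t, Real.exp (-(l * (t - s))) • b s := by
  set z : ℝ → F := fun t => Real.exp (-(l * t)) • y 0 +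
        ∫ s in (0)..t, Real.exp (-(l * (t - s))) • b s with hz
  have hzc : ContinuousOn z (Icc 0 T) :=
    ContinuousOn.add (by fun_prop) (continuousOn_exp_convolution hT hb l)
  have hii : ∀ {w : ℝ → F}, ContinuousOn w (Icc 0 T) → ∀ t ∈ Icc 0 T,
      IntervalIntegrable (fun s => l • w s) volume 0 t := by
    intro w hw t ht
    refine ContinuousOn.intervalIntegrable ?_
    rw [uIcc_of_le ht.1]
    exact (hw.mono (Icc_subset_Icc_right ht.2)).const_smul l
  have hze : ∀ t ∈ Icc 0 T, z t = y 0 - (∫ s in (0)..t, l • z s) + ∫ s in (0)..t, b s := by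
    intro t ht
    have hbt : IntervalIntegrable b volume 0 t :=
      hb.mono_set (by rw [uIcc_of_le ht.1, uIcc_of_le hT]; exact Icc_subset_Icc_right ht.2)
    have h1 := integral_exp_convolution ht.1 hbt l
    have h2 : ∫ s in (0)..t, l • z s = (∫ s in (0)..t, l • Real.exp (-(l * s)) • y 0) +
        ∫ s in (0)..t, l • ∫ r in (0)..s, Real.exp (-(l * (s - r))) • b r := by
      simp only [hz, smul_add]
      rw [intervalIntegral.integral_add]
      · exact Continuous.intervalIntegrable (by fun_prop) _ _
      · exact hii (continuousOn_exp_convolution hT hb l) t ht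
    have h3 : ∫ s in (0)..t, l • Real.exp (-(l * s)) • y 0 = (1 - Real.exp (-(l * t))) • y 0 := by
      have := integral_exp_decay l 0 t
      simp only [sub_zero] at this
      rw [← this, ← intervalIntegral.integral_smul_const]
      simp only [mul_smul]
    rw [h2, h1, h3, hz]
    module
  constructor
  · intro h
    have hd := eq_zero_of_integral_equation (d := fun t => y t - z t) hT (hy.sub hzc) l
      (fun t ht => by
        simp only [smul_sub]
        rw [intervalIntegral.integral_sub (hii hy t ht) (hii hzc t ht)]
        nth_rewrite 1 [h t ht, hze t ht]
        abel)
    intro t ht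
    exact sub_eq_zero.1 (hd t ht)
  · intro h t ht
    have e : ∫ s in (0)..t, l • z s = ∫ s in (0)..t, l • y s := by
      refine intervalIntegral.integral_congr fun s hs => ?_
      rw [uIcc_of_le ht.1] at hs
      simp only [hz, h s ⟨hs.1, hs.2.trans ht.2⟩]
    rw [show y t = z t from h t ht, hze t ht, e]

section

/-! ### Time-dependent families of functionals -/

/-- A family `L s`, `0 < s ≤ T`, of functionals bounded in the Lipschitz norm, with an integrable
bound `V s`, depending measurably on time. -/
structure LipFamily {n : ℕ} (T : ℝ) (L : ℝ → (ℝ → ℝ) → E n) (V : ℝ → ℝ) : Prop where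
  lip : ∀ᵐ s ∂(volume.restrict (Ioc 0 T)), LipFunctional (L s) (V s)
  integrable : IntegrableOn V (Ioc 0 T)
  measurable : ∀ k θ, AEStronglyMeasurable (fun s => L s (mode k θ)) (volume.restrict (Ioc 0 T))

/-- On the heat kernels the family `L s` is bounded by `κ τ + V s` with an integrable `κ`, where
`τ` is the time of the heat kernel. The Lipschitz norm of the heat kernel is of order `τ⁻¹`, and
does not give such a bound. -/
structure HeatBound {n : ℕ} (T : ℝ) (L : ℝ → (ℝ → ℝ) → E n) (V κ : ℝ → ℝ) : Prop where
  integrable : IntegrableOn κ (Ioc 0 T)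
  bound : ∀ᵐ s ∂(volume.restrict (Ioc 0 T)), ∀ τ ∈ Ioc 0 T, ∀ x,
    ‖L s fun y => heatKernel τ (x - y)‖ ≤ κ τ + V s

variable {n : ℕ} {T : ℝ} {L M : ℝ → (ℝ → ℝ) → E n} {V W κ μ : ℝ → ℝ}

theorem LipFamily.add (hL : LipFamily T L V) (hM : LipFamily T M W) :
    LipFamily T (fun s φ => L s φ + M s φ) (fun s => V s + W s) where
  lip := by
    filter_upwards [hL.lip, hM.lip] with s h1 h2
    exact h1.add h2
  integrable := hL.integrable.add hM.integrable
  measurable k θ := (hL.measurable k θ).add (hM.measurable k θ)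

theorem HeatBound.add (hL : HeatBound T L V κ) (hM : HeatBound T M W μ) :
    HeatBound T (fun s φ => L s φ + M s φ) (fun s => V s + W s) (fun s => κ s + μ s) where
  integrable := hL.integrable.add hM.integrable
  bound := by
    filter_upwards [hL.bound, hM.bound] with s h1 h2 τ hτ x
    refine (norm_add_le _ _).trans ?_
    have := h1 τ hτ x
    have := h2 τ hτ x
    linarith

theorem LipFamily.mono (h : LipFamily T L V) {t : ℝ} (ht : t ≤ T) : LipFamily t L V where
  lip := ae_restrict_of_ae_restrict_of_subset (Ioc_subset_Ioc_right ht) h.lip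
  integrable := h.integrable.mono_set (Ioc_subset_Ioc_right ht)
  measurable k θ := (h.measurable k θ).mono_measure
    (Measure.restrict_mono (Ioc_subset_Ioc_right ht) le_rfl)

theorem HeatBound.mono (h : HeatBound T L V κ) {t : ℝ} (ht : t ≤ T) : HeatBound t L V κ where
  integrable := h.integrable.mono_set (Ioc_subset_Ioc_right ht)
  bound := by
    filter_upwards [ae_restrict_of_ae_restrict_of_subset (Ioc_subset_Ioc_right ht) h.bound]
      with s hs τ hτ x
    exact hs τ ⟨hτ.1, hτ.2.trans ht⟩ x

theorem LipFamily.intervalIntegrable_mode (h : LipFamily T L V) (hT : 0 ≤ T) (k : ℤ) (θ : ℝ) :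
    IntervalIntegrable (fun s => L s (mode k θ)) volume 0 T := by
  rw [intervalIntegrable_iff_integrableOn_Ioc_of_le hT]
  refine Integrable.mono' (h.integrable.mul_const (1 + |(k : ℝ)|)) (h.measurable k θ) ?_
  filter_upwards [h.lip] with s hs
  exact hs.norm_mode_le k θ

theorem aestronglyMeasurable_of_hasSum_modes {φ : ℝ → ℝ → ℝ}
    {r θ : ℤ → ℝ → ℝ} (hr : ∀ k, AEStronglyMeasurable (r k) (volume.restrict (Ioc 0 T)))
    (hθ : ∀ k, AEStronglyMeasurable (fun s => L s (mode k (θ k s))) (volume.restrict (Ioc 0 T)))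
    (hφ : ∀ᵐ s ∂(volume.restrict (Ioc 0 T)),
      HasSum (fun k => r k s • L s (mode k (θ k s))) (L s (φ s))) :
    AEStronglyMeasurable (fun s => L s (φ s)) (volume.restrict (Ioc 0 T)) := by
  refine aestronglyMeasurable_of_tendsto_ae (atTop : Filter (Finset ℤ))
    (f := fun S s => ∑ k ∈ S, r k s • L s (mode k (θ k s))) (fun S => ?_) ?_
  · exact Finset.aestronglyMeasurable_fun_sum S fun k _ => (hr k).smul (hθ k)
  · filter_upwards [hφ] with s hs
    exact hs

/-- A time-dependent family can be applied term by term to a series of modes under the time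
integral. -/
theorem LipFamily.integral_series (h : LipFamily T L V) (hT : 0 ≤ T) {φ : ℝ → ℝ} {r θ : ℤ → ℝ}
    (hr : Summable fun k : ℤ => (1 + |(k : ℝ)|) * |r k|)
    (hφ : ∀ y ∈ I, HasSum (fun k => r k * mode k (θ k) y) (φ y)) :
    IntervalIntegrable (fun s => L s φ) volume 0 T ∧
      HasSum (fun k => r k • ∫ s in (0)..T, L s (mode k (θ k))) (∫ s in (0)..T, L s φ) := by
  have hs : ∀ᵐ s ∂(volume.restrict (Ioc 0 T)), HasSum (fun k => r k • L s (mode k (θ k))) (L s φ) := by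
    filter_upwards [h.lip] with s hs
    exact hs.hasSum hr hφ
  have hm : AEStronglyMeasurable (fun s => L s φ) (volume.restrict (Ioc 0 T)) :=
    aestronglyMeasurable_of_hasSum_modes (φ := fun _ => φ) (r := fun k _ => r k) (θ := fun k _ => θ k)
      (fun _ => aestronglyMeasurable_const) (fun k => h.measurable k _) hs
  constructor
  · obtain ⟨A, B, hAB⟩ := isLip_of_hasSum hr hφ
    rw [intervalIntegrable_iff_integrableOn_Ioc_of_le hT]
    refine Integrable.mono' (h.integrable.mul_const (A + B)) hm ?_
    filter_upwards [h.lip] with s hs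
    exact hs.bound φ A B hAB
  · simp only [← intervalIntegral.integral_smul]
    have hlip := (ae_restrict_iff' measurableSet_Ioc).1 h.lip
    refine intervalIntegral.hasSum_integral_of_dominated_convergence
      (fun k s => V s * ((1 + |(k : ℝ)|) * |r k|)) (fun k => ?_) (fun k => ?_) ?_ ?_ ?_
    · rw [uIoc_of_le hT]
      exact (h.measurable k (θ k)).const_smul (r k)
    · rw [uIoc_of_le hT]
      filter_upwards [hlip] with s hs hsT
      rw [norm_smul, Real.norm_eq_abs]
      calc _ ≤ |r k| * (V s * (1 + |(k : ℝ)|)) := by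
            gcongr; exact (hs hsT).norm_mode_le _ _
        _ = _ := by ring
    · exact Eventually.of_forall fun s _ => hr.mul_left _
    · simp only [tsum_mul_left]
      exact ((intervalIntegrable_iff_integrableOn_Ioc_of_le hT).2 h.integrable).mul_const _
    · rw [uIoc_of_le hT]
      filter_upwards [(ae_restrict_iff' measurableSet_Ioc).1 hs] with s hs hsT
      exact hs hsT

theorem ae_restrict_lt (T : ℝ) : ∀ᵐ s ∂(volume.restrict (Ioc 0 T)), s ∈ Ioo 0 T := by
  have h1 : ∀ᵐ s ∂(volume.restrict (Ioc 0 T)), s ≠ T := ae_restrict_of_ae (by simp [ae_iff])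
  filter_upwards [ae_restrict_mem measurableSet_Ioc, h1] with s hs hsT
  exact ⟨hs.1, lt_of_le_of_ne hs.2 hsT⟩

theorem continuous_heatCoeff (k : ℤ) : Continuous (heatCoeff k) := by
  unfold heatCoeff; fun_prop

theorem HeatBound.ae_bound (hb : HeatBound T L V κ) :
    ∀ᵐ s ∂(volume.restrict (Ioc 0 T)), ∀ x,
      ‖L s fun y => heatKernel (T - s) (x - y)‖ ≤ κ (T - s) + V s := by
  filter_upwards [hb.bound, ae_restrict_lt T] with s hs hsT x
  exact hs (T - s) ⟨by linarith [hsT.2], by linarith [hsT.1]⟩ x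

theorem HeatBound.intervalIntegrable_bound (h : LipFamily T L V) (hb : HeatBound T L V κ)
    (hT : 0 ≤ T) : IntervalIntegrable (fun s => κ (T - s) + V s) volume 0 T := by
  have h1 : IntervalIntegrable κ volume 0 T :=
    (intervalIntegrable_iff_integrableOn_Ioc_of_le hT).2 hb.integrable
  have h2 := h1.comp_sub_left T
  simp only [sub_zero, sub_self] at h2
  exact h2.symm.add ((intervalIntegrable_iff_integrableOn_Ioc_of_le hT).2 h.integrable)

theorem LipFamily.aestronglyMeasurable_heat (h : LipFamily T L V) (x : ℝ) :
    AEStronglyMeasurable (fun s => L s fun y => heatKernel (T - s) (x - y))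
      (volume.restrict (Ioc 0 T)) := by
  refine aestronglyMeasurable_of_hasSum_modes (φ := fun s y => heatKernel (T - s) (x - y))
    (r := fun k s => heatCoeff k (T - s)) (θ := fun k _ => -(k * x)) (fun k => ?_)
    (fun k => h.measurable _ _) ?_
  · exact ((continuous_heatCoeff k).comp (continuous_const.sub continuous_id)).aestronglyMeasurable
  · filter_upwards [h.lip, ae_restrict_lt T] with s hs hsT
    exact hs.hasSum_heatKernel (by linarith [hsT.2]) x

theorem LipFamily.intervalIntegrable_heat (h : LipFamily T L V) (hb : HeatBound T L V κ)
    (hT : 0 ≤ T) (x : ℝ) :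
    IntervalIntegrable (fun s => L s fun y => heatKernel (T - s) (x - y)) volume 0 T := by
  have := HeatBound.intervalIntegrable_bound h hb hT
  rw [intervalIntegrable_iff_integrableOn_Ioc_of_le hT] at this ⊢
  refine Integrable.mono' this (h.aestronglyMeasurable_heat x) ?_
  filter_upwards [hb.ae_bound] with s hs
  exact hs x

theorem LipFamily.continuous_integral_heat (h : LipFamily T L V) (hb : HeatBound T L V κ)
    (hT : 0 ≤ T) :
    Continuous fun x => ∫ s in (0)..T, L s fun y => heatKernel (T - s) (x - y) := by
  refine intervalIntegral.continuous_of_dominated_interval (bound := fun s => κ (T - s) + V s)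
    (fun x => ?_) (fun x => ?_) (HeatBound.intervalIntegrable_bound h hb hT) ?_
  · rw [uIoc_of_le hT]
    exact h.aestronglyMeasurable_heat x
  · rw [uIoc_of_le hT]
    filter_upwards [(ae_restrict_iff' measurableSet_Ioc).1 hb.ae_bound] with s hs hsT
    exact hs hsT x
  · rw [uIoc_of_le hT]
    filter_upwards [(ae_restrict_iff' measurableSet_Ioc).1 h.lip,
      (ae_restrict_iff' measurableSet_Ioc).1 (ae_restrict_lt T)] with s hs hs' hsT
    exact (hs hsT).continuous_heatKernel (by linarith [(hs' hsT).2])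

theorem LipFamily.aestronglyMeasurable_heat_prod (h : LipFamily T L V) (ν : Measure ℝ) [SFinite ν] :
    AEStronglyMeasurable (fun z : ℝ × ℝ => L z.1 fun y => heatKernel (T - z.1) (z.2 - y))
      ((volume.restrict (Ioc 0 T)).prod ν) := by
  refine aestronglyMeasurable_of_tendsto_ae (atTop : Filter (Finset ℤ))
    (f := fun S z => ∑ k ∈ S, heatCoeff k (T - z.1) • (mode k 0 z.2 • L z.1 (mode k 0) +
      mode k (-(Real.pi / 2)) z.2 • L z.1 (mode k (-(Real.pi / 2))))) (fun S => ?_) ?_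
  · refine Finset.aestronglyMeasurable_fun_sum S fun k _ => ?_
    have h1 : Continuous fun z : ℝ × ℝ => heatCoeff k (T - z.1) :=
      (continuous_heatCoeff k).comp (continuous_const.sub continuous_fst)
    have h2 : ∀ θ, Continuous fun z : ℝ × ℝ => mode k θ z.2 := fun θ =>
      (continuous_mode k θ).comp continuous_snd
    exact h1.aestronglyMeasurable.smul
      (((h2 _).aestronglyMeasurable.smul (h.measurable k _).comp_fst).add
        ((h2 _).aestronglyMeasurable.smul (h.measurable k _).comp_fst))
  · have h1 : ∀ᵐ z ∂((volume.restrict (Ioc 0 T)).prod ν),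
        LipFunctional (L z.1) (V z.1) ∧ z.1 ∈ Ioo 0 T :=
      Measure.quasiMeasurePreserving_fst.ae (h.lip.and (ae_restrict_lt T))
    filter_upwards [h1] with z hz
    have := hz.1.hasSum_heatKernel (t := T - z.1) (by linarith [hz.2.2]) z.2
    simp only [hz.1.apply_mode_translate] at this
    exact this

/-- The modes of the mild forcing term: the semigroup turns into exponential factors. -/
theorem LipFamily.pairing_integral_heat (h : LipFamily T L V) (hb : HeatBound T L V κ)
    (hT : 0 ≤ T) (l : ℤ) (θ : ℝ) :
    pairing (mode l θ) (fun x => ∫ s in (0)..T, L s fun y => heatKernel (T - s) (x - y)) =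
      ∫ s in (0)..T, Real.exp (-((1 + (l : ℝ) ^ 2) * (T - s))) • L s (mode l θ) := by
  set ν := volume.restrict (Ioc 0 (2 * Real.pi)) with hν
  have hbd := HeatBound.intervalIntegrable_bound h hb hT
  rw [intervalIntegrable_iff_integrableOn_Ioc_of_le hT] at hbd
  have hint : Integrable (Function.uncurry fun s x =>
      mode l θ x • L s fun y => heatKernel (T - s) (x - y))
      ((volume.restrict (Ioc 0 T)).prod ν) := by
    refine Integrable.mono' (Integrable.comp_fst hbd ν)
      (AEStronglyMeasurable.smul
        ((continuous_mode l θ).comp continuous_snd).aestronglyMeasurable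
        (h.aestronglyMeasurable_heat_prod ν)) ?_
    filter_upwards [Measure.quasiMeasurePreserving_fst.ae hb.ae_bound] with z hz
    simp only [Function.uncurry]
    rw [norm_smul]
    have h1 : ‖mode l θ z.2‖ ≤ 1 := Real.abs_cos_le_one _
    exact (mul_le_of_le_one_left (norm_nonneg _) h1).trans (hz z.2)
  have hswap := integral_integral_swap hint
  rw [pairing, intervalIntegral.integral_of_le two_pi_pos.le, intervalIntegral.integral_of_le hT]
  have e1 : ∀ x, mode l θ x • ∫ s in (0)..T, L s (fun y => heatKernel (T - s) (x - y)) =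
      ∫ s in Ioc 0 T, mode l θ x • L s (fun y => heatKernel (T - s) (x - y)) := by
    intro x
    rw [integral_smul, intervalIntegral.integral_of_le hT]
  simp only [e1]
  rw [← hν, ← hswap]
  refine integral_congr_ae ?_
  filter_upwards [h.lip, ae_restrict_lt T] with s hs hsT
  rw [hν, ← intervalIntegral.integral_of_le two_pi_pos.le,
    hs.integral_mode_smul_heatKernel (by linarith [hsT.2])]
  congr 2
  ring

/-! ### Equivalence of the weak and the mild formulation -/

/-- Pairing with an integrable function is bounded in the Lipschitz norm. -/
theorem lipFunctional_pairing {w : ℝ → E n} (hw : IntervalIntegrable w volume 0 (2 * Real.pi)) :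
    LipFunctional (fun φ => pairing φ w) (∫ x in (0)..(2 * Real.pi), ‖w x‖) := by
  have hi : ∀ φ, IsLip φ → IntervalIntegrable (fun x => φ x • w x) volume 0 (2 * Real.pi) :=
    fun φ hφ => hw.continuousOn_smul (by rw [uIcc_two_pi]; exact hφ.continuousOn)
  have h0 : 0 ≤ ∫ x in (0)..(2 * Real.pi), ‖w x‖ :=
    intervalIntegral.integral_nonneg two_pi_pos.le fun _ _ => norm_nonneg _
  refine ⟨fun φ ψ hφ hψ => ?_, fun c φ hφ => ?_, fun φ A B hφ => ?_⟩
  · simp only [pairing, add_smul]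
    exact intervalIntegral.integral_add (hi φ hφ) (hi ψ hψ)
  · simp only [pairing, mul_smul]
    exact intervalIntegral.integral_smul _ _
  · have hB := hφ.nonneg.2
    calc ‖pairing φ w‖ ≤ ∫ x in (0)..(2 * Real.pi), A * ‖w x‖ := by
          refine intervalIntegral.norm_integral_le_of_norm_le two_pi_pos.le ?_
            (hw.norm.const_mul A)
          refine Eventually.of_forall fun x hx => ?_
          rw [norm_smul]
          gcongr
          exact hφ.1 x (Ioc_subset_Icc_self hx)
      _ = (∫ x in (0)..(2 * Real.pi), ‖w x‖) * A := by
          rw [intervalIntegral.integral_const_mul, mul_comm]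
      _ ≤ _ := by nlinarith

theorem intervalIntegrable_of_continuousOn_I {F : Type*} [NormedAddCommGroup F] {w : ℝ → F}
    (hw : ContinuousOn w I) : IntervalIntegrable w volume 0 (2 * Real.pi) :=
  ContinuousOn.intervalIntegrable (by rwa [uIcc_two_pi])

theorem continuousOn_pairing {a : ℝ → ℝ → E n} (hT : 0 ≤ T)
    (ha : ContinuousOn (fun q : ℝ × ℝ => a q.1 q.2) (Icc 0 T ×ˢ I)) {φ : ℝ → ℝ}
    (hφ : Continuous φ) : ContinuousOn (fun t => pairing φ (a t)) (Icc 0 T) := by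
  set b : ℝ → ℝ → E n := fun t x => a (projIcc 0 T hT t) (projIcc 0 (2 * Real.pi) two_pi_pos.le x)
  have hb : Continuous (Function.uncurry b) := by
    refine ha.comp_continuous (f := fun z : ℝ × ℝ => ((projIcc 0 T hT z.1 : ℝ),
      (projIcc 0 (2 * Real.pi) two_pi_pos.le z.2 : ℝ))) ?_ fun z =>
      ⟨(projIcc 0 T hT z.1).2, (projIcc 0 (2 * Real.pi) two_pi_pos.le z.2).2⟩
    exact (continuous_subtype_val.comp (continuous_projIcc.comp continuous_fst)).prodMk
      (continuous_subtype_val.comp (continuous_projIcc.comp continuous_snd))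
  have hc : Continuous fun t => pairing φ (b t) := by
    refine intervalIntegral.continuous_parametric_intervalIntegral_of_continuous' ?_ _ _
    exact (hφ.comp continuous_snd).smul hb
  refine hc.continuousOn.congr fun t ht => ?_
  refine intervalIntegral.integral_congr fun x hx => ?_
  rw [uIcc_of_le two_pi_pos.le] at hx
  simp [b, projIcc_of_mem hT ht, projIcc_of_mem two_pi_pos.le hx]

theorem continuousOn_slice {F : Type*} [TopologicalSpace F] {a : ℝ → ℝ → F}
    (ha : ContinuousOn (fun q : ℝ × ℝ => a q.1 q.2) (Icc 0 T ×ˢ I)) {t : ℝ} (ht : t ∈ Icc 0 T) :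
    ContinuousOn (a t) I :=
  ha.comp (f := fun x => (t, x)) (by fun_prop) fun x hx => ⟨ht, hx⟩

theorem lipFamily_pairing_of_continuousOn {a : ℝ → ℝ → E n} (hT : 0 ≤ T)
    (ha : ContinuousOn (fun q : ℝ × ℝ => a q.1 q.2) (Icc 0 T ×ˢ I)) :
    ∃ C, LipFamily T (fun s φ => pairing φ (a s)) (fun _ => C) := by
  obtain ⟨C, hC⟩ := (isCompact_Icc.prod isCompact_Icc).exists_bound_of_continuousOn ha
  refine ⟨C * |2 * Real.pi - 0|, ?_, ?_, fun k θ => ?_⟩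
  · filter_upwards [ae_restrict_mem measurableSet_Ioc] with s hs
    have hs' := Ioc_subset_Icc_self hs
    refine (lipFunctional_pairing (intervalIntegrable_of_continuousOn_I
      (continuousOn_slice ha hs'))).mono ?_
    refine (Real.le_norm_self _).trans ?_
    refine intervalIntegral.norm_integral_le_of_norm_le_const fun x hx => ?_
    rw [uIoc_of_le two_pi_pos.le] at hx
    rw [norm_norm]
    exact hC (s, x) ⟨hs', Ioc_subset_Icc_self hx⟩
  · exact integrableOn_const (by simp)
  · exact ((continuousOn_pairing hT ha (continuous_mode k θ)).mono
      Ioc_subset_Icc_self).aestronglyMeasurable measurableSet_Ioc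

theorem contDiff_mode (k : ℤ) (θ : ℝ) : ContDiff ℝ (⊤ : ℕ∞) (mode k θ) := by
  unfold mode
  fun_prop

theorem periodic_mode (k : ℤ) (θ : ℝ) : Function.Periodic (mode k θ) (2 * Real.pi) := by
  intro x
  have : (k : ℝ) * (x + 2 * Real.pi) + θ = k * x + θ + k * (2 * Real.pi) := by ring
  rw [mode, this, Real.cos_add_int_mul_two_pi, mode]

theorem iteratedDeriv_two_mode (k : ℤ) (θ y : ℝ) :
    iteratedDeriv 2 (mode k θ) y = -(k : ℝ) ^ 2 * mode k θ y := by
  have hl : ∀ y, HasDerivAt (fun y : ℝ => k * y + θ) (k : ℝ) y := fun y => by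
    simpa using ((hasDerivAt_id y).const_mul (k : ℝ)).add_const θ
  have h1 : deriv (mode k θ) = fun y => -Real.sin (k * y + θ) * k :=
    funext fun y => (hl y).cos.deriv
  have h2 : HasDerivAt (fun y => -Real.sin (k * y + θ) * k) (-(Real.cos (k * y + θ) * k) * k) y :=
    (hl y).sin.neg.mul_const (k : ℝ)
  rw [iteratedDeriv_succ, iteratedDeriv_one, h1, h2.deriv, mode]
  ring

/-- The Duhamel formula for all the modes. Both the weak and the mild formulation are equivalent to
it. -/
def ModeDuhamel (T : ℝ) (L : ℝ → (ℝ → ℝ) → E n) (a : ℝ → ℝ → E n) : Prop :=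
  ∀ k θ, ∀ t ∈ Icc 0 T, pairing (mode k θ) (a t) =
    Real.exp (-((1 + (k : ℝ) ^ 2) * t)) • pairing (mode k θ) (a 0) +
      ∫ s in (0)..t, Real.exp (-((1 + (k : ℝ) ^ 2) * (t - s))) • L s (mode k θ)

/-- The weak identity for the modes alone, before it is extended to all test functions. -/
theorem weak_mode_iff {a : ℝ → ℝ → E n} (hT : 0 ≤ T)
    (ha : ContinuousOn (fun q : ℝ × ℝ => a q.1 q.2) (Icc 0 T ×ˢ I)) (hL : LipFamily T L V) :
    ModeDuhamel T L a ↔ ∀ k θ, ∀ t ∈ Icc 0 T, pairing (mode k θ) (a t) =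
      pairing (mode k θ) (a 0) +
        (∫ s in (0)..t, pairing (fun x => iteratedDeriv 2 (mode k θ) x - mode k θ x) (a s)) +
        ∫ s in (0)..t, L s (mode k θ) := by
  unfold ModeDuhamel
  refine forall_congr' fun k => forall_congr' fun θ => ?_
  rw [← integral_equation_iff_duhamel hT (continuousOn_pairing hT ha (continuous_mode k θ))
    (hL.intervalIntegrable_mode hT k θ)]
  have e : ∀ s, pairing (fun x => iteratedDeriv 2 (mode k θ) x - mode k θ x) (a s) =
      -((1 + (k : ℝ) ^ 2) • pairing (mode k θ) (a s)) := by
    intro s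
    simp only [pairing, iteratedDeriv_two_mode]
    rw [← intervalIntegral.integral_smul, ← intervalIntegral.integral_neg]
    congr 1
    ext1 x
    module
  simp only [e, intervalIntegral.integral_neg]
  simp only [sub_eq_add_neg]

theorem weak_iff_modeDuhamel {a : ℝ → ℝ → E n} (hT : 0 ≤ T)
    (ha : ContinuousOn (fun q : ℝ × ℝ => a q.1 q.2) (Icc 0 T ×ˢ I)) (hL : LipFamily T L V) :
    (∀ φ : ℝ → ℝ, ContDiff ℝ (⊤ : ℕ∞) φ → Function.Periodic φ (2 * Real.pi) → ∀ t ∈ Icc 0 T,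
      pairing φ (a t) = pairing φ (a 0) +
        (∫ s in (0)..t, pairing (fun x => iteratedDeriv 2 φ x - φ x) (a s)) +
        ∫ s in (0)..t, L s φ) ↔ ModeDuhamel T L a := by
  rw [weak_mode_iff hT ha hL]
  refine ⟨fun h k θ => h _ (contDiff_mode k θ) (periodic_mode k θ), fun h φ hφ hp t ht => ?_⟩
  obtain ⟨r, θ, hr, hr2, hs, hs2⟩ := exists_mode_expansion hφ hp
  obtain ⟨C, hC⟩ := lipFamily_pairing_of_continuousOn hT ha
  have hpair : ∀ t ∈ Icc 0 T, HasSum (fun k => r k • pairing (mode k (θ k)) (a t))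
      (pairing φ (a t)) := fun t ht =>
    (lipFunctional_pairing (intervalIntegrable_of_continuousOn_I
      (continuousOn_slice ha ht))).hasSum hr fun y _ => hs y
  have h1 := ((hC.mono ht.2).integral_series ht.1 (r := fun k => -((1 + (k : ℝ) ^ 2) * r k))
    (by simpa only [abs_neg] using hr2) fun y _ => hs2 y).2
  have h2 := ((hL.mono ht.2).integral_series ht.1 hr fun y _ => hs y).2
  refine (hpair t ht).unique ?_
  refine (((hpair 0 ⟨le_rfl, hT⟩).add h1).add h2).congr_fun fun k => ?_
  rw [h k (θ k) t ht]
  have e : ∫ s in (0)..t, pairing (fun x => iteratedDeriv 2 (mode k (θ k)) x - mode k (θ k) x) (a s)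
      = -(1 + (k : ℝ) ^ 2) • ∫ s in (0)..t, pairing (mode k (θ k)) (a s) := by
    rw [← intervalIntegral.integral_smul]
    congr 1
    ext1 s
    simp only [pairing, iteratedDeriv_two_mode]
    rw [← intervalIntegral.integral_smul]
    congr 1
    ext1 x
    module
  rw [e]
  module

theorem mild_iff_modeDuhamel {a : ℝ → ℝ → E n} (hT : 0 ≤ T)
    (ha : ContinuousOn (fun q : ℝ × ℝ => a q.1 q.2) (Icc 0 T ×ˢ I)) (hL : LipFamily T L V)
    (hb : HeatBound T L V κ) :
    (∀ x ∈ I, ∀ t ∈ Ioc 0 T, a t x = semigroup t (a 0) x +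
      ∫ s in (0)..t, L s fun y => heatKernel (t - s) (x - y)) ↔ ModeDuhamel T L a := by
  have h0 := lipFunctional_pairing (intervalIntegrable_of_continuousOn_I
    (continuousOn_slice ha ⟨le_rfl, hT⟩))
  -- The right-hand side is continuous in `x`, and its modes are those of the Duhamel formula.
  set m : ℝ → ℝ → E n := fun t x => semigroup t (a 0) x +
      ∫ s in (0)..t, L s fun y => heatKernel (t - s) (x - y) with hm
  have hc1 : ∀ t ∈ Ioc 0 T, Continuous (semigroup t (a 0)) := fun t ht =>
    h0.continuous_heatKernel ht.1
  have hc2 : ∀ t ∈ Ioc 0 T,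
      Continuous fun x => ∫ s in (0)..t, L s fun y => heatKernel (t - s) (x - y) := fun t ht =>
    (hL.mono ht.2).continuous_integral_heat (hb.mono ht.2) ht.1.le
  have hmc : ∀ t ∈ Ioc 0 T, Continuous (m t) := fun t ht => (hc1 t ht).add (hc2 t ht)
  have hmp : ∀ k θ, ∀ t ∈ Ioc 0 T, pairing (mode k θ) (m t) =
      Real.exp (-((1 + (k : ℝ) ^ 2) * t)) • pairing (mode k θ) (a 0) +
        ∫ s in (0)..t, Real.exp (-((1 + (k : ℝ) ^ 2) * (t - s))) • L s (mode k θ) := by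
    intro k θ t ht
    rw [← (hL.mono ht.2).pairing_integral_heat (hb.mono ht.2) ht.1.le k θ]
    have e1 := h0.integral_mode_smul_heatKernel ht.1 k θ
    have e2 : -((1 + (k : ℝ) ^ 2) * t) = -t - (k : ℝ) ^ 2 * t := by ring
    rw [e2, ← e1]
    simp only [pairing, hm, smul_add]
    rw [intervalIntegral.integral_add]
    · rfl
    · exact ((continuous_mode k θ).smul (hc1 t ht)).intervalIntegrable _ _
    · exact ((continuous_mode k θ).smul (hc2 t ht)).intervalIntegrable _ _
  constructor
  · intro h k θ t ht
    rcases eq_or_lt_of_le ht.1 with h' | h'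
    · subst h'; simp
    · have ht' : t ∈ Ioc 0 T := ⟨h', ht.2⟩
      rw [← hmp k θ t ht']
      refine intervalIntegral.integral_congr fun x hx => ?_
      rw [uIcc_two_pi] at hx
      simp only [hm, h x hx t ht']
  · intro h x hx t ht
    have ht' := Ioc_subset_Icc_self ht
    have hat := continuousOn_slice ha ht'
    refine sub_eq_zero.1 (eq_zero_of_pairing_mode_eq_zero (w := fun x => a t x - m t x)
      (hat.sub (hmc t ht).continuousOn) (fun k θ => ?_) x hx)
    have e : pairing (mode k θ) (fun x => a t x - m t x) =
        pairing (mode k θ) (a t) - pairing (mode k θ) (m t) := by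
      simp only [pairing, smul_sub]
      refine intervalIntegral.integral_sub ?_ ?_
      · exact intervalIntegrable_of_continuousOn_I ((continuous_mode k θ).continuousOn.smul hat)
      · exact ((continuous_mode k θ).smul (hmc t ht)).intervalIntegrable _ _
    rw [e, h k θ t ht', hmp k θ t ht, sub_self]

end

/-! ### The heat kernel as a sum of Gaussians -/

/-- The Gaussian `exp(-t) (4πt)^{-1/2} exp(-z²/(4t))`, of which the heat kernel is the periodic
sum. -/
noncomputable def gauss (t z : ℝ) : ℝ :=
  Real.exp (-t) / (2 * √(Real.pi * t)) * Real.exp (-(z ^ 2 / (4 * t)))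

theorem gauss_nonneg (t z : ℝ) : 0 ≤ gauss t z := by unfold gauss; positivity

theorem gauss_prefactor_le {t : ℝ} (ht : 0 < t) : Real.exp (-t) / (2 * √(Real.pi * t)) ≤ 1 / √t := by
  have h1 : Real.exp (-t) ≤ 1 := Real.exp_le_one_iff.2 (by linarith)
  have h2 : √t ≤ 2 * √(Real.pi * t) := by
    have : √t ≤ √(Real.pi * t) := Real.sqrt_le_sqrt (by nlinarith [Real.pi_gt_three])
    linarith [Real.sqrt_nonneg t]
  exact div_le_div₀ zero_le_one h1 (Real.sqrt_pos.2 ht) h2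

theorem exp_neg_sq_le (w : ℝ) : Real.exp (-(w ^ 2 / 4)) ≤ 8 / (1 + w ^ 2) := by
  rw [Real.exp_neg, ← one_div, div_le_div_iff₀ (Real.exp_pos _) (by positivity)]
  have := Real.add_one_le_exp (w ^ 2 / 4)
  nlinarith [sq_nonneg w]

theorem abs_mul_exp_neg_sq_le (w : ℝ) : |w| / 2 * Real.exp (-(w ^ 2 / 4)) ≤ 8 / (1 + w ^ 2) := by
  have h1 : |w| / 2 ≤ Real.exp (w ^ 2 / 8) := by
    refine le_trans ?_ (Real.add_one_le_exp (w ^ 2 / 8))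
    nlinarith [sq_nonneg (|w| - 2), sq_abs w]
  have h2 := Real.add_one_le_exp (w ^ 2 / 8)
  calc |w| / 2 * Real.exp (-(w ^ 2 / 4))
      ≤ Real.exp (w ^ 2 / 8) * Real.exp (-(w ^ 2 / 4)) := by gcongr
    _ = 1 / Real.exp (w ^ 2 / 8) := by
        rw [← Real.exp_add, one_div, ← Real.exp_neg]; ring_nf
    _ ≤ 8 / (1 + w ^ 2) := by
        rw [div_le_div_iff₀ (Real.exp_pos _) (by positivity)]
        nlinarith [sq_nonneg w]

/-- If `y` lies in the cell `[m h, (m + 1) h]`, then its distance to `x` is controlled from below by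
the number of cells in between. -/
theorem one_add_sq_ge_of_mem_cell {c r h x y : ℝ} (hc : 0 < c) (hc1 : c ≤ 1) (hr : 0 < r)
    (hh : c * r ≤ h) (m : ℤ) (hy : y ∈ Icc (m * h) ((m + 1) * h)) :
    c ^ 2 / 8 * (1 + ((m - ⌊x / h⌋ : ℤ) : ℝ) ^ 2) ≤ 1 + ((x - y) / r) ^ 2 := by
  have hh0 : 0 < h := (mul_pos hc hr).trans_le hh
  set m0 := ⌊x / h⌋ with hm0
  have hx1 : m0 * h ≤ x := (le_div_iff₀ hh0).1 (Int.floor_le _)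
  have hx2 : x < (m0 + 1) * h := (div_lt_iff₀ hh0).1 (Int.lt_floor_add_one _)
  set d : ℝ := |((m - m0 : ℤ) : ℝ)| with hd
  rw [← sq_abs ((m - m0 : ℤ) : ℝ), ← hd]
  have hdist : (d - 1) * h ≤ |x - y| := by
    rcases le_total m0 m with hle | hle
    · have : d = m - m0 := by
        rw [hd, abs_of_nonneg (by exact_mod_cast sub_nonneg.2 hle)]; push_cast; ring
      rw [this]
      have := neg_abs_le (x - y)
      nlinarith [hy.1]
    · have : d = m0 - m := by
        rw [hd, abs_of_nonpos (by exact_mod_cast sub_nonpos.2 hle)]; push_cast; ring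
      rw [this]
      have := le_abs_self (x - y)
      nlinarith [hy.2]
  have hc2 : c ^ 2 ≤ 1 := pow_le_one₀ hc.le hc1
  by_cases h2 : |m - m0| ≤ 1
  · have : d ≤ 1 := by rw [hd]; exact_mod_cast h2
    have hd0 : 0 ≤ d := abs_nonneg _
    have : d ^ 2 ≤ 1 := pow_le_one₀ hd0 this
    nlinarith [sq_nonneg ((x - y) / r), sq_nonneg c]
  · have hd2 : 2 ≤ d := by
      rw [hd]
      have : (2 : ℤ) ≤ |m - m0| := by omega
      exact_mod_cast this
    have h3 : c * d / 2 ≤ |(x - y) / r| := by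
      rw [abs_div, abs_of_pos hr, le_div_iff₀ hr]
      calc c * d / 2 * r = (d / 2) * (c * r) := by ring
        _ ≤ (d - 1) * h := by gcongr <;> linarith
        _ ≤ _ := hdist
    have h4 : (c * d / 2) ^ 2 ≤ ((x - y) / r) ^ 2 := by
      rw [← sq_abs ((x - y) / r)]
      gcongr
    nlinarith [sq_nonneg c, mul_le_mul hd2 hd2 (by norm_num) (by linarith)]

theorem gauss_eq {t : ℝ} (ht : 0 < t) (z : ℝ) :
    gauss t z = Real.exp (-t) / (2 * √(Real.pi * t)) * Real.exp (-((z / √t) ^ 2 / 4)) := by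
  rw [gauss, div_pow, Real.sq_sqrt ht.le, div_div, mul_comm t 4]

theorem hasDerivAt_gauss {t : ℝ} (ht : 0 < t) (z : ℝ) :
    HasDerivAt (gauss t) (-(Real.exp (-t) / (2 * √(Real.pi * t)) *
      ((z / √t) / 2 * Real.exp (-((z / √t) ^ 2 / 4))) / √t)) z := by
  have hs : √t ≠ 0 := (Real.sqrt_pos.2 ht).ne'
  have h1 : HasDerivAt (fun z : ℝ => -((z / √t) ^ 2 / 4)) (-((2 * (z / √t) * (1 / √t)) / 4)) z := by
    have := (((hasDerivAt_id z).div_const (√t)).pow 2).div_const 4 |>.neg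
    refine this.congr_deriv ?_
    simp
  have h2 := h1.exp.const_mul (Real.exp (-t) / (2 * √(Real.pi * t)))
  have e : gauss t = fun z => Real.exp (-t) / (2 * √(Real.pi * t)) *
      Real.exp (-((z / √t) ^ 2 / 4)) := funext fun z => gauss_eq ht z
  rw [e]
  refine h2.congr_deriv ?_
  field_simp
  ring

/-- Bounds for the Gaussian around `x` on a cell, in terms of the distance of the cell to `x`. -/
theorem gauss_cell_bounds {c h t : ℝ} (ht : 0 < t) (hc : 0 < c) (hc1 : c ≤ 1) (hh : c * √t ≤ h)
    (x : ℝ) (m : ℤ) :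
    (∀ y ∈ Icc (m * h) ((m + 1) * h),
      gauss t (x - y) ≤ 64 / c ^ 2 / √t * (1 / (1 + ((m - ⌊x / h⌋ : ℤ) : ℝ) ^ 2))) ∧
    ∀ y ∈ Icc (m * h) ((m + 1) * h), ∀ z ∈ Icc (m * h) ((m + 1) * h),
      |gauss t (x - y) - gauss t (x - z)| ≤
        64 / c ^ 2 / √t * (1 / (1 + ((m - ⌊x / h⌋ : ℤ) : ℝ) ^ 2)) / √t * |y - z| := by
  have hr := Real.sqrt_pos.2 ht
  have hcell : ∀ y ∈ Icc (m * h) ((m + 1) * h), 8 / (1 + ((x - y) / √t) ^ 2) ≤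
      64 / c ^ 2 * (1 / (1 + ((m - ⌊x / h⌋ : ℤ) : ℝ) ^ 2)) := by
    intro y hy
    have := one_add_sq_ge_of_mem_cell (x := x) hc hc1 hr hh m hy
    calc 8 / (1 + ((x - y) / √t) ^ 2)
        ≤ 8 / (c ^ 2 / 8 * (1 + ((m - ⌊x / h⌋ : ℤ) : ℝ) ^ 2)) :=
          div_le_div_of_nonneg_left (by norm_num) (by positivity) this
      _ = _ := by field_simp; norm_num
  have hP := gauss_prefactor_le ht
  constructor
  · intro y hy
    rw [gauss_eq ht]
    calc _ ≤ 1 / √t * (64 / c ^ 2 * (1 / (1 + ((m - ⌊x / h⌋ : ℤ) : ℝ) ^ 2))) := by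
          gcongr
          exact (exp_neg_sq_le _).trans (hcell y hy)
      _ = _ := by ring
  · intro y hy z hz
    have hd : ∀ y ∈ Icc (m * h) ((m + 1) * h), HasDerivWithinAt (fun y => gauss t (x - y))
        (Real.exp (-t) / (2 * √(Real.pi * t)) *
      (((x - y) / √t) / 2 * Real.exp (-(((x - y) / √t) ^ 2 / 4))) / √t) (Icc (m * h) ((m + 1) * h)) y := by
      intro y _
      have h1 : HasDerivAt (fun y : ℝ => x - y) (-1) y := by
        simpa using (hasDerivAt_id y).const_sub x
      exact (((hasDerivAt_gauss ht (x - y)).comp y h1).congr_deriv (by ring)).hasDerivWithinAt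
    have hb : ∀ y ∈ Icc (m * h) ((m + 1) * h), ‖Real.exp (-t) / (2 * √(Real.pi * t)) *
        (((x - y) / √t) / 2 * Real.exp (-(((x - y) / √t) ^ 2 / 4))) / √t‖ ≤
        64 / c ^ 2 / √t * (1 / (1 + ((m - ⌊x / h⌋ : ℤ) : ℝ) ^ 2)) / √t := by
      intro y hy
      rw [norm_div, norm_mul, norm_mul, norm_div, norm_div ((x - y) / √t)]
      simp only [Real.norm_eq_abs, abs_of_pos hr, abs_of_pos (Real.exp_pos _), Nat.abs_ofNat,
        abs_mul, abs_of_nonneg (Real.sqrt_nonneg _)]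
      have h1 := (abs_mul_exp_neg_sq_le _).trans (hcell y hy)
      calc _ ≤ 1 / √t * (64 / c ^ 2 * (1 / (1 + ((m - ⌊x / h⌋ : ℤ) : ℝ) ^ 2))) / √t :=
            div_le_div_of_nonneg_right (mul_le_mul hP h1 (by positivity) (by positivity)) hr.le
        _ = _ := by ring
    have := (convex_Icc (m * h) ((m + 1) * h)).norm_image_sub_le_of_norm_hasDerivWithin_le hd hb hz hy
    simpa only [Real.norm_eq_abs] using this

theorem summable_gauss {t : ℝ} (ht : 0 < t) (x : ℝ) :
    Summable fun k : ℤ => gauss t (x - 2 * Real.pi * k) := by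
  have hr := Real.sqrt_pos.2 ht
  -- The points `2πk` belong to cells of size `2π`.
  set c : ℝ := 1 / (1 + √t) with hc
  have hc0 : 0 < c := by positivity
  have hc1 : c ≤ 1 := by rw [hc, div_le_one (by positivity)]; linarith
  have hh : c * √t ≤ 2 * Real.pi := by
    have : c * √t ≤ 1 := by
      rw [hc, one_div, inv_mul_le_iff₀ (by positivity)]; linarith
    linarith [Real.pi_gt_three]
  have hs := ((summable_one_div_one_add_sq).comp_injective
    (sub_left_injective (b := ⌊x / (2 * Real.pi)⌋))).mul_left (64 / c ^ 2 / √t)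
  refine Summable.of_nonneg_of_le (fun k => gauss_nonneg _ _) (fun k => ?_) hs
  have := (gauss_cell_bounds ht hc0 hc1 hh x k).1 (2 * Real.pi * k)
    ⟨by linarith, by nlinarith [Real.pi_pos]⟩
  simpa using this

/-- Poisson summation for the heat kernel. -/
theorem heatKernel_hasSum_gauss {t : ℝ} (ht : 0 < t) (x : ℝ) :
    HasSum (fun k : ℤ => gauss t (x - 2 * Real.pi * k)) (heatKernel t x) := by
  have hpi : (Real.pi : ℂ) ≠ 0 := by exact_mod_cast Real.pi_ne_zero
  have htc : (t : ℂ) ≠ 0 := by exact_mod_cast ht.ne'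
  have hP := Complex.tsum_exp_neg_quadratic (a := ((t / Real.pi : ℝ) : ℂ))
    (by rw [Complex.ofReal_re]; positivity) (Complex.I * x / (2 * Real.pi))
  have hl : ∀ k : ℤ, Complex.exp (-Real.pi * ((t / Real.pi : ℝ) : ℂ) * k ^ 2 +
      2 * Real.pi * (Complex.I * x / (2 * Real.pi)) * k) =
      ((Real.exp (-((k : ℝ) ^ 2 * t)) : ℝ) : ℂ) * Complex.exp (((k * x : ℝ) : ℂ) * Complex.I) := by
    intro k
    rw [Complex.ofReal_exp, ← Complex.exp_add]
    congr 1
    push_cast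
    field_simp
  have hr : ∀ k : ℤ, Complex.exp (-Real.pi / ((t / Real.pi : ℝ) : ℂ) *
      (k + Complex.I * (Complex.I * x / (2 * Real.pi))) ^ 2) =
      ((Real.exp (-((x - 2 * Real.pi * k) ^ 2 / (4 * t))) : ℝ) : ℂ) := by
    intro k
    have e : Complex.I * (Complex.I * x / (2 * Real.pi)) = -(x / (2 * Real.pi)) := by
      rw [← mul_div_assoc, ← mul_assoc, Complex.I_mul_I]; ring
    rw [Complex.ofReal_exp, e]
    congr 1
    push_cast
    field_simp
    ring
  have hpre : (1 : ℂ) / ((t / Real.pi : ℝ) : ℂ) ^ (1 / 2 : ℂ) = ((1 / √(t / Real.pi) : ℝ) : ℂ) := by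
    have : ((1 / 2 : ℝ) : ℂ) = 1 / 2 := by push_cast; rfl
    rw [← this, ← Complex.ofReal_cpow (by positivity), ← Real.sqrt_eq_rpow]
    push_cast
    rfl
  simp only [hl, hr] at hP
  rw [hpre, ← Complex.ofReal_tsum, ← Complex.ofReal_mul] at hP
  have hsum : Summable fun k : ℤ =>
      ((Real.exp (-((k : ℝ) ^ 2 * t)) : ℝ) : ℂ) * Complex.exp (((k * x : ℝ) : ℂ) * Complex.I) := by
    refine Summable.of_norm_bounded ((summable_heatCoeff ht).mul_left (2 * Real.pi * Real.exp t))
      fun k => ?_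
    rw [norm_mul, Complex.norm_exp_ofReal_mul_I, mul_one, Complex.norm_real, Real.norm_eq_abs,
      abs_of_pos (Real.exp_pos _), abs_of_nonneg (heatCoeff_nonneg k t), heatCoeff]
    have e : 2 * Real.pi * Real.exp t *
        ((1 + |(k : ℝ)|) * ((2 * Real.pi)⁻¹ * Real.exp (-t - (k : ℝ) ^ 2 * t))) =
        (1 + |(k : ℝ)|) * Real.exp (-((k : ℝ) ^ 2 * t)) := by
      have h1 : Real.exp (-((k : ℝ) ^ 2 * t)) = Real.exp t * Real.exp (-t - (k : ℝ) ^ 2 * t) := by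
        rw [← Real.exp_add]; ring_nf
      have := Real.pi_ne_zero
      rw [h1]
      field_simp
    rw [e]
    exact le_mul_of_one_le_left (Real.exp_pos _).le (by simp)
  have hre := (Complex.hasSum_re hsum.hasSum).tsum_eq
  rw [hP, Complex.ofReal_re] at hre
  simp only [Complex.re_ofReal_mul, Complex.exp_ofReal_mul_I_re] at hre
  have hk : heatKernel t x = ∑' k : ℤ, gauss t (x - 2 * Real.pi * k) := by
    have e1 : ∀ k : ℤ, Real.exp (-t - (k : ℝ) ^ 2 * t) * Real.cos (k * x) =
        Real.exp (-t) * (Real.exp (-((k : ℝ) ^ 2 * t)) * Real.cos (k * x)) := by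
      intro k
      rw [← mul_assoc, ← Real.exp_add]
      ring_nf
    simp only [heatKernel, e1, tsum_mul_left, gauss]
    rw [hre, ← mul_assoc, ← mul_assoc]
    congr 1
    rw [Real.sqrt_mul Real.pi_pos.le, Real.sqrt_div ht.le]
    have h1 := Real.sqrt_pos.2 ht
    have h2 := Real.sqrt_pos.2 Real.pi_pos
    have h3 : Real.pi = √Real.pi ^ 2 := (Real.sq_sqrt Real.pi_pos.le).symm
    field_simp
    nlinarith
  rw [hk]
  exact (summable_gauss ht x).hasSum

theorem heatKernel_nonneg {t : ℝ} (ht : 0 < t) (x : ℝ) : 0 ≤ heatKernel t x :=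
  (heatKernel_hasSum_gauss ht x).nonneg fun _ => gauss_nonneg _ _

theorem continuous_heatKernel_sub {t : ℝ} (ht : 0 < t) (x : ℝ) :
    ContinuousOn (fun y => heatKernel t (x - y)) I := (isLip_heatKernel ht x).continuousOn

theorem integral_heatKernel {t : ℝ} (ht : 0 < t) (x : ℝ) :
    ∫ y in (0)..(2 * Real.pi), heatKernel t (x - y) = Real.exp (-t) := by
  have hs : HasSum (fun k : ℤ => ∫ y in (0)..(2 * Real.pi), heatCoeff k t * mode k (-(k * x)) y)
      (∫ y in (0)..(2 * Real.pi), heatKernel t (x - y)) := by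
    refine intervalIntegral.hasSum_integral_of_dominated_convergence
      (fun k _ => (1 + |(k : ℝ)|) * |heatCoeff k t|) (fun k => ?_) (fun k => ?_) ?_ ?_ ?_
    · exact ((continuous_mode _ _).const_mul _).aestronglyMeasurable
    · refine Eventually.of_forall fun y _ => ?_
      rw [Real.norm_eq_abs, abs_mul, mul_comm]
      gcongr
      exact (Real.abs_cos_le_one _).trans (by simp)
    · exact Eventually.of_forall fun _ _ => summable_heatCoeff ht
    · exact intervalIntegrable_const
    · exact Eventually.of_forall fun y _ => heatKernel_hasSum ht x y
  have ht' : ∀ k : ℤ, (∫ y in (0)..(2 * Real.pi), heatCoeff k t * mode k (-(k * x)) y) =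
      if k = 0 then Real.exp (-t) else 0 := by
    intro k
    rw [intervalIntegral.integral_const_mul, integral_mode]
    split_ifs with hk
    · subst hk
      have := Real.pi_ne_zero
      simp [heatCoeff]
      field_simp
    · simp
  simp only [ht'] at hs
  exact hs.unique (hasSum_ite_eq 0 _)

/-- The `L¹` bound for the heat kernel. -/
theorem norm_pairing_heatKernel_le {n : ℕ} {w : ℝ → E n} {t C : ℝ} (ht : 0 < t) (x : ℝ)
    (hw : ∀ y ∈ Ioo 0 (2 * Real.pi), ‖w y‖ ≤ C) :
    ‖pairing (fun y => heatKernel t (x - y)) w‖ ≤ C := by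
  have hC : 0 ≤ C := (norm_nonneg _).trans (hw Real.pi ⟨Real.pi_pos, by linarith [Real.pi_pos]⟩)
  have hi := intervalIntegrable_of_continuousOn_I (continuous_heatKernel_sub ht x)
  calc ‖pairing (fun y => heatKernel t (x - y)) w‖
      ≤ ∫ y in (0)..(2 * Real.pi), heatKernel t (x - y) * C := by
        refine intervalIntegral.norm_integral_le_of_norm_le two_pi_pos.le ?_ (hi.mul_const C)
        filter_upwards [(ae_restrict_iff' measurableSet_Ioc).1 (ae_restrict_lt (2 * Real.pi))]
          with y hy hy'
        rw [norm_smul, Real.norm_eq_abs, abs_of_nonneg (heatKernel_nonneg ht _)]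
        exact mul_le_mul_of_nonneg_left (hw y (hy hy')) (heatKernel_nonneg ht _)
    _ = Real.exp (-t) * C := by
        rw [intervalIntegral.integral_mul_const, integral_heatKernel ht]
    _ ≤ C := mul_le_of_le_one_left hC (Real.exp_le_one_iff.2 (by linarith))

/-- On each of `N` cells of size at most of the order of the parabolic scale `√t`, the heat kernel
`y ↦ p_t(x - y)` has a bound `A j` and a Lipschitz constant `A j / √t`, where the sum over the cells
of the `A j` is at most of order `1 / √t`. -/
theorem heatKernel_cell_bounds {T : ℝ} (hT : 0 < T) :
    ∃ C : ℝ, 0 < C ∧ ∀ t ∈ Ioc 0 T, ∀ x : ℝ, ∃ N : ℕ, 0 < N ∧ 2 * Real.pi / N ≤ C * √t ∧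
      ∃ A : ℕ → ℝ, (∀ j, 0 ≤ A j) ∧
        ∑ j ∈ Finset.range N, A j ≤ C / √t ∧ ∀ j < N,
        (∀ y ∈ Icc (j * (2 * Real.pi / N)) ((j + 1) * (2 * Real.pi / N)),
          |heatKernel t (x - y)| ≤ A j) ∧
        ∀ y ∈ Icc (j * (2 * Real.pi / N)) ((j + 1) * (2 * Real.pi / N)),
          ∀ z ∈ Icc (j * (2 * Real.pi / N)) ((j + 1) * (2 * Real.pi / N)),
          |heatKernel t (x - y) - heatKernel t (x - z)| ≤ A j / √t * |y - z| := by
  set c : ℝ := 1 / (1 + √T) with hc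
  have hc0 : 0 < c := by positivity
  have hc1 : c ≤ 1 := by
    rw [hc, div_le_one (by positivity)]; linarith [Real.sqrt_nonneg T]
  set S : ℝ := ∑' k : ℤ, 1 / (1 + (k : ℝ) ^ 2) with hS
  have hS0 : 0 ≤ S := tsum_nonneg fun k => by positivity
  refine ⟨2 * Real.pi + 64 / c ^ 2 * S, by positivity, fun t ht x => ?_⟩
  have hr := Real.sqrt_pos.2 ht.1
  have hrT : √t ≤ √T := Real.sqrt_le_sqrt ht.2
  set N := ⌈1 / √t⌉₊ with hN
  have hN0 : 0 < N := Nat.ceil_pos.2 (by positivity)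
  have hN0' : (0 : ℝ) < N := by exact_mod_cast hN0
  have hN1 : 1 / √t ≤ N := Nat.le_ceil _
  have hN2 : N < 1 / √t + 1 := Nat.ceil_lt_add_one (by positivity)
  set h := 2 * Real.pi / N with hh
  have hh0 : 0 < h := by positivity
  have hhN : N * h = 2 * Real.pi := by rw [hh]; field_simp
  have hh1 : h ≤ 2 * Real.pi * √t := by
    rw [hh, div_le_iff₀ hN0']
    have : 1 ≤ √t * N := by
      rw [div_le_iff₀ hr] at hN1; linarith
    nlinarith [two_pi_pos]
  have hh2 : c * √t ≤ h := by
    rw [hh, le_div_iff₀ hN0']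
    have h1 : √t * N ≤ 1 + √t := by
      have : √t * (1 / √t + 1) = 1 + √t := by field_simp
      rw [← this]; gcongr
    have h2 : c * (1 + √T) = 1 := by rw [hc]; field_simp
    calc c * √t * N = c * (√t * N) := by ring
      _ ≤ c * (1 + √T) := by gcongr; linarith
      _ ≤ 2 * Real.pi := by rw [h2]; linarith [Real.pi_gt_three]
  have : NeZero N := ⟨hN0.ne'⟩
  set m0 := ⌊x / h⌋ with hm0
  let f : ℤ → ℝ := fun m => 64 / c ^ 2 / √t * (1 / (1 + ((m - m0 : ℤ) : ℝ) ^ 2))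
  have hf0 : ∀ m, 0 ≤ f m := fun m => by positivity
  have hfs : Summable f := ((summable_one_div_one_add_sq).comp_injective
    (sub_left_injective (b := m0))).mul_left (64 / c ^ 2 / √t)
  have hft : ∑' m, f m = 64 / c ^ 2 / √t * S := by
    rw [tsum_mul_left, hS]
    congr 1
    exact (Equiv.subRight m0).tsum_eq fun k : ℤ => 1 / (1 + (k : ℝ) ^ 2)
  have hfj : ∀ j : ℕ, Summable fun k : ℤ => f (j + k * N) := fun j =>
    hfs.comp_injective fun k k' hkk => by
      have : (N : ℤ) ≠ 0 := by exact_mod_cast hN0.ne'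
      have h1 : k * (N : ℤ) = k' * N := by simpa using hkk
      exact mul_right_cancel₀ this h1
  have hcell : ∀ (j : ℕ) (k : ℤ), ∀ y ∈ Icc (j * h) ((j + 1) * h),
      y + 2 * Real.pi * k ∈ Icc (((j + k * N : ℤ) : ℝ) * h) ((((j + k * N : ℤ) : ℝ) + 1) * h) := by
    intro j k y hy
    rw [← hhN]
    push_cast
    constructor
    · nlinarith [hy.1]
    · nlinarith [hy.2]
  have hb := fun m => gauss_cell_bounds ht.1 hc0 hc1 hh2 x m
  have hgs : ∀ y, HasSum (fun k : ℤ => gauss t (x - (y + 2 * Real.pi * k))) (heatKernel t (x - y)) := by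
    intro y
    simpa only [sub_sub] using heatKernel_hasSum_gauss ht.1 (x - y)
  have hcS : 0 ≤ 64 / c ^ 2 * S := by positivity
  refine ⟨N, hN0, ?_, fun j => ∑' k : ℤ, f (j + k * N), fun j => tsum_nonneg fun k => hf0 _,
    ?_, fun j _ => ⟨fun y hy => ?_, fun y hy z hz => ?_⟩⟩
  · refine hh1.trans ?_
    gcongr
    linarith
  · have e : ∑ j ∈ Finset.range N, ∑' k : ℤ, f (j + k * N) = ∑' m, f m := by
      have hs' : Summable fun p : ℤ × Fin N => f ((Int.divModEquiv N).symm p) :=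
        (Int.divModEquiv N).symm.summable_iff.2 hfs
      rw [← (Int.divModEquiv N).symm.tsum_eq f]
      rw [← (Equiv.prodComm (Fin N) ℤ).tsum_eq]
      have hs'' := (Equiv.prodComm (Fin N) ℤ).summable_iff.2 hs'
      have hp := hs''.tsum_prod
      simp only [Function.comp_def] at hp
      rw [hp, tsum_fintype, Finset.sum_range]
      refine Finset.sum_congr rfl fun j _ => tsum_congr fun k => ?_
      simp only [Equiv.prodComm_apply, Prod.swap, Int.divModEquiv_symm_apply]
      congr 1
      ring
    rw [e, hft]
    calc 64 / c ^ 2 / √t * S = (64 / c ^ 2 * S) / √t := by ring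
      _ ≤ _ := by gcongr; linarith [two_pi_pos]
  · rw [← Real.norm_eq_abs]
    refine (hgs y).norm_le_of_bounded (hfj j).hasSum fun k => ?_
    rw [Real.norm_eq_abs, abs_of_nonneg (gauss_nonneg _ _)]
    exact (hb _).1 _ (hcell j k y hy)
  · rw [← Real.norm_eq_abs]
    refine ((hgs y).sub (hgs z)).norm_le_of_bounded (((hfj j).hasSum.div_const _).mul_right _)
      fun k => ?_
    have := (hb _).2 _ (hcell j k y hy) _ (hcell j k z hz)
    rw [add_sub_add_right_eq_sub] at this
    exact this

/-! ### The sewing lemma -/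

/-- The defect of additivity of `Ξ` on `[a, b]` is at most `K` times the length to the power `θ`. -/
def DefectBound (Ξ : ℝ → ℝ → ℝ) (a b K θ : ℝ) : Prop :=
  ∀ x y z, a ≤ x → x ≤ y → y ≤ z → z ≤ b → |Ξ x z - Ξ x y - Ξ y z| ≤ K * (z - x) ^ θ

/-- The constant of the sewing lemma; it solves `C = 2 ^ (1 - θ) * C + 2`. -/
noncomputable def sewingConst (θ : ℝ) : ℝ := 2 / (1 - 2 ^ (1 - θ))

theorem two_rpow_lt_one {θ : ℝ} (hθ : 1 < θ) : (2 : ℝ) ^ (1 - θ) < 1 :=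
  Real.rpow_lt_one_of_one_lt_of_neg one_lt_two (by linarith)

theorem sewingConst_pos {θ : ℝ} (hθ : 1 < θ) : 0 < sewingConst θ :=
  div_pos two_pos (by linarith [two_rpow_lt_one hθ])

theorem sewingConst_eq {θ : ℝ} (hθ : 1 < θ) :
    sewingConst θ * 2 ^ (1 - θ) + 2 = sewingConst θ := by
  have : (1 : ℝ) - 2 ^ (1 - θ) ≠ 0 := by linarith [two_rpow_lt_one hθ]
  rw [sewingConst]
  field_simp
  ring

theorem DefectBound.mono {Ξ : ℝ → ℝ → ℝ} {a b c d K θ : ℝ} (h : DefectBound Ξ a b K θ)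
    (hac : a ≤ c) (hdb : d ≤ b) : DefectBound Ξ c d K θ :=
  fun x y z hx hxy hyz hz => h x y z (hac.trans hx) hxy hyz (hz.trans hdb)

theorem DefectBound.diag {Ξ : ℝ → ℝ → ℝ} {a b K θ : ℝ} (h : DefectBound Ξ a b K θ)
    (hθ : 1 < θ) {x : ℝ} (hx : a ≤ x) (hx' : x ≤ b) : Ξ x x = 0 := by
  have := h x x x hx le_rfl le_rfl hx'
  rw [sub_self, sub_self, Real.zero_rpow (by linarith), mul_zero, zero_sub, abs_neg] at this
  exact abs_eq_zero.1 (le_antisymm this (abs_nonneg _))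

/-- The maximal inequality for Riemann sums, by bisection: the cell that contains the midpoint is
split off, and the two remaining pieces have at most half the length. -/
theorem DefectBound.abs_sum_sub_le {Ξ : ℝ → ℝ → ℝ} {a b K θ : ℝ} (h : DefectBound Ξ a b K θ)
    (hθ : 1 < θ) (hK : 0 ≤ K) (N : ℕ) : ∀ (τ : ℕ → ℝ), Monotone τ → a ≤ τ 0 → τ N ≤ b →
    |∑ i ∈ Finset.range N, Ξ (τ i) (τ (i + 1)) - Ξ (τ 0) (τ N)| ≤
      sewingConst θ * K * (τ N - τ 0) ^ θ := by
  induction N using Nat.strong_induction_on with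
  | _ N ih =>
  intro τ hτ ha hb
  rcases Nat.eq_zero_or_pos N with h0 | hN
  · subst h0
    rw [h.diag hθ ha hb]
    simp [Real.zero_rpow (by linarith : θ ≠ 0)]
  set L := τ N - τ 0 with hL
  have hL0 : 0 ≤ L := sub_nonneg.2 (hτ (Nat.zero_le N))
  classical
  set i := Nat.findGreatest (fun i => τ i ≤ τ 0 + L / 2) (N - 1) with hi
  have hiN : i ≤ N - 1 := Nat.findGreatest_le _
  have hi1 : τ i ≤ τ 0 + L / 2 := by
    have := Nat.findGreatest_spec (P := fun i => τ i ≤ τ 0 + L / 2) (Nat.zero_le (N - 1))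
      (by linarith)
    exact this
  have hi2 : τ 0 + L / 2 ≤ τ (i + 1) := by
    rcases Nat.lt_or_ge i (N - 1) with hlt | hge
    · have := Nat.findGreatest_is_greatest (P := fun i => τ i ≤ τ 0 + L / 2) (n := N - 1)
        (k := i + 1) (by omega) (by omega)
      exact (not_le.1 this).le
    · have : i + 1 = N := by omega
      rw [this]
      linarith
  obtain ⟨M, hM⟩ : ∃ M, N = i + (1 + M) := ⟨N - i - 1, by omega⟩
  have hshift : Monotone fun j => τ (i + 1 + j) := fun p q hpq => hτ (by omega)
  have hlast : i + 1 + M = N := by omega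
  have m1 : τ 0 ≤ τ i := hτ (Nat.zero_le i)
  have m2 : τ i ≤ τ (i + 1) := hτ (Nat.le_succ i)
  have m3 : τ (i + 1) ≤ τ N := hτ (by omega)
  have h1 := ih i (by omega) τ hτ ha ((m2.trans m3).trans hb)
  have h2 := ih M (by omega) (fun j => τ (i + 1 + j)) hshift (ha.trans (m1.trans m2))
    (by simp only [hlast]; exact hb)
  simp only [hlast, add_zero] at h2
  have d1 := h (τ 0) (τ i) (τ N) ha m1 (m2.trans m3) hb
  have d2 := h (τ i) (τ (i + 1)) (τ N) (ha.trans m1) m2 m3 hb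
  have hhalf : 2 * (L / 2) ^ θ = 2 ^ (1 - θ) * L ^ θ := by
    rw [Real.div_rpow hL0 zero_le_two, Real.rpow_sub two_pos, Real.rpow_one]
    ring
  have hCK : 0 ≤ sewingConst θ * K := mul_nonneg (sewingConst_pos hθ).le hK
  have b1 : (τ i - τ 0) ^ θ ≤ (L / 2) ^ θ :=
    Real.rpow_le_rpow (by linarith) (by linarith) (by linarith)
  have b2 : (τ N - τ (i + 1)) ^ θ ≤ (L / 2) ^ θ :=
    Real.rpow_le_rpow (by linarith) (by linarith) (by linarith)
  have b3 : (τ N - τ i) ^ θ ≤ L ^ θ :=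
    Real.rpow_le_rpow (by linarith) (by linarith) (by linarith)
  have hsum : ∑ j ∈ Finset.range N, Ξ (τ j) (τ (j + 1)) =
      ∑ j ∈ Finset.range i, Ξ (τ j) (τ (j + 1)) + (Ξ (τ i) (τ (i + 1)) +
        ∑ j ∈ Finset.range M, Ξ (τ (i + 1 + j)) (τ (i + 1 + (j + 1)))) := by
    rw [hM, Finset.sum_range_add, Finset.sum_range_add]
    simp [add_assoc]
  have c1 := mul_le_mul_of_nonneg_left b1 hCK
  have c2 := mul_le_mul_of_nonneg_left b2 hCK
  have c3 := mul_le_mul_of_nonneg_left b3 hK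
  have key : sewingConst θ * K * (2 * (L / 2) ^ θ) + 2 * (K * L ^ θ) =
      sewingConst θ * K * L ^ θ := by
    rw [hhalf]
    nth_rewrite 2 [← sewingConst_eq hθ]
    ring
  rw [hsum]
  rw [abs_le] at h1 h2 d1 d2 ⊢
  constructor <;> linarith [h1.1, h1.2, h2.1, h2.2, d1.1, d1.2, d2.1, d2.2]

/-- The sewing lemma. Additivity of `J` holds on all of `[a, b]`, and the distance of `J` to `Ξ` on
a subinterval is controlled by the defect of `Ξ` on that subinterval. The function `J` is a limit,
along an ultrafilter, of the Riemann sums over the uniform partitions. -/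
theorem exists_sewing {Ξ : ℝ → ℝ → ℝ} {a b K θ : ℝ} (hab : a ≤ b) (h : DefectBound Ξ a b K θ)
    (hθ : 1 < θ) (hK : 0 ≤ K) :
    ∃ J : ℝ → ℝ → ℝ, (∀ x y z, a ≤ x → x ≤ y → y ≤ z → z ≤ b → J x z = J x y + J y z) ∧
      ∀ x y K', a ≤ x → x ≤ y → y ≤ b → 0 ≤ K' → DefectBound Ξ x y K' θ →
        |J x y - Ξ x y| ≤ sewingConst θ * K' * (y - x) ^ θ := by
  -- uniform partitions of `[a, b]` and their intersections with `[x, y]`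
  set ρ : ℕ → ℕ → ℝ := fun k i => a + i * ((b - a) / (k + 1)) with hρ
  set c : ℝ → ℝ → ℝ → ℝ := fun x y r => max x (min y r) with hc
  set S : ℕ → ℝ → ℝ → ℝ := fun k x y =>
    ∑ i ∈ Finset.range (k + 1), Ξ (c x y (ρ k i)) (c x y (ρ k (i + 1))) with hS
  have hstep : ∀ k : ℕ, 0 ≤ (b - a) / ((k : ℝ) + 1) := fun k =>
    div_nonneg (sub_nonneg.2 hab) (by positivity)
  have hρm : ∀ k, Monotone (ρ k) := fun k i j hij => by
    simp only [hρ]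
    gcongr
  have hρ0 : ∀ k, ρ k 0 = a := fun k => by simp [hρ]
  have hρ1 : ∀ k, ρ k (k + 1) = b := fun k => by
    simp only [hρ]; push_cast; field_simp; ring
  have hcm : ∀ x y k, Monotone fun i => c x y (ρ k i) := fun x y k i j hij => by
    simp only [hc]
    exact max_le_max le_rfl (min_le_min le_rfl (hρm k hij))
  have hc0 : ∀ x y k, a ≤ x → x ≤ y → c x y (ρ k 0) = x := fun x y k hx hxy => by
    simp only [hc, hρ0]
    rw [min_eq_right (hx.trans hxy), max_eq_left hx]
  have hc1 : ∀ x y k, x ≤ y → y ≤ b → c x y (ρ k (k + 1)) = y := fun x y k hxy hy => by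
    simp only [hc, hρ1]
    rw [min_eq_left hy, max_eq_right hxy]
  have hbound : ∀ x y K', a ≤ x → x ≤ y → y ≤ b → 0 ≤ K' → DefectBound Ξ x y K' θ → ∀ k,
      |S k x y - Ξ x y| ≤ sewingConst θ * K' * (y - x) ^ θ := by
    intro x y K' hx hxy hy hK' hd k
    have := hd.abs_sum_sub_le hθ hK' (k + 1) (fun i => c x y (ρ k i)) (hcm x y k)
      (by rw [hc0 x y k hx hxy]) (by rw [hc1 x y k hxy hy])
    simpa only [hc0 x y k hx hxy, hc1 x y k hxy hy] using this
  have hlim : ∀ x y, ∃ l, a ≤ x → x ≤ y → y ≤ b →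
      Tendsto (fun k => S k x y) (hyperfilter ℕ) (𝓝 l) := by
    intro x y
    by_cases hxy : a ≤ x ∧ x ≤ y ∧ y ≤ b
    · set R := sewingConst θ * K * (y - x) ^ θ
      have hmem : ∀ k, S k x y ∈ Icc (Ξ x y - R) (Ξ x y + R) := fun k => by
        have := abs_le.1 (hbound x y K hxy.1 hxy.2.1 hxy.2.2 hK (h.mono hxy.1 hxy.2.2) k)
        constructor <;> linarith [this.1, this.2]
      obtain ⟨l, _, hl⟩ := isCompact_Icc.ultrafilter_le_nhds
        ((hyperfilter ℕ).map fun k => S k x y)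
        (le_principal_iff.2 (by
          rw [Ultrafilter.coe_map, mem_map]
          exact Eventually.of_forall hmem))
      exact ⟨l, fun _ _ _ => hl⟩
    · exact ⟨0, fun h1 h2 h3 => absurd ⟨h1, h2, h3⟩ hxy⟩
  choose J hJ using hlim
  refine ⟨J, fun x y z hx hxy hyz hz => ?_, fun x y K' hx hxy hy hK' hd => ?_⟩
  · have t1 := hJ x z hx (hxy.trans hyz) hz
    have t2 := hJ x y hx hxy (hyz.trans hz)
    have t3 := hJ y z (hx.trans hxy) hyz hz
    have hterm : ∀ k i, |Ξ (c x z (ρ k i)) (c x z (ρ k (i + 1))) -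
        Ξ (c x y (ρ k i)) (c x y (ρ k (i + 1))) - Ξ (c y z (ρ k i)) (c y z (ρ k (i + 1)))| ≤
        K * ((b - a) / (k + 1)) ^ θ := by
      intro k i
      have hle : ρ k i ≤ ρ k (i + 1) := hρm k (Nat.le_succ i)
      have hd : ρ k (i + 1) - ρ k i = (b - a) / (k + 1) := by
        simp only [hρ]; push_cast; ring
      have hR : 0 ≤ K * ((b - a) / (k + 1)) ^ θ := mul_nonneg hK (Real.rpow_nonneg (hstep k) _)
      have hyy : Ξ y y = 0 := h.diag hθ (hx.trans hxy) (hyz.trans hz)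
      have ca : ∀ r, r ≤ y → c x z r = c x y r ∧ c y z r = y := fun r hr => by
        simp only [hc]
        rw [min_eq_right (hr.trans hyz), min_eq_right hr, max_eq_left hr]
        exact ⟨rfl, rfl⟩
      have cb : ∀ r, y ≤ r → c x z r = c y z r ∧ c x y r = y := fun r hr => by
        simp only [hc]
        have : y ≤ min z r := le_min hyz hr
        rw [min_eq_left hr, max_eq_right (hxy.trans this), max_eq_right this, max_eq_right hxy]
        exact ⟨rfl, rfl⟩
      rcases le_total (ρ k (i + 1)) y with h1 | h1
      · rw [(ca _ h1).1, (ca _ h1).2, (ca _ (hle.trans h1)).1, (ca _ (hle.trans h1)).2, hyy]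
        simpa using hR
      rcases le_total y (ρ k i) with h2 | h2
      · rw [(cb _ h1).1, (cb _ h1).2, (cb _ h2).1, (cb _ h2).2, hyy]
        simpa using hR
      · rw [(cb _ h1).2, (ca _ h2).2, (cb _ h1).1, ← (ca _ h2).1, ← (cb _ h1).1]
        have p1 : x ≤ c x z (ρ k i) := le_max_left _ _
        have p2 : c x z (ρ k i) ≤ y := max_le hxy ((min_le_right _ _).trans h2)
        have p3 : y ≤ c x z (ρ k (i + 1)) := (le_min hyz h1).trans (le_max_right _ _)
        have p4 : c x z (ρ k (i + 1)) ≤ z := max_le (hxy.trans hyz) (min_le_left _ _)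
        refine (h _ _ _ (hx.trans p1) p2 p3 (p4.trans hz)).trans ?_
        have p5 : ρ k i ≤ c x z (ρ k i) := by
          simp only [hc]
          rw [min_eq_right (h2.trans hyz)]
          exact le_max_right _ _
        have p6 : c x z (ρ k (i + 1)) ≤ ρ k (i + 1) :=
          max_le (hxy.trans h1) (min_le_right _ _)
        gcongr
        · linarith
        · linarith
    have hdiff : ∀ k, |S k x z - S k x y - S k y z| ≤ (k + 1) * (K * ((b - a) / (k + 1)) ^ θ) := by
      intro k
      simp only [hS]
      rw [← Finset.sum_sub_distrib, ← Finset.sum_sub_distrib]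
      refine (Finset.abs_sum_le_sum_abs _ _).trans ?_
      refine (Finset.sum_le_card_nsmul _ _ _ fun i _ => hterm k i).trans ?_
      rw [Finset.card_range, nsmul_eq_mul]
      push_cast
      exact le_rfl
    have hzero : Tendsto (fun k : ℕ => ((k : ℝ) + 1) * (K * ((b - a) / (k + 1)) ^ θ)) atTop (𝓝 0) := by
      have e : ∀ k : ℕ, ((k : ℝ) + 1) * (K * ((b - a) / (k + 1)) ^ θ) =
          K * (b - a) ^ θ * ((k : ℝ) + 1) ^ (-(θ - 1)) := by
        intro k
        have hk : (0 : ℝ) < k + 1 := by positivity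
        rw [Real.div_rpow (sub_nonneg.2 hab) hk.le, neg_sub, Real.rpow_sub hk, Real.rpow_one]
        ring
      simp only [e]
      have h1 : Tendsto (fun k : ℕ => (k : ℝ) + 1) atTop atTop :=
        tendsto_atTop_add_const_right _ _ tendsto_natCast_atTop_atTop
      have h2 := (tendsto_rpow_neg_atTop (y := θ - 1) (by linarith)).comp h1
      simpa using h2.const_mul (K * (b - a) ^ θ)
    have t4 : Tendsto (fun k => S k x z - S k x y - S k y z) (hyperfilter ℕ) (𝓝 0) := by
      have : Tendsto (fun k => S k x z - S k x y - S k y z) atTop (𝓝 0) :=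
        squeeze_zero_norm hdiff hzero
      exact this.mono_left Nat.hyperfilter_le_atTop
    have := tendsto_nhds_unique t4 ((t1.sub t2).sub t3)
    linarith
  · have t := ((hJ x y hx hxy hy).sub_const (Ξ x y)).abs
    exact le_of_tendsto t (Eventually.of_forall fun k => hbound x y K' hx hxy hy hK' hd k)

theorem sum_eq_of_additive {J : ℝ → ℝ → ℝ} {a b : ℝ}
    (hJ : ∀ x y z, a ≤ x → x ≤ y → y ≤ z → z ≤ b → J x z = J x y + J y z) {τ : ℕ → ℝ}
    (hτ : Monotone τ) (h0 : τ 0 = a) (N : ℕ) (hN : τ N ≤ b) :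
    ∑ i ∈ Finset.range N, J (τ i) (τ (i + 1)) = J a (τ N) := by
  induction N with
  | zero =>
    have : a ≤ b := h0 ▸ hN
    have := hJ a a a le_rfl le_rfl le_rfl this
    simp only [Finset.range_zero, Finset.sum_empty, h0]
    linarith
  | succ N ih =>
    have h1 : τ N ≤ τ (N + 1) := hτ (Nat.le_succ N)
    rw [Finset.sum_range_succ, ih (h1.trans hN),
      ← hJ a (τ N) (τ (N + 1)) le_rfl (h0 ▸ hτ (Nat.zero_le N)) h1 hN]

theorem sum_rpow_le {τ : ℕ → ℝ} (hτ : Monotone τ) {θ δ : ℝ} (hθ : 1 < θ) (N : ℕ)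
    (h : ∀ i < N, τ (i + 1) - τ i < δ) :
    ∑ i ∈ Finset.range N, (τ (i + 1) - τ i) ^ θ ≤ δ ^ (θ - 1) * (τ N - τ 0) := by
  rw [← Finset.sum_range_sub τ N, Finset.mul_sum]
  refine Finset.sum_le_sum fun i hi => ?_
  have h0 : 0 ≤ τ (i + 1) - τ i := sub_nonneg.2 (hτ (Nat.le_succ i))
  have hlt := h i (Finset.mem_range.1 hi)
  rcases h0.eq_or_lt with he | hpos
  · rw [← he, Real.zero_rpow (by linarith), mul_zero]
  · have : (τ (i + 1) - τ i) ^ θ = (τ (i + 1) - τ i) ^ (θ - 1) * (τ (i + 1) - τ i) := by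
      rw [← Real.rpow_add_one hpos.ne']; ring_nf
    rw [this]
    gcongr

/-- The Riemann sums of a germ converge to the sewn function. -/
theorem abs_sum_sub_sewing_le {Ξ J : ℝ → ℝ → ℝ} {a b K θ : ℝ} (hθ : 1 < θ) (hK : 0 ≤ K)
    (h : DefectBound Ξ a b K θ)
    (hJ : ∀ x y z, a ≤ x → x ≤ y → y ≤ z → z ≤ b → J x z = J x y + J y z)
    (hJ' : ∀ x y K', a ≤ x → x ≤ y → y ≤ b → 0 ≤ K' → DefectBound Ξ x y K' θ →
        |J x y - Ξ x y| ≤ sewingConst θ * K' * (y - x) ^ θ)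
    {τ : ℕ → ℝ} (hτ : Monotone τ) {N : ℕ} (h0 : τ 0 = a) (hN : τ N = b) {δ : ℝ}
    (hm : ∀ i < N, τ (i + 1) - τ i < δ) :
    |∑ i ∈ Finset.range N, Ξ (τ i) (τ (i + 1)) - J a b| ≤
      sewingConst θ * K * (δ ^ (θ - 1) * (b - a)) := by
  have e := sum_eq_of_additive hJ hτ h0 N hN.le
  rw [hN] at e
  rw [← e, ← Finset.sum_sub_distrib]
  refine (Finset.abs_sum_le_sum_abs _ _).trans ?_
  have hs := sum_rpow_le hτ hθ N hm
  rw [h0, hN] at hs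
  have hC : 0 ≤ sewingConst θ * K := mul_nonneg (sewingConst_pos hθ).le hK
  refine le_trans ?_ (mul_le_mul_of_nonneg_left hs hC)
  rw [Finset.mul_sum]
  refine Finset.sum_le_sum fun i hi => ?_
  have hi' := Finset.mem_range.1 hi
  have p1 : a ≤ τ i := h0 ▸ hτ (Nat.zero_le i)
  have p2 : τ (i + 1) ≤ b := hN ▸ hτ hi'
  rw [abs_sub_comm]
  exact hJ' _ _ K p1 (hτ (Nat.le_succ i)) p2 hK (h.mono p1 p2)

section

/-! ### Rough integrals of controlled paths -/

variable {n : ℕ} {α : ℝ}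

/-- The Hölder seminorms of the path and of the area of `X` are at most `M`. -/
structure RoughPath.BoundedBy (X : RoughPath n α) (M : ℝ) : Prop where
  path : ∀ x ∈ I, ∀ y ∈ I, ‖X.path x - X.path y‖ ≤ M * |x - y| ^ α
  area : ∀ x ∈ I, ∀ y ∈ I, ∀ i j : Fin n, |X.area x y i j| ≤ M * |x - y| ^ (2 * α)

/-- The path `Y` is controlled by `X` with derivative process `Y'`. The bound on the remainder and
the bound on the increments of `Y'` separate a part of rough regularity, with constant `M`, from a
Lipschitz part, which is linear in `V`. -/
structure Controlled (X : RoughPath n α) (Y : ℝ → ℝ) (Y' : ℝ → Fin n → ℝ) (M V : ℝ) : Prop where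
  bound : ∀ x ∈ I, |Y x| ≤ M
  bound' : ∀ x ∈ I, ∀ k, |Y' x k| ≤ M
  incr' : ∀ x ∈ I, ∀ y ∈ I, ∀ k, |Y' y k - Y' x k| ≤ M * (|y - x| ^ α + V * |y - x|)
  remainder : ∀ x ∈ I, ∀ y ∈ I,
    |Y y - Y x - ∑ k, Y' x k * (X.path y k - X.path x k)| ≤
      M * (|y - x| ^ (2 * α) + V * |y - x|)

theorem abs_coord_le (w : E n) (j : Fin n) : |w j| ≤ ‖w‖ := by
  simpa using PiLp.norm_apply_le w j

theorem norm_le_sum_abs (w : E n) : ‖w‖ ≤ ∑ j, |w j| := by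
  have h : w = ∑ j, EuclideanSpace.single j (w j) := by
    ext i
    simp
  calc ‖w‖ = ‖∑ j, EuclideanSpace.single j (w j)‖ := by rw [← h]
    _ ≤ ∑ j, ‖EuclideanSpace.single j (w j)‖ := norm_sum_le _ _
    _ = _ := by simp

theorem germ_apply (X : RoughPath n α) (Y : ℝ → ℝ) (Y' : ℝ → Fin n → ℝ) (x y : ℝ) (j : Fin n) :
    germ X Y Y' x y j = Y x * (X.path y j - X.path x j) + ∑ k, Y' x k * X.area x y k j := rfl

/-- The defect of the germ, by Chen's relation. -/
theorem germ_defect (X : RoughPath n α) (Y : ℝ → ℝ) (Y' : ℝ → Fin n → ℝ) {x y z : ℝ}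
    (hx : x ∈ I) (hy : y ∈ I) (hz : z ∈ I) (j : Fin n) :
    germ X Y Y' x z j - germ X Y Y' x y j - germ X Y Y' y z j =
      -((Y y - Y x - ∑ k, Y' x k * (X.path y k - X.path x k)) * (X.path z j - X.path y j) +
        ∑ k, (Y' y k - Y' x k) * X.area y z k j) := by
  have hc : ∀ k, X.area x z k j = X.area y z k j + X.area x y k j +
      (X.path y k - X.path x k) * (X.path z j - X.path y j) := fun k => by
    have := X.chen x hx y hy z hz k j
    linarith
  simp only [germ_apply, hc, mul_add, Finset.sum_add_distrib, sub_mul, Finset.sum_mul,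
    Finset.sum_sub_distrib, mul_assoc]
  ring

theorem rpow_le_seven {h β : ℝ} (h0 : 0 ≤ h) (h1 : h ≤ 2 * Real.pi) (hβ : 0 ≤ β) (hβ1 : β ≤ 1) :
    h ^ β ≤ 7 := by
  have h7 : 2 * Real.pi ≤ 7 := by linarith [Real.pi_lt_d2]
  calc h ^ β ≤ (7 : ℝ) ^ β := Real.rpow_le_rpow h0 (h1.trans h7) hβ
    _ ≤ (7 : ℝ) ^ (1 : ℝ) := Real.rpow_le_rpow_of_exponent_le (by norm_num) hβ1
    _ = 7 := Real.rpow_one 7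

namespace Controlled

variable {X : RoughPath n α} {Y : ℝ → ℝ} {Y' : ℝ → Fin n → ℝ} {M V : ℝ}

/-- The defect of the germ of `φ Y` on a subinterval, in terms of the size `A` and the Lipschitz
constant `B` of `φ` there. -/
theorem defectBound (hY : Controlled X Y Y' M V) (hX : X.BoundedBy M) (hα : 1 / 3 < α)
    (hα' : α < 1 / 2) (hV : 0 ≤ V) (hM : 0 ≤ M) {φ : ℝ → ℝ} {a b A B : ℝ} (ha : 0 ≤ a)
    (hb : b ≤ 2 * Real.pi) (hA : 0 ≤ A) (hB : 0 ≤ B)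
    (hφA : ∀ y ∈ Icc a b, |φ y| ≤ A)
    (hφB : ∀ y ∈ Icc a b, ∀ z ∈ Icc a b, |φ y - φ z| ≤ B * |y - z|) (j : Fin n) :
    DefectBound (fun x y => germ X (fun x => φ x * Y x) (fun x k => φ x * Y' x k) x y j) a b
      (M ^ 2 * (1 + 7 * n) * (A + (A * V + B) * (b - a) ^ (1 - 2 * α))) (3 * α) := by
  intro x y z hx hxy hyz hz
  have hxab : x ∈ Icc a b := ⟨hx, hxy.trans (hyz.trans hz)⟩
  have hyab : y ∈ Icc a b := ⟨hx.trans hxy, hyz.trans hz⟩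
  have hxI : x ∈ I := ⟨ha.trans hxab.1, hxab.2.trans hb⟩
  have hyI : y ∈ I := ⟨ha.trans hyab.1, hyab.2.trans hb⟩
  have hzI : z ∈ I := ⟨hyI.1.trans hyz, hz.trans hb⟩
  set L := z - x with hL
  have hL0 : 0 ≤ L := by linarith
  have hL1 : L ≤ 2 * Real.pi := by linarith [hxI.1, hzI.2]
  have hLh : L ≤ b - a := by linarith
  have e1 : |y - x| ≤ L := by rw [abs_of_nonneg (by linarith)]; linarith
  have e2 : |z - y| ≤ L := by rw [abs_of_nonneg (by linarith)]; linarith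
  -- increments of `φ Y` and `φ Y'`
  have p1 : |φ y * Y y - φ x * Y x - ∑ k, φ x * Y' x k * (X.path y k - X.path x k)| ≤
      M * (A * (L ^ (2 * α) + V * L) + B * L) := by
    have e : φ y * Y y - φ x * Y x - ∑ k, φ x * Y' x k * (X.path y k - X.path x k) =
        φ x * (Y y - Y x - ∑ k, Y' x k * (X.path y k - X.path x k)) + (φ y - φ x) * Y y := by
      simp only [mul_assoc, ← Finset.mul_sum]
      ring
    rw [e]
    refine (abs_add_le _ _).trans ?_
    rw [abs_mul, abs_mul]
    calc _ ≤ A * (M * (L ^ (2 * α) + V * L)) + (B * L) * M := by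
          have h1 := hY.remainder x hxI y hyI
          have h2 := hφB y hyab x hxab
          have h3 := hφA x hxab
          have h4 := hY.bound y hyI
          gcongr
          · exact h1.trans (by gcongr)
          · exact h2.trans (by gcongr)
      _ = _ := by ring
  have p2 : ∀ k, |φ y * Y' y k - φ x * Y' x k| ≤ M * (A * (L ^ α + V * L) + B * L) := by
    intro k
    have e : φ y * Y' y k - φ x * Y' x k =
        φ x * (Y' y k - Y' x k) + (φ y - φ x) * Y' y k := by ring
    rw [e]
    refine (abs_add_le _ _).trans ?_
    rw [abs_mul, abs_mul]
    calc _ ≤ A * (M * (L ^ α + V * L)) + (B * L) * M := by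
          have h1 := hY.incr' x hxI y hyI k
          have h2 := hφB y hyab x hxab
          have h3 := hφA x hxab
          have h4 := hY.bound' y hyI k
          gcongr
          · exact h1.trans (by gcongr)
          · exact h2.trans (by gcongr)
      _ = _ := by ring
  have p3 : |X.path z j - X.path y j| ≤ M * L ^ α := by
    have := abs_coord_le (X.path z - X.path y) j
    refine this.trans ((hX.path z hzI y hyI).trans ?_)
    gcongr
  have p4 : ∀ k, |X.area y z k j| ≤ M * L ^ (2 * α) := fun k => by
    refine (hX.area y hyI z hzI k j).trans ?_
    rw [abs_sub_comm]
    gcongr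
  rw [germ_defect X _ _ hxI hyI hzI j, abs_neg]
  -- all the powers of the length are compared with the power `3 α`
  have q1 : L ^ (2 * α) * L ^ α = L ^ (3 * α) := by
    rw [← Real.rpow_add_of_nonneg hL0 (by linarith) (by linarith)]; ring_nf
  have q2 : L * L ^ α ≤ L ^ (3 * α) * (b - a) ^ (1 - 2 * α) := by
    have : L * L ^ α = L ^ (3 * α) * L ^ (1 - 2 * α) := by
      rw [← Real.rpow_add_of_nonneg hL0 (by linarith) (by linarith), ← Real.rpow_one_add' hL0
        (by linarith)]
      ring_nf
    rw [this]
    gcongr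
    linarith
  have q3 : L * L ^ (2 * α) ≤ 7 * (L * L ^ α) := by
    have : L ^ (2 * α) = L ^ α * L ^ α := by
      rw [← Real.rpow_add_of_nonneg hL0 (by linarith) (by linarith)]; ring_nf
    rw [this]
    have h7 := rpow_le_seven hL0 hL1 (β := α) (by linarith) (by linarith)
    have : 0 ≤ L * L ^ α := mul_nonneg hL0 (Real.rpow_nonneg hL0 _)
    nlinarith
  set R := L ^ (3 * α) * (b - a) ^ (1 - 2 * α) with hR
  have q3' : L * L ^ (2 * α) ≤ 7 * R := q3.trans (by linarith)
  have hAVB : 0 ≤ A * V + B := by positivity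
  have hP : 0 ≤ L ^ (3 * α) := Real.rpow_nonneg hL0 _
  calc _ ≤ M * (A * (L ^ (2 * α) + V * L) + B * L) * (M * L ^ α) +
        ∑ _k : Fin n, M * (A * (L ^ α + V * L) + B * L) * (M * L ^ (2 * α)) := by
        refine (abs_add_le _ _).trans (add_le_add ?_ ?_)
        · rw [abs_mul]
          gcongr
        · refine (Finset.abs_sum_le_sum_abs _ _).trans (Finset.sum_le_sum fun k _ => ?_)
          rw [abs_mul]
          gcongr
          · exact p2 k
          · exact p4 k
    _ = M ^ 2 * (A * (L ^ (2 * α) * L ^ α) + (A * V + B) * (L * L ^ α)) +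
        n * (M ^ 2 * (A * (L ^ (2 * α) * L ^ α) + (A * V + B) * (L * L ^ (2 * α)))) := by
        rw [Finset.sum_const, Finset.card_univ, Fintype.card_fin, nsmul_eq_mul]
        ring
    _ ≤ M ^ 2 * (A * L ^ (3 * α) + (A * V + B) * R) +
        n * (M ^ 2 * (7 * (A * L ^ (3 * α)) + (A * V + B) * (7 * R))) := by
        rw [q1]
        have r1 := mul_nonneg hA hP
        have r2 := mul_le_mul_of_nonneg_left q2 hAVB
        have r3 := mul_le_mul_of_nonneg_left q3' hAVB
        refine add_le_add (mul_le_mul_of_nonneg_left ?_ (sq_nonneg M))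
          (mul_le_mul_of_nonneg_left (mul_le_mul_of_nonneg_left ?_ (sq_nonneg M))
            (Nat.cast_nonneg n))
        · linarith
        · linarith
    _ = _ := by rw [hR]; ring

theorem abs_germ_le (hY : Controlled X Y Y' M V) (hX : X.BoundedBy M) (hα : 1 / 3 < α)
    (hα' : α < 1 / 2) (hM : 0 ≤ M) {φ : ℝ → ℝ} {a b A : ℝ} (ha : 0 ≤ a) (hab : a ≤ b)
    (hb : b ≤ 2 * Real.pi) (hA : 0 ≤ A) (hφA : |φ a| ≤ A) (j : Fin n) :
    |germ X (fun x => φ x * Y x) (fun x k => φ x * Y' x k) a b j| ≤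
      M ^ 2 * (1 + 7 * n) * (A * (b - a) ^ α) := by
  have haI : a ∈ I := ⟨ha, hab.trans hb⟩
  have hbI : b ∈ I := ⟨ha.trans hab, hb⟩
  have hL0 : 0 ≤ b - a := sub_nonneg.2 hab
  have p3 : |X.path b j - X.path a j| ≤ M * (b - a) ^ α := by
    have := abs_coord_le (X.path b - X.path a) j
    refine this.trans ((hX.path b hbI a haI).trans ?_)
    rw [abs_of_nonneg hL0]
  have p4 : ∀ k, |X.area a b k j| ≤ M * (7 * (b - a) ^ α) := fun k => by
    refine (hX.area a haI b hbI k j).trans ?_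
    rw [abs_sub_comm, abs_of_nonneg hL0, two_mul, Real.rpow_add_of_nonneg hL0 (by linarith)
      (by linarith)]
    gcongr
    exact rpow_le_seven hL0 (by linarith) (by linarith) (by linarith)
  rw [germ_apply]
  calc _ ≤ A * M * (M * (b - a) ^ α) + ∑ _k : Fin n, A * M * (M * (7 * (b - a) ^ α)) := by
        refine (abs_add_le _ _).trans (add_le_add ?_ ?_)
        · rw [abs_mul, abs_mul]
          gcongr
          exact hY.bound a haI
        · refine (Finset.abs_sum_le_sum_abs _ _).trans (Finset.sum_le_sum fun k _ => ?_)
          rw [abs_mul, abs_mul]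
          gcongr
          · exact hY.bound' a haI k
          · exact p4 k
    _ = _ := by
        rw [Finset.sum_const, Finset.card_univ, Fintype.card_fin, nsmul_eq_mul]
        ring

end Controlled

/-- The constant in the bound for rough integrals. -/
noncomputable def roughConst (n : ℕ) (α M : ℝ) : ℝ :=
  M ^ 2 * (1 + 7 * n) * (1 + 7 * sewingConst (3 * α))

/-- The rough integrals of `φ Y` over subintervals. The bound on a subinterval only involves the
size `A` and the Lipschitz constant `B` of `φ` on that subinterval. -/
theorem Controlled.exists_integral {X : RoughPath n α} {Y : ℝ → ℝ} {Y' : ℝ → Fin n → ℝ} {M V : ℝ}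
    (hY : Controlled X Y Y' M V) (hX : X.BoundedBy M) (hα : 1 / 3 < α)
    (hα' : α < 1 / 2) (hV : 0 ≤ V) (hM : 0 ≤ M) {φ : ℝ → ℝ} (hφ : IsLip φ) (j : Fin n) :
    ∃ J : ℝ → ℝ → ℝ,
      (∀ x y z, 0 ≤ x → x ≤ y → y ≤ z → z ≤ 2 * Real.pi → J x z = J x y + J y z) ∧
      (∀ ε > 0, ∃ δ > 0, ∀ (N : ℕ) (τ : ℕ → ℝ), Monotone τ → τ 0 = 0 → τ N = 2 * Real.pi →
        (∀ i < N, τ (i + 1) - τ i < δ) →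
        |∑ i ∈ Finset.range N, germ X (fun x => φ x * Y x) (fun x k => φ x * Y' x k)
          (τ i) (τ (i + 1)) j - J 0 (2 * Real.pi)| < ε) ∧
      ∀ a b A B, 0 ≤ a → a ≤ b → b ≤ 2 * Real.pi → 0 ≤ A → 0 ≤ B →
        (∀ y ∈ Icc a b, |φ y| ≤ A) →
        (∀ y ∈ Icc a b, ∀ z ∈ Icc a b, |φ y - φ z| ≤ B * |y - z|) →
        |J a b| ≤ roughConst n α M * (A * (b - a) ^ α + (A * V + B) * (b - a) ^ (1 + α)) := by
  obtain ⟨A₀, B₀, hAB⟩ := hφ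
  obtain ⟨hA0, hB0⟩ := hAB.nonneg
  obtain ⟨hA₀, hB₀⟩ := hAB
  have hθ : 1 < 3 * α := by linarith
  have hdef := hY.defectBound hX hα hα' hV hM le_rfl le_rfl hA0 hB0 hA₀ hB₀ j
  set K := M ^ 2 * (1 + 7 * n) * (A₀ + (A₀ * V + B₀) * (2 * Real.pi - 0) ^ (1 - 2 * α)) with hKdef
  have hK : 0 ≤ K := by
    have : 0 ≤ (2 * Real.pi - 0) ^ (1 - 2 * α) :=
      Real.rpow_nonneg (by linarith [two_pi_pos]) _
    positivity
  obtain ⟨J, hJ, hJ'⟩ := exists_sewing two_pi_pos.le hdef hθ hK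
  refine ⟨J, hJ, fun ε hε => ?_, fun a b A B ha hab hb hA hB hφA hφB => ?_⟩
  · -- the error for mesh `δ` is at most a constant times `δ ^ (3 α - 1)`
    have ht : Tendsto (fun δ : ℝ => sewingConst (3 * α) * K * (δ ^ (3 * α - 1) * (2 * Real.pi - 0)))
        (𝓝[>] 0) (𝓝 0) := by
      have h1 : Tendsto (fun δ : ℝ => δ ^ (3 * α - 1)) (𝓝[>] 0) (𝓝 0) := by
        have := (Real.continuousAt_rpow_const 0 (3 * α - 1) (Or.inr (by linarith))).tendsto
        rw [Real.zero_rpow (by linarith)] at this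
        exact this.mono_left nhdsWithin_le_nhds
      simpa using (h1.mul_const (2 * Real.pi - 0)).const_mul (sewingConst (3 * α) * K)
    obtain ⟨δ, hδ, hδ0⟩ := ((ht.eventually (gt_mem_nhds hε)).and self_mem_nhdsWithin).exists
    refine ⟨δ, hδ0, fun N τ hτ h0 hN hm => ?_⟩
    exact (abs_sum_sub_sewing_le hθ hK hdef hJ hJ' hτ h0 hN hm).trans_lt hδ
  · have hL0 : 0 ≤ b - a := sub_nonneg.2 hab
    have hL1 : b - a ≤ 2 * Real.pi := by linarith
    have hd := hY.defectBound hX hα hα' hV hM ha hb hA hB hφA hφB j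
    have hP : 0 ≤ (b - a) ^ (1 - 2 * α) := Real.rpow_nonneg hL0 _
    have h1 := hJ' a b _ ha hab hb (by positivity) hd
    have h2 := hY.abs_germ_le hX hα hα' hM ha hab hb hA (hφA a ⟨le_rfl, hab⟩) j
    have q1 : (b - a) ^ (3 * α) ≤ 7 * (b - a) ^ α := by
      have : (b - a) ^ (3 * α) = (b - a) ^ (2 * α) * (b - a) ^ α := by
        rw [← Real.rpow_add_of_nonneg hL0 (by linarith) (by linarith)]; ring_nf
      rw [this]
      gcongr
      exact rpow_le_seven hL0 hL1 (by linarith) (by linarith)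
    have q2 : (b - a) ^ (1 - 2 * α) * (b - a) ^ (3 * α) = (b - a) ^ (1 + α) := by
      rw [← Real.rpow_add_of_nonneg hL0 (by linarith) (by linarith)]; ring_nf
    have hS := (sewingConst_pos hθ).le
    set D := M ^ 2 * (1 + 7 * (n : ℝ)) with hD
    have hD0 : 0 ≤ D := by positivity
    have hQ : 0 ≤ (b - a) ^ (1 + α) := Real.rpow_nonneg hL0 _
    have hQ' : 0 ≤ (b - a) ^ α := Real.rpow_nonneg hL0 _
    have hAVB : 0 ≤ A * V + B := by positivity
    calc |J a b| = |(J a b - germ X (fun x => φ x * Y x) (fun x k => φ x * Y' x k) a b j) +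
          germ X (fun x => φ x * Y x) (fun x k => φ x * Y' x k) a b j| := by ring_nf
      _ ≤ sewingConst (3 * α) * (D * (A + (A * V + B) * (b - a) ^ (1 - 2 * α))) *
            (b - a) ^ (3 * α) + D * (A * (b - a) ^ α) :=
          (abs_add_le _ _).trans (add_le_add h1 h2)
      _ = sewingConst (3 * α) * D * (A * (b - a) ^ (3 * α) + (A * V + B) * (b - a) ^ (1 + α)) +
            D * (A * (b - a) ^ α) := by rw [← q2]; ring
      _ ≤ sewingConst (3 * α) * D * (A * (7 * (b - a) ^ α) + (A * V + B) * (7 * (b - a) ^ (1 + α))) +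
            D * (A * (b - a) ^ α + (A * V + B) * (b - a) ^ (1 + α)) := by
          gcongr
          · linarith
          · linarith [mul_nonneg hAVB hQ]
      _ = _ := by rw [roughConst, ← hD]; ring

/-! ### The rough integral operator -/

/-- The uniform partition of `[0, 2π]` into `N` cells. -/
noncomputable def unifPart (N i : ℕ) : ℝ := i * (2 * Real.pi / N)

theorem unifPart_mono (N : ℕ) : Monotone (unifPart N) := fun i j hij => by
  unfold unifPart
  gcongr

theorem unifPart_zero (N : ℕ) : unifPart N 0 = 0 := by simp [unifPart]

theorem unifPart_last {N : ℕ} (hN : 0 < N) : unifPart N N = 2 * Real.pi := by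
  have : (N : ℝ) ≠ 0 := by exact_mod_cast hN.ne'
  unfold unifPart
  field_simp

theorem unifPart_succ_sub (N i : ℕ) : unifPart N (i + 1) - unifPart N i = 2 * Real.pi / N := by
  unfold unifPart
  push_cast
  ring

theorem unifPart_mem_I {N i : ℕ} (hi : i ≤ N) (hN : 0 < N) : unifPart N i ∈ I :=
  ⟨by unfold unifPart; positivity, by rw [← unifPart_last hN]; exact unifPart_mono N hi⟩

section

variable {X : RoughPath n α} {Y Z : ℝ → ℝ} {Y' Z' : ℝ → Fin n → ℝ} {J K : E n}

theorem HasRoughIntegral.tendsto (h : HasRoughIntegral X Y Y' J) :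
    Tendsto (fun N => ∑ i ∈ Finset.range (N + 1),
      germ X Y Y' (unifPart (N + 1) i) (unifPart (N + 1) (i + 1))) atTop (𝓝 J) := by
  rw [Metric.tendsto_atTop]
  intro ε hε
  obtain ⟨δ, hδ, h⟩ := h ε hε
  obtain ⟨N₀, hN₀⟩ := exists_nat_gt (2 * Real.pi / δ)
  refine ⟨N₀, fun N hN => ?_⟩
  rw [dist_eq_norm]
  refine h (N + 1) _ (unifPart_mono _) (unifPart_zero _) (unifPart_last (Nat.succ_pos N))
    fun i _ => ?_
  rw [unifPart_succ_sub, div_lt_iff₀ (by positivity)]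
  rw [div_lt_iff₀ hδ] at hN₀
  have : (N₀ : ℝ) ≤ ((N + 1 : ℕ) : ℝ) := by exact_mod_cast hN.trans (Nat.le_succ N)
  nlinarith

theorem HasRoughIntegral.unique (h : HasRoughIntegral X Y Y' J) (h' : HasRoughIntegral X Y Y' K) :
    J = K := tendsto_nhds_unique h.tendsto h'.tendsto

theorem HasRoughIntegral.eq (h : HasRoughIntegral X Y Y' J) : roughIntegral X Y Y' = J := by
  have hex : ∃ J, HasRoughIntegral X Y Y' J := ⟨J, h⟩
  rw [roughIntegral, dif_pos hex]
  exact hex.choose_spec.unique h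

theorem HasRoughIntegral.add (h : HasRoughIntegral X Y Y' J) (h' : HasRoughIntegral X Z Z' K) :
    HasRoughIntegral X (fun x => Y x + Z x) (fun x k => Y' x k + Z' x k) (J + K) := by
  intro ε hε
  obtain ⟨δ, hδ, h⟩ := h (ε / 2) (by positivity)
  obtain ⟨δ', hδ', h'⟩ := h' (ε / 2) (by positivity)
  refine ⟨min δ δ', lt_min hδ hδ', fun N τ hτ h0 hN hm => ?_⟩
  have h1 := h N τ hτ h0 hN fun i hi => (hm i hi).trans_le (min_le_left _ _)
  have h2 := h' N τ hτ h0 hN fun i hi => (hm i hi).trans_le (min_le_right _ _)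
  have e : ∀ x y, germ X (fun x => Y x + Z x) (fun x k => Y' x k + Z' x k) x y =
      germ X Y Y' x y + germ X Z Z' x y := by
    intro x y
    ext j
    simp only [germ_apply, PiLp.add_apply, add_mul, Finset.sum_add_distrib]
    ring
  simp only [e, Finset.sum_add_distrib]
  rw [add_sub_add_comm]
  exact (norm_add_le _ _).trans_lt (by linarith)

theorem HasRoughIntegral.smul (h : HasRoughIntegral X Y Y' J) (c : ℝ) :
    HasRoughIntegral X (fun x => c * Y x) (fun x k => c * Y' x k) (c • J) := by
  intro ε hε
  obtain ⟨δ, hδ, h⟩ := h (ε / (|c| + 1)) (by positivity)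
  refine ⟨δ, hδ, fun N τ hτ h0 hN hm => ?_⟩
  have h1 := h N τ hτ h0 hN hm
  have e : ∀ x y, germ X (fun x => c * Y x) (fun x k => c * Y' x k) x y =
      c • germ X Y Y' x y := by
    intro x y
    ext j
    simp only [germ_apply, PiLp.smul_apply, smul_eq_mul, mul_add, Finset.mul_sum]
    ring_nf
  simp only [e, ← Finset.smul_sum]
  rw [← smul_sub, norm_smul, Real.norm_eq_abs]
  rw [lt_div_iff₀ (by positivity)] at h1
  nlinarith [norm_nonneg (∑ i ∈ Finset.range N, germ X Y Y' (τ i) (τ (i + 1)) - J), abs_nonneg c]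

end

end

section

/-! ### The rough integral of the heat kernel -/

variable {n : ℕ} {α : ℝ}

theorem roughConst_nonneg (n : ℕ) {α M : ℝ} (hα : 1 / 3 < α) : 0 ≤ roughConst n α M := by
  have := (sewingConst_pos (θ := 3 * α) (by linarith)).le
  unfold roughConst
  positivity

namespace Controlled

variable {X : RoughPath n α} {Y : ℝ → ℝ} {Y' : ℝ → Fin n → ℝ} {M V : ℝ}

theorem exists_hasRoughIntegral (hY : Controlled X Y Y' M V) (hX : X.BoundedBy M) (hα : 1 / 3 < α)
    (hα' : α < 1 / 2) (hV : 0 ≤ V) (hM : 0 ≤ M) {φ : ℝ → ℝ} (hφ : IsLip φ) :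
    ∃ J : Fin n → ℝ → ℝ → ℝ,
      HasRoughIntegral X (fun x => φ x * Y x) (fun x k => φ x * Y' x k)
        (WithLp.toLp 2 fun j => J j 0 (2 * Real.pi)) ∧
      (∀ j x y z, 0 ≤ x → x ≤ y → y ≤ z → z ≤ 2 * Real.pi → J j x z = J j x y + J j y z) ∧
      ∀ j a b A B, 0 ≤ a → a ≤ b → b ≤ 2 * Real.pi → 0 ≤ A → 0 ≤ B →
        (∀ y ∈ Icc a b, |φ y| ≤ A) →
        (∀ y ∈ Icc a b, ∀ z ∈ Icc a b, |φ y - φ z| ≤ B * |y - z|) →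
        |J j a b| ≤ roughConst n α M * (A * (b - a) ^ α + (A * V + B) * (b - a) ^ (1 + α)) := by
  choose J hJ hlim hbd using fun j => hY.exists_integral hX hα hα' hV hM hφ j
  refine ⟨J, fun ε hε => ?_, hJ, hbd⟩
  have hev : ∀ᶠ δ in 𝓝[>] (0 : ℝ), ∀ j : Fin n, ∀ (N : ℕ) (τ : ℕ → ℝ), Monotone τ → τ 0 = 0 →
      τ N = 2 * Real.pi → (∀ i < N, τ (i + 1) - τ i < δ) →
        |∑ i ∈ Finset.range N, germ X (fun x => φ x * Y x) (fun x k => φ x * Y' x k)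
          (τ i) (τ (i + 1)) j - J j 0 (2 * Real.pi)| < ε / (n + 1) := by
    rw [eventually_all]
    intro j
    obtain ⟨δ, hδ, h⟩ := hlim j (ε / (n + 1)) (by positivity)
    filter_upwards [Ioo_mem_nhdsGT hδ] with δ' hδ' N τ hτ h0 hN hm
    exact h N τ hτ h0 hN fun i hi => (hm i hi).trans hδ'.2
  obtain ⟨δ, h, hδ⟩ := (hev.and self_mem_nhdsWithin).exists
  refine ⟨δ, hδ, fun N τ hτ h0 hN hm => ?_⟩
  refine (norm_le_sum_abs _).trans_lt ?_
  have hle : ∀ j, |(∑ i ∈ Finset.range N, germ X (fun x => φ x * Y x) (fun x k => φ x * Y' x k)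
      (τ i) (τ (i + 1)) - WithLp.toLp 2 fun j => J j 0 (2 * Real.pi)) j| ≤ ε / (n + 1) := by
    intro j
    have := (h j N τ hτ h0 hN hm).le
    simpa using this
  calc _ ≤ ∑ _j : Fin n, ε / (n + 1) := Finset.sum_le_sum fun j _ => hle j
    _ = n * (ε / (n + 1)) := by simp
    _ < ε := by
      rw [← mul_div_assoc, div_lt_iff₀ (by positivity)]
      linarith

theorem abs_roughIntegral_le (hY : Controlled X Y Y' M V) (hX : X.BoundedBy M) (hα : 1 / 3 < α)
    (hα' : α < 1 / 2) (hV : 0 ≤ V) (hM : 0 ≤ M) {φ : ℝ → ℝ} {A B : ℝ} (hφ : LipBound φ A B)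
    (j : Fin n) :
    |roughIntegral X (fun x => φ x * Y x) (fun x k => φ x * Y' x k) j| ≤
      49 * roughConst n α M * (1 + V) * (A + B) := by
  obtain ⟨J, hJ, -, hbd⟩ := hY.exists_hasRoughIntegral hX hα hα' hV hM ⟨A, B, hφ⟩
  obtain ⟨hA, hB⟩ := hφ.nonneg
  rw [hJ.eq]
  have h := hbd j 0 (2 * Real.pi) A B le_rfl two_pi_pos.le le_rfl hA hB hφ.1 hφ.2
  rw [sub_zero] at h
  have h7 := rpow_le_seven two_pi_pos.le le_rfl (β := α) (by linarith) (by linarith)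
  have h49 : (2 * Real.pi) ^ (1 + α) ≤ 49 := by
    rw [Real.rpow_add two_pi_pos, Real.rpow_one]
    have : 2 * Real.pi ≤ 7 := by linarith [Real.pi_lt_d2]
    have := Real.rpow_nonneg two_pi_pos.le α
    nlinarith [two_pi_pos]
  have hR := roughConst_nonneg n (M := M) hα
  calc _ ≤ roughConst n α M * (A * 7 + (A * V + B) * 49) := by
        refine h.trans ?_
        gcongr
    _ ≤ roughConst n α M * (49 * (1 + V) * (A + B)) := by
        gcongr
        nlinarith [mul_nonneg hV hB]
    _ = _ := by ring

end Controlled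

/-- The bound for the rough integrals of the heat kernel: at the parabolic scale `√τ`, each cell
contributes the rough bound at that scale. The power `√τ ^ (α - 1)` is integrable in `τ`, and the
Lipschitz part `V` of the controlled path comes without any singularity in `τ`. -/
theorem exists_roughIntegral_heatKernel_bound (n : ℕ) {α T : ℝ} (M : ℝ) (hα : 1 / 3 < α)
    (hα' : α < 1 / 2) (hT : 0 < T) (hM : 0 ≤ M) : ∃ Q : ℝ, 0 ≤ Q ∧
    ∀ (X : RoughPath n α) (Y : ℝ → ℝ) (Y' : ℝ → Fin n → ℝ) (V : ℝ), Controlled X Y Y' M V →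
      X.BoundedBy M → 0 ≤ V → ∀ t ∈ Ioc 0 T, ∀ (x : ℝ) (j : Fin n),
      |roughIntegral X (fun y => heatKernel t (x - y) * Y y)
        (fun y k => heatKernel t (x - y) * Y' y k) j| ≤ Q * (√t ^ (α - 1) + V) := by
  obtain ⟨C, hC, hcell⟩ := heatKernel_cell_bounds hT
  have hR := roughConst_nonneg n (M := M) hα
  refine ⟨roughConst n α M * C ^ α * C * (1 + C) * (1 + √T ^ α), by positivity, ?_⟩
  intro X Y Y' V hY hX hV t ht x j
  obtain ⟨N, hN, hN1, A, hA0, hAs, hA⟩ := hcell t ht x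
  obtain ⟨J, hJ, hadd, hbd⟩ := hY.exists_hasRoughIntegral hX hα hα' hV hM (isLip_heatKernel ht.1 x)
  rw [hJ.eq]
  set h := 2 * Real.pi / N with hh
  have hN' : (0 : ℝ) < N := by exact_mod_cast hN
  have hh0 : 0 < h := by positivity
  have hr := Real.sqrt_pos.2 ht.1
  have hsum := sum_eq_of_additive (hadd j) (unifPart_mono N) (unifPart_zero N) N
    (unifPart_last hN).le
  rw [unifPart_last hN] at hsum
  have hstep : ∀ i < N, |J j (unifPart N i) (unifPart N (i + 1))| ≤
      roughConst n α M * (h ^ α * (1 + h * V + h / √t)) * A i := by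
    intro i hi
    have hA' := hA i hi
    have e1 : unifPart N i = i * h := rfl
    have e2 : unifPart N (i + 1) = (i + 1) * h := by unfold unifPart; push_cast; rfl
    have hm := unifPart_mem_I (N := N) (i := i) hi.le hN
    have hm' := unifPart_mem_I (N := N) (i := i + 1) hi hN
    have := hbd j (unifPart N i) (unifPart N (i + 1)) (A i) (A i / √t) hm.1
      (unifPart_mono N (Nat.le_succ i)) hm'.2 (hA0 i) (div_nonneg (hA0 i) hr.le)
      (by rw [e1, e2]; exact hA'.1) (by rw [e1, e2]; exact hA'.2)
    rw [unifPart_succ_sub, ← hh, Real.rpow_add hh0, Real.rpow_one] at this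
    refine this.trans (le_of_eq ?_)
    ring
  have hhα : h ^ α ≤ C ^ α * √t ^ α := by
    rw [← Real.mul_rpow hC.le hr.le]
    exact Real.rpow_le_rpow hh0.le hN1 (by linarith)
  have hhr : h / √t ≤ C := by rw [div_le_iff₀ hr]; exact hN1
  have htT : √t ^ α ≤ √T ^ α :=
    Real.rpow_le_rpow hr.le (Real.sqrt_le_sqrt ht.2) (by linarith)
  have hpow : √t ^ α / √t = √t ^ (α - 1) := by rw [Real.rpow_sub_one hr.ne']
  have hTα : 0 ≤ √T ^ α := by positivity
  calc |J j 0 (2 * Real.pi)|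
      ≤ ∑ i ∈ Finset.range N, |J j (unifPart N i) (unifPart N (i + 1))| := by
        rw [← hsum]; exact Finset.abs_sum_le_sum_abs _ _
    _ ≤ ∑ i ∈ Finset.range N, roughConst n α M * (h ^ α * (1 + h * V + h / √t)) * A i :=
        Finset.sum_le_sum fun i hi => hstep i (Finset.mem_range.1 hi)
    _ = roughConst n α M * (h ^ α * (1 + h * V + h / √t)) * ∑ i ∈ Finset.range N, A i := by
        rw [Finset.mul_sum]
    _ ≤ roughConst n α M * ((C ^ α * √t ^ α) * (1 + (C * √t) * V + C)) * (C / √t) := by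
        have := Finset.sum_nonneg (s := Finset.range N) fun i _ => hA0 i
        gcongr
    _ = roughConst n α M * C ^ α * C *
          ((1 + C) * (√t ^ α / √t) + C * √t ^ α * V) := by
        field_simp
        ring
    _ ≤ roughConst n α M * C ^ α * C *
          ((1 + C) * (1 + √T ^ α) * √t ^ (α - 1) + (1 + C) * (1 + √T ^ α) * V) := by
        rw [hpow]
        have h0 : 0 ≤ √t ^ (α - 1) := by positivity
        gcongr
        · nlinarith
        · linarith
        · linarith
    _ = _ := by ring

/-! ### The rough term as a functional of the test function -/

section

variable {X : RoughPath n α} {g : E n → Matrix (Fin n) (Fin n) ℝ} {u : ℝ → E n} {M V : ℝ}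

theorem roughTermExists_of_controlled
    (hY : ∀ i j, Controlled X (fun x => g (u x) i j) (fun x k => partialG g i j k (u x)) M V)
    (hX : X.BoundedBy M) (hα : 1 / 3 < α) (hα' : α < 1 / 2) (hV : 0 ≤ V) (hM : 0 ≤ M)
    {φ : ℝ → ℝ} (hφ : IsLip φ) : RoughTermExists g X u φ := by
  intro i j
  obtain ⟨J, hJ, -⟩ := (hY i j).exists_hasRoughIntegral hX hα hα' hV hM hφ
  exact ⟨_, hJ⟩

theorem roughTerm_apply (φ : ℝ → ℝ) (i : Fin n) : roughTerm g X u φ i = ∑ j : Fin n,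
    roughIntegral X (fun x => φ x * g (u x) i j) (fun x k => φ x * partialG g i j k (u x)) j := rfl

theorem norm_roughTerm_le {φ : ℝ → ℝ} {R : ℝ} (h : ∀ i j : Fin n, |roughIntegral X
    (fun x => φ x * g (u x) i j) (fun x k => φ x * partialG g i j k (u x)) j| ≤ R) :
    ‖roughTerm g X u φ‖ ≤ (n : ℝ) ^ 2 * R := by
  calc ‖roughTerm g X u φ‖ ≤ ∑ i, |roughTerm g X u φ i| := norm_le_sum_abs _
    _ ≤ ∑ _i : Fin n, ∑ _j : Fin n, R := by
        refine Finset.sum_le_sum fun i _ => ?_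
        rw [roughTerm_apply]
        exact (Finset.abs_sum_le_sum_abs _ _).trans (Finset.sum_le_sum fun j _ => h i j)
    _ = _ := by simp; ring

theorem lipFunctional_roughTerm
    (hY : ∀ i j, Controlled X (fun x => g (u x) i j) (fun x k => partialG g i j k (u x)) M V)
    (hX : X.BoundedBy M) (hα : 1 / 3 < α) (hα' : α < 1 / 2) (hV : 0 ≤ V) (hM : 0 ≤ M) :
    LipFunctional (roughTerm g X u) ((n : ℝ) ^ 2 * (49 * roughConst n α M * (1 + V))) where
  map_add φ ψ hφ hψ := by
    ext i
    rw [PiLp.add_apply, roughTerm_apply, roughTerm_apply, roughTerm_apply,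
      ← Finset.sum_add_distrib]
    refine Finset.sum_congr rfl fun j _ => ?_
    obtain ⟨J, hJ⟩ := roughTermExists_of_controlled hY hX hα hα' hV hM hφ i j
    obtain ⟨K, hK⟩ := roughTermExists_of_controlled hY hX hα hα' hV hM hψ i j
    have := hJ.add hK
    simp only [← add_mul] at this
    rw [hJ.eq, hK.eq, this.eq, PiLp.add_apply]
  map_smul c φ hφ := by
    ext i
    rw [PiLp.smul_apply, roughTerm_apply, roughTerm_apply, Finset.smul_sum]
    refine Finset.sum_congr rfl fun j _ => ?_
    obtain ⟨J, hJ⟩ := roughTermExists_of_controlled hY hX hα hα' hV hM hφ i j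
    have := hJ.smul c
    simp only [← mul_assoc] at this
    rw [hJ.eq, this.eq, PiLp.smul_apply]
  bound φ A B hφ := by
    rw [mul_assoc]
    exact norm_roughTerm_le fun i j => (hY i j).abs_roughIntegral_le hX hα hα' hV hM hφ j

end

/-! ### Smooth functions of controlled paths -/

/-- Bounds for a smooth function, its derivative and its second order Taylor remainder on a ball. -/
theorem exists_taylor_bounds {G : E n → ℝ} (hG : ContDiff ℝ (⊤ : ℕ∞) G) (R : ℝ) :
    ∃ K : ℝ, 0 ≤ K ∧ ∀ w ∈ Metric.closedBall (0 : E n) R, |G w| ≤ K ∧ ‖fderiv ℝ G w‖ ≤ K ∧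
      ∀ w' ∈ Metric.closedBall (0 : E n) R, ‖fderiv ℝ G w' - fderiv ℝ G w‖ ≤ K * ‖w' - w‖ ∧
        |G w' - G w - fderiv ℝ G w (w' - w)| ≤ K * ‖w' - w‖ ^ 2 := by
  set S := Metric.closedBall (0 : E n) R
  have hS : IsCompact S := isCompact_closedBall 0 R
  have hSc : Convex ℝ S := convex_closedBall 0 R
  have hd : ContDiff ℝ 1 (fderiv ℝ G) := hG.fderiv_right (m := 1) (by norm_cast)
  obtain ⟨K1, hK1⟩ := hS.exists_bound_of_continuousOn hG.continuous.continuousOn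
  obtain ⟨K2, hK2⟩ := hS.exists_bound_of_continuousOn hd.continuous.continuousOn
  obtain ⟨K3, hK3⟩ := hd.contDiffOn.exists_lipschitzOnWith one_ne_zero hSc hS
  refine ⟨|K1| + |K2| + K3, by positivity, fun w hw => ⟨?_, ?_, fun w' hw' => ?_⟩⟩
  · have := (hK1 w hw).trans (le_abs_self K1)
    rw [Real.norm_eq_abs] at this
    linarith [abs_nonneg K2, K3.coe_nonneg]
  · have := (hK2 w hw).trans (le_abs_self K2)
    linarith [abs_nonneg K1, K3.coe_nonneg]
  have hl : ∀ z ∈ S, ‖fderiv ℝ G z - fderiv ℝ G w‖ ≤ K3 * ‖z - w‖ := fun z hz => by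
    simpa only [dist_eq_norm] using hK3.dist_le_mul z hz w hw
  have hle : (K3 : ℝ) ≤ |K1| + |K2| + K3 := by linarith [abs_nonneg K1, abs_nonneg K2]
  constructor
  · exact (hl w' hw').trans (by gcongr)
  · have hseg : segment ℝ w w' ⊆ S := hSc.segment_subset hw hw'
    have := (convex_segment w w').norm_image_sub_le_of_norm_hasFDerivWithin_le' (f := G)
      (f' := fderiv ℝ G) (φ := fderiv ℝ G w) (C := K3 * ‖w' - w‖)
      (fun z _ => (hG.differentiable (by simp) z).hasFDerivAt.hasFDerivWithinAt)
      (fun z hz => (hl z (hseg hz)).trans (by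
        gcongr
        rw [← dist_eq_norm, ← dist_eq_norm]
        have := dist_add_dist_of_mem_segment hz
        rw [dist_comm z w, dist_comm w' w]
        linarith [dist_nonneg (x := z) (y := w')]))
      (left_mem_segment ℝ w w') (right_mem_segment ℝ w w')
    rw [Real.norm_eq_abs] at this
    calc _ ≤ K3 * ‖w' - w‖ * ‖w' - w‖ := this
      _ ≤ (|K1| + |K2| + K3) * ‖w' - w‖ * ‖w' - w‖ := by gcongr
      _ = _ := by ring

theorem sum_partialG_mul (g : E n → Matrix (Fin n) (Fin n) ℝ) (i j : Fin n) (w z : E n) :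
    ∑ k, partialG g i j k w * z k = fderiv ℝ (fun z : E n => g z i j) w z := by
  have h : z = ∑ k, z k • EuclideanSpace.single k (1 : ℝ) := by
    ext l
    simp [Pi.single_apply]
  conv_rhs => rw [h, map_sum]
  refine Finset.sum_congr rfl fun k _ => ?_
  rw [map_smul, smul_eq_mul, mul_comm]
  rfl

/-- If `u = v + X` with `v` Lipschitz, then `g(u)` is controlled by `X`, with bounds that are linear
in the Lipschitz constant of `v`. The quadratic Taylor remainder of the Lipschitz part is linear in
that constant because `v` is bounded. -/
theorem exists_controlled_comp {g : E n → Matrix (Fin n) (Fin n) ℝ}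
    (hg : ∀ i j : Fin n, ContDiff ℝ (⊤ : ℕ∞) fun w => g w i j) {R H : ℝ} (hR : 0 ≤ R) (hH : 0 ≤ H) :
    ∃ M : ℝ, H ≤ M ∧ ∀ (X : RoughPath n α) (u : ℝ → E n) (V : ℝ), X.BoundedBy H → 0 ≤ V →
      (∀ x ∈ I, ‖u x‖ ≤ R) → (∀ x ∈ I, ‖u x - X.path x‖ ≤ R) →
      (∀ x ∈ I, ∀ y ∈ I, ‖(u y - X.path y) - (u x - X.path x)‖ ≤ V * |y - x|) →
      ∀ i j, Controlled X (fun x => g (u x) i j) (fun x k => partialG g i j k (u x)) M V := by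
  choose K hK0 hK using fun i j => exists_taylor_bounds (hg i j) R
  set K' := ∑ i, ∑ j, K i j with hK'
  have hKle : ∀ i j, K i j ≤ K' := fun i j => by
    have h1 : K i j ≤ ∑ j, K i j :=
      Finset.single_le_sum (f := fun j => K i j) (fun j _ => hK0 i j) (Finset.mem_univ j)
    exact h1.trans (Finset.single_le_sum (f := fun i => ∑ j, K i j)
      (fun i _ => Finset.sum_nonneg fun j _ => hK0 i j) (Finset.mem_univ i))
  have hK'0 : 0 ≤ K' := Finset.sum_nonneg fun i _ => Finset.sum_nonneg fun j _ => hK0 i j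
  have hHM : 0 ≤ K' * (1 + H + 2 * H ^ 2 + 4 * R) := by positivity
  refine ⟨H + K' * (1 + H + 2 * H ^ 2 + 4 * R), by linarith, ?_⟩
  intro X u V hX hV hu hv hlip i j
  set M := H + K' * (1 + H + 2 * H ^ 2 + 4 * R) with hM
  have hKM : ∀ c, c ≤ 1 + H + 2 * H ^ 2 + 4 * R → K' * c ≤ M := fun c hc => by
    have := mul_le_mul_of_nonneg_left hc hK'0
    linarith
  have hball : ∀ x ∈ I, u x ∈ Metric.closedBall (0 : E n) R := fun x hx => by
    simpa using hu x hx
  have hKM1 : K i j ≤ M := by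
    have := hKM 1 (by nlinarith)
    linarith [hKle i j]
  have hinc : ∀ x ∈ I, ∀ y ∈ I, ‖u y - u x‖ ≤ H * |y - x| ^ α + V * |y - x| := by
    intro x hx y hy
    have e : u y - u x = (X.path y - X.path x) + ((u y - X.path y) - (u x - X.path x)) := by abel
    rw [e]
    exact (norm_add_le _ _).trans (add_le_add (hX.path y hy x hx) (hlip x hx y hy))
  refine ⟨fun x hx => ((hK i j _ (hball x hx)).1).trans hKM1, fun x hx k => ?_,
    fun x hx y hy k => ?_, fun x hx y hy => ?_⟩
  · have h1 := (fderiv ℝ (fun z : E n => g z i j) (u x)).le_opNorm (EuclideanSpace.single k 1)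
    rw [PiLp.norm_single, norm_one, mul_one] at h1
    exact (h1.trans (hK i j _ (hball x hx)).2.1).trans hKM1
  · have h1 := (fderiv ℝ (fun z : E n => g z i j) (u y) -
      fderiv ℝ (fun z : E n => g z i j) (u x)).le_opNorm (EuclideanSpace.single k 1)
    rw [PiLp.norm_single, norm_one, mul_one] at h1
    have h2 := ((hK i j _ (hball x hx)).2.2 _ (hball y hy)).1
    have hα0 : 0 ≤ |y - x| ^ α := by positivity
    have hV0 : 0 ≤ V * |y - x| := by positivity
    calc _ ≤ K i j * ‖u y - u x‖ := h1.trans h2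
      _ ≤ K' * (H * |y - x| ^ α + V * |y - x|) := by
          gcongr
          · exact hKle i j
          · exact hinc x hx y hy
      _ = (K' * H) * |y - x| ^ α + (K' * 1) * (V * |y - x|) := by ring
      _ ≤ M * |y - x| ^ α + M * (V * |y - x|) := by
          gcongr
          · exact hKM H (by nlinarith)
          · exact hKM 1 (by nlinarith)
      _ = _ := by ring
  · set w := (u y - X.path y) - (u x - X.path x) with hw
    have hw1 : ‖w‖ ≤ V * |y - x| := hlip x hx y hy
    have hw2 : ‖w‖ ≤ 2 * R := (norm_sub_le _ _).trans (by linarith [hv x hx, hv y hy])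
    have hsplit : X.path y - X.path x = (u y - u x) - w := by rw [hw]; abel
    have e1 : ∑ k, partialG g i j k (u x) * (X.path y k - X.path x k) =
        fderiv ℝ (fun z : E n => g z i j) (u x) (u y - u x) -
          fderiv ℝ (fun z : E n => g z i j) (u x) w := by
      have := sum_partialG_mul g i j (u x) (X.path y - X.path x)
      rw [← map_sub, ← hsplit, ← this]
      rfl
    have h2 := ((hK i j _ (hball x hx)).2.2 _ (hball y hy)).2
    have h3 : |fderiv ℝ (fun z : E n => g z i j) (u x) w| ≤ K i j * ‖w‖ :=
      ((fderiv ℝ (fun z : E n => g z i j) (u x)).le_opNorm w).trans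
        (mul_le_mul_of_nonneg_right (hK i j _ (hball x hx)).2.1 (norm_nonneg _))
    have hsq : ‖u y - u x‖ ^ 2 ≤ 2 * H ^ 2 * |y - x| ^ (2 * α) + 4 * R * (V * |y - x|) := by
      have e : u y - u x = (X.path y - X.path x) + w := by rw [hsplit]; abel
      have hp := hX.path y hy x hx
      have hp2 : ‖X.path y - X.path x‖ ^ 2 ≤ H ^ 2 * |y - x| ^ (2 * α) := by
        calc _ ≤ (H * |y - x| ^ α) ^ 2 := by gcongr
          _ = _ := by
            rw [mul_pow, ← Real.rpow_natCast (|y - x| ^ α), ← Real.rpow_mul (abs_nonneg _)]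
            push_cast
            ring_nf
      have hw3 : ‖w‖ ^ 2 ≤ 2 * R * (V * |y - x|) := by
        rw [sq]
        exact mul_le_mul hw2 hw1 (norm_nonneg _) (by linarith)
      have hn : ‖u y - u x‖ ≤ ‖X.path y - X.path x‖ + ‖w‖ := by rw [e]; exact norm_add_le _ _
      calc ‖u y - u x‖ ^ 2 ≤ (‖X.path y - X.path x‖ + ‖w‖) ^ 2 := by gcongr
        _ ≤ 2 * ‖X.path y - X.path x‖ ^ 2 + 2 * ‖w‖ ^ 2 := by
            nlinarith [sq_nonneg (‖X.path y - X.path x‖ - ‖w‖)]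
        _ ≤ _ := by linarith
    have hV0 : 0 ≤ V * |y - x| := by positivity
    have hα0 : 0 ≤ |y - x| ^ (2 * α) := by positivity
    calc _ = |(g (u y) i j - g (u x) i j - fderiv ℝ (fun z : E n => g z i j) (u x) (u y - u x)) +
          fderiv ℝ (fun z : E n => g z i j) (u x) w| := by rw [e1]; ring_nf
      _ ≤ K i j * ‖u y - u x‖ ^ 2 + K i j * ‖w‖ := (abs_add_le _ _).trans (add_le_add h2 h3)
      _ ≤ K' * (2 * H ^ 2 * |y - x| ^ (2 * α) + 4 * R * (V * |y - x|)) + K' * (V * |y - x|) := by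
          gcongr
          · exact hKle i j
          · exact hKle i j
      _ = (K' * (2 * H ^ 2)) * |y - x| ^ (2 * α) + (K' * (4 * R + 1)) * (V * |y - x|) := by ring
      _ ≤ M * |y - x| ^ (2 * α) + M * (V * |y - x|) := by
          gcongr
          · exact hKM _ (by nlinarith)
          · exact hKM _ (by nlinarith)
      _ = _ := by ring

end

section

/-! ### The three families of functionals along a path -/

variable {n : ℕ} {α T : ℝ}

theorem RoughPath.BoundedBy.mono {X : RoughPath n α} {M M' : ℝ} (h : X.BoundedBy M) (hM : M ≤ M') :
    X.BoundedBy M' where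
  path x hx y hy := (h.path x hx y hy).trans (by gcongr)
  area x hx y hy i j := (h.area x hx y hy i j).trans (by gcongr)

theorem RoughPath.exists_boundedBy (X : RoughPath n α) : ∃ M, 0 ≤ M ∧ X.BoundedBy M := by
  obtain ⟨C, hC⟩ := X.holder_path
  obtain ⟨D, hD⟩ := X.holder_area
  refine ⟨|C| + |D|, by positivity, fun x hx y hy => ?_, fun x hx y hy i j => ?_⟩
  · refine (hC x hx y hy).trans ?_
    gcongr
    linarith [le_abs_self C, abs_nonneg D]
  · refine (hD x hx y hy i j).trans ?_
    gcongr
    linarith [le_abs_self D, abs_nonneg C]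

theorem RoughPath.Close.boundedBy {X Y : RoughPath n α} {ε M : ℝ} (h : X.Close Y ε)
    (hY : Y.BoundedBy M) : X.BoundedBy (M + ε) where
  path x hx y hy := by
    have e : X.path x - X.path y = (Y.path x - Y.path y) +
        ((X.path x - Y.path x) - (X.path y - Y.path y)) := by abel
    rw [e, add_mul]
    exact (norm_add_le _ _).trans (add_le_add (hY.path x hx y hy) (h.2.1 x hx y hy))
  area x hx y hy i j := by
    have e : X.area x y i j = Y.area x y i j + (X.area x y i j - Y.area x y i j) := by ring
    rw [e, add_mul]
    exact (abs_add_le _ _).trans (add_le_add (hY.area x hx y hy i j) (h.2.2 x hx y hy i j))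

/-- By compactness of `[0, T]`, the rough paths have a common Hölder bound. -/
theorem ContinuousInRoughPaths.exists_boundedBy {Ψ : ℝ → RoughPath n α}
    (h : ContinuousInRoughPaths T Ψ) : ∃ H, 0 ≤ H ∧ ∀ s ∈ Icc 0 T, (Ψ s).BoundedBy H := by
  refine isCompact_Icc.induction_on (s := Icc 0 T)
    (p := fun S => ∃ H, 0 ≤ H ∧ ∀ s ∈ S, (Ψ s).BoundedBy H) ⟨0, le_rfl, by simp⟩ ?_ ?_ ?_
  · rintro S S' hS ⟨H, hH, h⟩
    exact ⟨H, hH, fun s hs => h s (hS hs)⟩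
  · rintro S S' ⟨H, hH, h⟩ ⟨H', hH', h'⟩
    refine ⟨max H H', le_max_of_le_left hH, fun s hs => ?_⟩
    rcases hs with hs | hs
    · exact (h s hs).mono (le_max_left _ _)
    · exact (h' s hs).mono (le_max_right _ _)
  · intro t ht
    obtain ⟨M, hM, hb⟩ := (Ψ t).exists_boundedBy
    exact ⟨_, h t ht 1 one_pos, M + 1, by positivity, fun s hs => RoughPath.Close.boundedBy hs hb⟩

theorem ContinuousInRoughPaths.continuousOn_path {Ψ : ℝ → RoughPath n α}
    (h : ContinuousInRoughPaths T Ψ) {x : ℝ} (hx : x ∈ I) :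
    ContinuousOn (fun s => (Ψ s).path x) (Icc 0 T) := by
  intro t ht
  rw [ContinuousWithinAt, Metric.tendsto_nhds]
  intro ε hε
  filter_upwards [h t ht (ε / 2) (by positivity)] with s hs
  rw [dist_eq_norm]
  linarith [hs.1 x hx]

theorem ContinuousInRoughPaths.continuousOn_area {Ψ : ℝ → RoughPath n α}
    (h : ContinuousInRoughPaths T Ψ) {x y : ℝ} (hx : x ∈ I) (hy : y ∈ I) (i j : Fin n) :
    ContinuousOn (fun s => (Ψ s).area x y i j) (Icc 0 T) := by
  intro t ht
  rw [ContinuousWithinAt, Metric.tendsto_nhds]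
  intro ε hε
  set L := |x - y| ^ (2 * α) with hL
  have hL0 : 0 ≤ L := by positivity
  filter_upwards [h t ht (ε / (L + 1)) (by positivity)] with s hs
  rw [Real.dist_eq]
  refine (hs.2.2 x hx y hy i j).trans_lt ?_
  rw [← hL, div_mul_eq_mul_div, div_lt_iff₀ (by positivity)]
  nlinarith

theorem continuous_partialG {g : E n → Matrix (Fin n) (Fin n) ℝ}
    (hg : ∀ i j : Fin n, ContDiff ℝ (⊤ : ℕ∞) fun w => g w i j) (i j k : Fin n) :
    Continuous (partialG g i j k) :=
  ((hg i j).continuous_fderiv (by simp)).clm_apply continuous_const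

/-- The rough term depends measurably on time, as a limit of Riemann sums that are continuous in
time. -/
theorem aestronglyMeasurable_roughTerm {g : E n → Matrix (Fin n) (Fin n) ℝ}
    (hg : ∀ i j : Fin n, ContDiff ℝ (⊤ : ℕ∞) fun w => g w i j) {Ψ : ℝ → RoughPath n α}
    (hΨ : ContinuousInRoughPaths T Ψ) {u : ℝ → ℝ → E n}
    (hu : ContinuousOn (fun q : ℝ × ℝ => u q.1 q.2) (Icc 0 T ×ˢ I)) (φ : ℝ → ℝ)
    (hex : ∀ᵐ s ∂(volume.restrict (Ioc 0 T)), RoughTermExists g (Ψ s) (u s) φ) :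
    AEStronglyMeasurable (fun s => roughTerm g (Ψ s) (u s) φ) (volume.restrict (Ioc 0 T)) := by
  have hus : ∀ x ∈ I, ContinuousOn (fun s => u s x) (Icc 0 T) := fun x hx =>
    hu.comp (f := fun s => (s, x)) (by fun_prop) fun s hs => ⟨hs, hx⟩
  refine aestronglyMeasurable_of_tendsto_ae atTop
    (f := fun N s => WithLp.toLp 2 fun i => ∑ j, ∑ l ∈ Finset.range (N + 1),
      germ (Ψ s) (fun x => φ x * g (u s x) i j) (fun x k => φ x * partialG g i j k (u s x))
        (unifPart (N + 1) l) (unifPart (N + 1) (l + 1)) j) (fun N => ?_) ?_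
  · refine (ContinuousOn.mono ?_ Ioc_subset_Icc_self).aestronglyMeasurable measurableSet_Ioc
    refine (PiLp.continuous_toLp 2 _).comp_continuousOn (continuousOn_pi.2 fun i => ?_)
    refine continuousOn_finsetSum _ fun j _ => continuousOn_finsetSum _ fun l hl => ?_
    have hl' := Finset.mem_range.1 hl
    have h1 : unifPart (N + 1) l ∈ I := unifPart_mem_I hl'.le (Nat.succ_pos N)
    have h2 : unifPart (N + 1) (l + 1) ∈ I := unifPart_mem_I hl' (Nat.succ_pos N)
    simp only [germ_apply]
    have hp : ∀ x ∈ I, ContinuousOn (fun s => (Ψ s).path x j) (Icc 0 T) := fun x hx =>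
      (EuclideanSpace.proj (𝕜 := ℝ) j).continuous.comp_continuousOn (hΨ.continuousOn_path hx)
    refine ContinuousOn.add (ContinuousOn.mul (continuousOn_const.mul ?_) ?_) ?_
    · exact (hg i j).continuous.comp_continuousOn (hus _ h1)
    · exact (hp _ h2).sub (hp _ h1)
    · refine continuousOn_finsetSum _ fun k _ => ContinuousOn.mul (continuousOn_const.mul ?_) ?_
      · exact (continuous_partialG hg i j k).comp_continuousOn (hus _ h1)
      · exact hΨ.continuousOn_area h1 h2 k j
  · filter_upwards [hex] with s hs
    refine ((PiLp.continuous_toLp 2 _).tendsto _).comp (tendsto_pi_nhds.2 fun i => ?_)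
    refine tendsto_finsetSum _ fun j _ => ?_
    obtain ⟨J, hJ⟩ := hs i j
    rw [hJ.eq]
    have := ((EuclideanSpace.proj (𝕜 := ℝ) j).continuous.tendsto J).comp hJ.tendsto
    simpa [Function.comp_def] using this

theorem norm_le_normC1 {w : ℝ → E n} (hw : ContDiffOn ℝ 1 w I) :
    0 ≤ normC1 w ∧ (∀ x ∈ I, ‖dx w x‖ ≤ normC1 w) ∧
      ∀ x ∈ I, ∀ y ∈ I, ‖w y - w x‖ ≤ normC1 w * |y - x| := by
  have hud : UniqueDiffOn ℝ I := uniqueDiffOn_Icc two_pi_pos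
  have hdc : ContinuousOn (dx w) I := hw.continuousOn_derivWithin hud le_rfl
  have hbdd : BddAbove (range fun x : I => ‖dx w x‖) := by
    obtain ⟨C, hC⟩ := isCompact_Icc.exists_bound_of_continuousOn (s := I) hdc
    exact ⟨C, by rintro _ ⟨x, rfl⟩; exact hC x x.2⟩
  have h0 : 0 ≤ ⨆ x : I, ‖w x‖ := Real.iSup_nonneg fun x => norm_nonneg _
  have h1 : 0 ≤ ⨆ x : I, ‖dx w x‖ := Real.iSup_nonneg fun x => norm_nonneg _
  have hd : ∀ x ∈ I, ‖dx w x‖ ≤ normC1 w := fun x hx => by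
    have := le_ciSup hbdd ⟨x, hx⟩
    simp only [normC1]
    linarith
  refine ⟨add_nonneg h0 h1, hd, fun x hx y hy => ?_⟩
  have := (convex_Icc 0 (2 * Real.pi)).norm_image_sub_le_of_norm_derivWithin_le
    (hw.differentiableOn one_ne_zero) hd hx hy
  simpa only [Real.norm_eq_abs] using this

theorem dx_eq_tendsto {w : ℝ → E n} (hw : ContDiffOn ℝ 1 w I) {x : ℝ} (hx : x ∈ Ioo 0 (2 * Real.pi)) :
    Tendsto (fun m : ℕ => ((m : ℝ) + 1) • (w (min (x + 1 / ((m : ℝ) + 1)) (2 * Real.pi)) - w x))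
      atTop (𝓝 (dx w x)) := by
  have hI : I ∈ 𝓝 x := Icc_mem_nhds hx.1 hx.2
  have hd : HasDerivAt w (dx w x) x :=
    ((hw.differentiableOn one_ne_zero x (Ioo_subset_Icc_self hx)).hasDerivWithinAt).hasDerivAt hI
  have h1 : Tendsto (fun m : ℕ => 1 / ((m : ℝ) + 1)) atTop (𝓝[≠] 0) :=
    tendsto_nhdsWithin_iff.2 ⟨tendsto_one_div_add_atTop_nhds_zero_nat,
      Eventually.of_forall fun m => by simp only [mem_compl_iff, mem_singleton_iff]; positivity⟩
  have h2 := (hasDerivAt_iff_tendsto_slope_zero.1 hd).comp h1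
  refine h2.congr' ?_
  have h3 : ∀ᶠ m : ℕ in atTop, 1 / ((m : ℝ) + 1) < 2 * Real.pi - x :=
    tendsto_one_div_add_atTop_nhds_zero_nat.eventually (gt_mem_nhds (by linarith [hx.2]))
  filter_upwards [h3] with m hm
  simp only [Function.comp, one_div, inv_inv] at hm ⊢
  rw [min_eq_left (by linarith)]

/-- The spatial derivative is jointly measurable, as an almost everywhere limit of difference
quotients. -/
theorem aestronglyMeasurable_dx {v : ℝ → ℝ → E n} (hv : InSolutionSpace T v) :
    AEStronglyMeasurable (fun z : ℝ × ℝ => dx (v z.1) z.2)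
      ((volume.restrict (Ioc 0 T)).prod (volume.restrict (Ioc 0 (2 * Real.pi)))) := by
  refine aestronglyMeasurable_of_tendsto_ae atTop (f := fun (m : ℕ) z =>
    ((m : ℝ) + 1) • (v z.1 (min (z.2 + 1 / ((m : ℝ) + 1)) (2 * Real.pi)) - v z.1 z.2))
    (fun m => ?_) ?_
  · rw [Measure.prod_restrict]
    refine ContinuousOn.aestronglyMeasurable ?_ (measurableSet_Ioc.prod measurableSet_Ioc)
    refine ContinuousOn.const_smul (ContinuousOn.sub ?_ ?_) ((m : ℝ) + 1)
    · refine hv.1.comp (f := fun z : ℝ × ℝ => (z.1, min (z.2 + 1 / ((m : ℝ) + 1)) (2 * Real.pi)))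
        (by fun_prop) fun z hz => ⟨Ioc_subset_Icc_self hz.1, ?_, min_le_right _ _⟩
      have : (0 : ℝ) ≤ 1 / ((m : ℝ) + 1) := by positivity
      exact le_min (by linarith [hz.2.1]) two_pi_pos.le
    · exact hv.1.mono (prod_mono Ioc_subset_Icc_self Ioc_subset_Icc_self)
  · have h1 : ∀ᵐ s ∂(volume.restrict (Ioc 0 T)), ContDiffOn ℝ 1 (v s) I :=
      ae_restrict_of_ae_restrict_of_subset Ioc_subset_Icc_self hv.2.1
    filter_upwards [Measure.quasiMeasurePreserving_fst.ae h1,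
      Measure.quasiMeasurePreserving_snd.ae (ae_restrict_lt (2 * Real.pi))] with z hz1 hz2
    exact dx_eq_tendsto hz1 hz2

/-- Pairings with a time-dependent function, bounded in space by an integrable function of time. -/
theorem lipFamily_pairing {w : ℝ → ℝ → E n} {V : ℝ → ℝ}
    (hw : ∀ᵐ s ∂(volume.restrict (Ioc 0 T)), ContinuousOn (w s) I ∧ ∀ x ∈ I, ‖w s x‖ ≤ V s)
    (hV : IntegrableOn V (Ioc 0 T))
    (hm : AEStronglyMeasurable (fun z : ℝ × ℝ => w z.1 z.2)
      ((volume.restrict (Ioc 0 T)).prod (volume.restrict (Ioc 0 (2 * Real.pi))))) :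
    LipFamily T (fun s φ => pairing φ (w s)) (fun s => 7 * V s) ∧
      HeatBound T (fun s φ => pairing φ (w s)) (fun s => 7 * V s) (fun _ => 0) := by
  refine ⟨⟨?_, hV.const_mul 7, fun k θ => ?_⟩, integrableOn_zero, ?_⟩
  · filter_upwards [hw] with s hs
    refine (lipFunctional_pairing (intervalIntegrable_of_continuousOn_I hs.1)).mono ?_
    have h0 : 0 ≤ V s := (norm_nonneg _).trans (hs.2 0 zero_mem_I)
    calc ∫ x in (0)..(2 * Real.pi), ‖w s x‖ ≤ ∫ _x in (0)..(2 * Real.pi), V s := by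
          refine intervalIntegral.integral_mono_on two_pi_pos.le
            (intervalIntegrable_of_continuousOn_I hs.1.norm) intervalIntegrable_const
            fun x hx => hs.2 x hx
      _ = 2 * Real.pi * V s := by simp
      _ ≤ 7 * V s := by
          gcongr
          linarith [Real.pi_lt_d2]
  · have h1 : AEStronglyMeasurable (fun z : ℝ × ℝ => mode k θ z.2 • w z.1 z.2)
        ((volume.restrict (Ioc 0 T)).prod (volume.restrict (Ioc 0 (2 * Real.pi)))) :=
      ((continuous_mode k θ).comp continuous_snd).aestronglyMeasurable.smul hm
    have h2 := h1.integral_prod_right'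
    refine h2.congr (Eventually.of_forall fun s => ?_)
    simp only [pairing]
    rw [intervalIntegral.integral_of_le two_pi_pos.le]
  · filter_upwards [hw] with s hs τ hτ x
    have h0 : 0 ≤ V s := (norm_nonneg _).trans (hs.2 0 zero_mem_I)
    have := norm_pairing_heatKernel_le (w := w s) hτ.1 x
      (fun y hy => hs.2 y (Ioo_subset_Icc_self hy))
    linarith

theorem exists_bound_family {F : Type*} [NormedAddCommGroup F] {a : ℝ → ℝ → F}
    (ha : ContinuousOn (fun q : ℝ × ℝ => a q.1 q.2) (Icc 0 T ×ˢ I)) :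
    ∃ R, 0 ≤ R ∧ ∀ s ∈ Icc 0 T, ∀ x ∈ I, ‖a s x‖ ≤ R := by
  obtain ⟨R, hR⟩ := (isCompact_Icc.prod isCompact_Icc).exists_bound_of_continuousOn ha
  exact ⟨|R|, abs_nonneg _, fun s hs x hx => (hR (s, x) ⟨hs, hx⟩).trans (le_abs_self R)⟩

theorem exists_lipFamily_fHat {f : E n → E n} (hf : Continuous f) {u : ℝ → ℝ → E n}
    (hu : ContinuousOn (fun q : ℝ × ℝ => u q.1 q.2) (Icc 0 T ×ˢ I)) :
    ∃ V κ, LipFamily T (fun s φ => pairing φ fun x => fHat f (u s x)) V ∧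
      HeatBound T (fun s φ => pairing φ fun x => fHat f (u s x)) V κ := by
  have hc : ContinuousOn (fun q : ℝ × ℝ => fHat f (u q.1 q.2)) (Icc 0 T ×ˢ I) :=
    (hf.comp_continuousOn hu).add hu
  obtain ⟨R, -, hR⟩ := exists_bound_family (a := fun s x => fHat f (u s x)) hc
  refine ⟨_, _, lipFamily_pairing (V := fun _ => R) ?_ (integrableOn_const (by simp)) ?_⟩
  · filter_upwards [ae_restrict_mem measurableSet_Ioc] with s hs
    have hs' := Ioc_subset_Icc_self hs
    exact ⟨continuousOn_slice (a := fun s x => fHat f (u s x)) hc hs', hR s hs'⟩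
  · rw [Measure.prod_restrict]
    exact (hc.mono (prod_mono Ioc_subset_Icc_self Ioc_subset_Icc_self)).aestronglyMeasurable
      (measurableSet_Ioc.prod measurableSet_Ioc)

theorem continuous_mulVec {g : E n → Matrix (Fin n) (Fin n) ℝ}
    (hg : ∀ i j : Fin n, Continuous fun w => g w i j) :
    Continuous fun p : E n × E n => WithLp.toLp 2 (g p.1 *ᵥ p.2.ofLp) := by
  refine (PiLp.continuous_toLp 2 _).comp (continuous_pi fun i => ?_)
  simp only [Matrix.mulVec, dotProduct]
  refine continuous_finsetSum _ fun j _ => ((hg i j).comp continuous_fst).mul ?_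
  exact (EuclideanSpace.proj (𝕜 := ℝ) j).continuous.comp continuous_snd

theorem norm_mulVec_le (A : Matrix (Fin n) (Fin n) ℝ) (d : E n) :
    ‖WithLp.toLp 2 (A *ᵥ d.ofLp)‖ ≤ (∑ i, ∑ j, |A i j|) * ‖d‖ := by
  refine (norm_le_sum_abs _).trans ?_
  rw [Finset.sum_mul]
  refine Finset.sum_le_sum fun i _ => ?_
  rw [Finset.sum_mul]
  simp only [Matrix.mulVec, dotProduct]
  refine (Finset.abs_sum_le_sum_abs _ _).trans (Finset.sum_le_sum fun j _ => ?_)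
  rw [abs_mul]
  gcongr
  exact abs_coord_le d j

theorem exists_lipFamily_transport {g : E n → Matrix (Fin n) (Fin n) ℝ}
    (hg : ∀ i j : Fin n, Continuous fun w => g w i j) {u v : ℝ → ℝ → E n}
    (hu : ContinuousOn (fun q : ℝ × ℝ => u q.1 q.2) (Icc 0 T ×ˢ I)) (hv : InSolutionSpace T v) :
    (∀ᵐ s ∂(volume.restrict (Ioc 0 T)), ContinuousOn (transport g (u s) (v s)) I) ∧
    ∃ V κ, LipFamily T (fun s φ => pairing φ (transport g (u s) (v s))) V ∧
      HeatBound T (fun s φ => pairing φ (transport g (u s) (v s))) V κ := by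
  have hC1 : ∀ᵐ s ∂(volume.restrict (Ioc 0 T)), ContDiffOn ℝ 1 (v s) I :=
    ae_restrict_of_ae_restrict_of_subset Ioc_subset_Icc_self hv.2.1
  have hsum : ContinuousOn (fun q : ℝ × ℝ => ∑ i, ∑ j, |g (u q.1 q.2) i j|) (Icc 0 T ×ˢ I) :=
    continuousOn_finsetSum _ fun i _ => continuousOn_finsetSum _ fun j _ =>
      ((hg i j).comp_continuousOn hu).abs
  obtain ⟨R, hR0, hR⟩ := exists_bound_family (a := fun s x => ∑ i, ∑ j, |g (u s x) i j|) hsum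
  have hcont : ∀ᵐ s ∂(volume.restrict (Ioc 0 T)), ContinuousOn (transport g (u s) (v s)) I := by
    filter_upwards [hC1, ae_restrict_mem measurableSet_Ioc] with s hs hsT
    have h1 := continuousOn_slice hu (Ioc_subset_Icc_self hsT)
    have h2 : ContinuousOn (dx (v s)) I :=
      hs.continuousOn_derivWithin (uniqueDiffOn_Icc two_pi_pos) le_rfl
    exact (continuous_mulVec hg).comp_continuousOn (h1.prodMk h2)
  refine ⟨hcont, _, _, lipFamily_pairing (V := fun s => R * normC1 (v s)) ?_
    ((hv.2.2.mono_set Ioc_subset_Icc_self).const_mul R) ?_⟩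
  · filter_upwards [hC1, hcont, ae_restrict_mem measurableSet_Ioc] with s hs hsc hsT
    refine ⟨hsc, fun x hx => (norm_mulVec_le _ _).trans ?_⟩
    have h1 := hR s (Ioc_subset_Icc_self hsT) x hx
    rw [Real.norm_eq_abs] at h1
    exact mul_le_mul ((le_abs_self _).trans h1) ((norm_le_normC1 hs).2.1 x hx) (norm_nonneg _) hR0
  · have hum : AEStronglyMeasurable (fun z : ℝ × ℝ => u z.1 z.2)
        ((volume.restrict (Ioc 0 T)).prod (volume.restrict (Ioc 0 (2 * Real.pi)))) := by
      rw [Measure.prod_restrict]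
      exact (hu.mono (prod_mono Ioc_subset_Icc_self Ioc_subset_Icc_self)).aestronglyMeasurable
        (measurableSet_Ioc.prod measurableSet_Ioc)
    exact (continuous_mulVec hg).comp_aestronglyMeasurable (hum.prodMk (aestronglyMeasurable_dx hv))

theorem exists_lipFamily_roughTerm (hα : 1 / 3 < α) (hα' : α < 1 / 2) (hT : 0 < T)
    {g : E n → Matrix (Fin n) (Fin n) ℝ}
    (hg : ∀ i j : Fin n, ContDiff ℝ (⊤ : ℕ∞) fun w => g w i j) {Ψ : ℝ → RoughPath n α}
    (hΨ : ContinuousInRoughPaths T Ψ) {u : ℝ → ℝ → E n}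
    (hu : ContinuousOn (fun q : ℝ × ℝ => u q.1 q.2) (Icc 0 T ×ˢ I))
    (hv : InSolutionSpace T (shifted Ψ u)) :
    (∀ᵐ s ∂(volume.restrict (Ioc 0 T)), ∀ φ, IsLip φ → RoughTermExists g (Ψ s) (u s) φ) ∧
    ∃ V κ, LipFamily T (fun s => roughTerm g (Ψ s) (u s)) V ∧
      HeatBound T (fun s => roughTerm g (Ψ s) (u s)) V κ := by
  obtain ⟨H, hH0, hH⟩ := hΨ.exists_boundedBy
  obtain ⟨R₁, hR₁, hu'⟩ := exists_bound_family hu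
  obtain ⟨R₂, hR₂, hv'⟩ := exists_bound_family hv.1
  obtain ⟨M, hHM, hM⟩ := exists_controlled_comp (α := α) hg (R := max R₁ R₂)
    (le_max_of_le_left hR₁) hH0
  have hM0 : 0 ≤ M := hH0.trans hHM
  obtain ⟨Q, hQ0, hQ⟩ := exists_roughIntegral_heatKernel_bound n M hα hα' hT hM0
  have hC1 : ∀ᵐ s ∂(volume.restrict (Ioc 0 T)), ContDiffOn ℝ 1 (shifted Ψ u s) I :=
    ae_restrict_of_ae_restrict_of_subset Ioc_subset_Icc_self hv.2.1
  set V : ℝ → ℝ := fun s => normC1 (shifted Ψ u s) with hV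
  have hVi : IntegrableOn V (Ioc 0 T) := hv.2.2.mono_set Ioc_subset_Icc_self
  have hgood : ∀ᵐ s ∂(volume.restrict (Ioc 0 T)), 0 ≤ V s ∧ (Ψ s).BoundedBy M ∧ ∀ i j,
      Controlled (Ψ s) (fun x => g (u s x) i j) (fun x k => partialG g i j k (u s x)) M (V s) := by
    filter_upwards [hC1, ae_restrict_mem measurableSet_Ioc] with s hs hsT
    have hsT' := Ioc_subset_Icc_self hsT
    obtain ⟨h0, -, hlip⟩ := norm_le_normC1 hs
    exact ⟨h0, (hH s hsT').mono hHM, hM (Ψ s) (u s) (V s) (hH s hsT') h0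
      (fun x hx => (hu' s hsT' x hx).trans (le_max_left _ _))
      (fun x hx => (hv' s hsT' x hx).trans (le_max_right _ _)) hlip⟩
  have hex : ∀ᵐ s ∂(volume.restrict (Ioc 0 T)), ∀ φ, IsLip φ →
      RoughTermExists g (Ψ s) (u s) φ := by
    filter_upwards [hgood] with s hs φ hφ
    exact roughTermExists_of_controlled hs.2.2 hs.2.1 hα hα' hs.1 hM0 hφ
  have hS := roughConst_nonneg n (M := M) hα
  refine ⟨hex, fun s => (n : ℝ) ^ 2 * ((49 * roughConst n α M + Q) * (1 + V s)),
    fun τ => (n : ℝ) ^ 2 * (Q * √τ ^ (α - 1)), ⟨?_, ?_, fun k θ => ?_⟩, ?_, ?_⟩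
  · filter_upwards [hgood] with s hs
    refine (lipFunctional_roughTerm hs.2.2 hs.2.1 hα hα' hs.1 hM0).mono ?_
    have := hs.1
    gcongr
    linarith
  · exact (((integrableOn_const (by simp)).add hVi).const_mul _).const_mul _
  · refine aestronglyMeasurable_roughTerm hg hΨ hu (mode k θ) ?_
    filter_upwards [hex] with s hs
    exact hs _ (isLip_mode k θ)
  · have h1 : IntervalIntegrable (fun τ : ℝ => τ ^ ((α - 1) / 2)) volume 0 T :=
      intervalIntegral.intervalIntegrable_rpow' (by linarith)
    rw [intervalIntegrable_iff_integrableOn_Ioc_of_le hT.le] at h1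
    refine IntegrableOn.congr_fun ((h1.const_mul Q).const_mul ((n : ℝ) ^ 2)) (fun τ hτ => ?_)
      measurableSet_Ioc
    rw [Real.sqrt_eq_rpow, ← Real.rpow_mul hτ.1.le]
    ring_nf
  · filter_upwards [hgood] with s hs τ hτ x
    have h1 := norm_roughTerm_le (X := Ψ s) (g := g) (u := u s)
      (φ := fun y => heatKernel τ (x - y)) fun i j =>
      hQ (Ψ s) _ _ (V s) (hs.2.2 i j) hs.2.1 hs.1 τ hτ x j
    refine h1.trans ?_
    rw [← mul_add]
    have := hs.1
    have h2 : 0 ≤ 49 * roughConst n α M * (1 + V s) := by positivity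
    gcongr
    nlinarith

theorem LipFamily.intervalIntegrable_of_smooth {L : ℝ → (ℝ → ℝ) → E n} {V : ℝ → ℝ}
    (h : LipFamily T L V) (hT : 0 ≤ T) {φ : ℝ → ℝ} (hφ : ContDiff ℝ (⊤ : ℕ∞) φ)
    (hp : Function.Periodic φ (2 * Real.pi)) : IntervalIntegrable (fun s => L s φ) volume 0 T := by
  obtain ⟨r, θ, hr, -, hs, -⟩ := exists_mode_expansion hφ hp
  exact (h.integral_series hT hr fun y _ => hs y).1

/-- The equivalence of the weak and the mild formulation along a single path. -/
theorem mildIdentity_iff_weakIdentity (hα : 1 / 3 < α) (hα' : α < 1 / 2) (hT : 0 < T)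
    {f : E n → E n} (hf : ContDiff ℝ (⊤ : ℕ∞) f) {g : E n → Matrix (Fin n) (Fin n) ℝ}
    (hg : ∀ i j : Fin n, ContDiff ℝ (⊤ : ℕ∞) fun w => g w i j) {Ψ : ℝ → RoughPath n α}
    (hΨ : ContinuousInRoughPaths T Ψ) {u : ℝ → ℝ → E n}
    (hu : ContinuousOn (fun q : ℝ × ℝ => u q.1 q.2) (Icc 0 T ×ˢ I))
    (hv : InSolutionSpace T (shifted Ψ u)) :
    (∀ x ∈ I, ∀ t ∈ Ioc 0 T, MildIdentity f g Ψ u (shifted Ψ u) t x) ↔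
      ∀ φ : ℝ → ℝ, ContDiff ℝ (⊤ : ℕ∞) φ → Function.Periodic φ (2 * Real.pi) → ∀ t ∈ Icc 0 T,
        WeakIdentity f g Ψ u (shifted Ψ u) φ t := by
  obtain ⟨hc1, V1, κ1, hL1, hb1⟩ := exists_lipFamily_transport (fun i j => (hg i j).continuous) hu hv
  obtain ⟨hex, V2, κ2, hL2, hb2⟩ := exists_lipFamily_roughTerm hα hα' hT hg hΨ hu hv
  obtain ⟨V3, κ3, hL3, hb3⟩ := exists_lipFamily_fHat hf.continuous hu
  have hL := (hL1.add hL2).add hL3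
  have hb := (hb1.add hb2).add hb3
  have hcv := hv.1
  refine Iff.trans ?_ ((mild_iff_modeDuhamel hT.le hcv hL hb).trans
    ((weak_iff_modeDuhamel hT.le hcv hL).symm.trans ?_))
  · refine forall_congr' fun x => forall_congr' fun _ => forall_congr' fun t =>
      forall_congr' fun ht => ?_
    have i1 := (hL1.mono ht.2).intervalIntegrable_heat (hb1.mono ht.2) ht.1.le x
    have i2 := (hL2.mono ht.2).intervalIntegrable_heat (hb2.mono ht.2) ht.1.le x
    have i3 := (hL3.mono ht.2).intervalIntegrable_heat (hb3.mono ht.2) ht.1.le x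
    -- the semigroup is applied to the sum of the transport and the reaction term
    have hsplit : ∀ᵐ s ∂(volume.restrict (Ioc 0 t)),
        semigroup (t - s) (fun y => transport g (u s) (shifted Ψ u s) y + fHat f (u s y)) x =
          pairing (fun y => heatKernel (t - s) (x - y)) (transport g (u s) (shifted Ψ u s)) +
          pairing (fun y => heatKernel (t - s) (x - y)) (fun y => fHat f (u s y)) := by
      filter_upwards [ae_restrict_of_ae_restrict_of_subset (Ioc_subset_Ioc_right ht.2) hc1,
        ae_restrict_lt t] with s hs hst
      have hk := continuous_heatKernel_sub (t := t - s) (by linarith [hst.2]) x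
      have hus := continuousOn_slice hu ⟨hst.1.le, hst.2.le.trans ht.2⟩
      simp only [semigroup, pairing, smul_add]
      exact intervalIntegral.integral_add
        (intervalIntegrable_of_continuousOn_I (hk.smul hs))
        (intervalIntegrable_of_continuousOn_I
          (hk.smul ((hf.continuous.comp_continuousOn hus).add hus)))
    have hsplit' : ∀ᵐ s ∂volume, s ∈ uIoc 0 t →
        pairing (fun y => heatKernel (t - s) (x - y)) (transport g (u s) (shifted Ψ u s)) +
          pairing (fun y => heatKernel (t - s) (x - y)) (fun y => fHat f (u s y)) =
        semigroup (t - s) (fun y => transport g (u s) (shifted Ψ u s) y + fHat f (u s y)) x := by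
      rw [uIoc_of_le ht.1.le]
      filter_upwards [(ae_restrict_iff' measurableSet_Ioc).1 hsplit] with s hs hst
      exact (hs hst).symm
    have i13 : IntervalIntegrable (fun s =>
        semigroup (t - s) (fun y => transport g (u s) (shifted Ψ u s) y + fHat f (u s y)) x)
        volume 0 t := by
      refine (i1.add i3).congr_ae ?_
      rw [uIoc_of_le ht.1.le]
      filter_upwards [hsplit] with s hs
      exact hs.symm
    have hext : ∀ᵐ s ∂(volume.restrict (Ioc 0 t)),
        RoughTermExists g (Ψ s) (u s) (fun y => heatKernel (t - s) (x - y)) := by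
      filter_upwards [ae_restrict_of_ae_restrict_of_subset (Ioc_subset_Ioc_right ht.2) hex,
        ae_restrict_lt t] with s hs hst
      exact hs _ (isLip_heatKernel (by linarith [hst.2]) x)
    have hint : (∫ s in (0)..t,
        (pairing (fun y => heatKernel (t - s) (x - y)) (transport g (u s) (shifted Ψ u s)) +
          roughTerm g (Ψ s) (u s) (fun y => heatKernel (t - s) (x - y)) +
          pairing (fun y => heatKernel (t - s) (x - y)) (fun y => fHat f (u s y)))) =
        (∫ s in (0)..t, semigroup (t - s)
          (fun y => transport g (u s) (shifted Ψ u s) y + fHat f (u s y)) x) +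
        ∫ s in (0)..t, roughTerm g (Ψ s) (u s) (fun y => heatKernel (t - s) (x - y)) := by
      rw [intervalIntegral.integral_add (i1.add i2) i3, intervalIntegral.integral_add i1 i2,
        ← intervalIntegral.integral_congr_ae hsplit', intervalIntegral.integral_add i1 i3]
      abel
    rw [hint, ← add_assoc]
    exact ⟨fun h => h.2.2.2, fun h => ⟨hext, i13, i2, h⟩⟩
  · refine forall_congr' fun φ => forall_congr' fun hφ => forall_congr' fun hp =>
      forall_congr' fun t => forall_congr' fun ht => ?_
    have i1 := (hL1.mono ht.2).intervalIntegrable_of_smooth ht.1 hφ hp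
    have i2 := (hL2.mono ht.2).intervalIntegrable_of_smooth ht.1 hφ hp
    have i3 := (hL3.mono ht.2).intervalIntegrable_of_smooth ht.1 hφ hp
    have i0 : IntervalIntegrable
        (fun s => pairing (fun x => iteratedDeriv 2 φ x - φ x) (shifted Ψ u s)) volume 0 t := by
      refine ContinuousOn.intervalIntegrable ?_
      rw [uIcc_of_le ht.1]
      have hd : Continuous fun x => iteratedDeriv 2 φ x - φ x :=
        (hφ.continuous_iteratedDeriv 2 (WithTop.coe_le_coe.2 le_top)).sub hφ.continuous
      exact (continuousOn_pairing hT.le hcv hd).mono (Icc_subset_Icc_right ht.2)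
    have hext : ∀ᵐ s ∂(volume.restrict (Ioc 0 t)), RoughTermExists g (Ψ s) (u s) φ := by
      filter_upwards [ae_restrict_of_ae_restrict_of_subset (Ioc_subset_Ioc_right ht.2) hex] with s hs
      exact hs _ (isLip_of_contDiff (hφ.of_le (by exact_mod_cast le_top)))
    have hint : (∫ s in (0)..t, (pairing φ (transport g (u s) (shifted Ψ u s)) +
          roughTerm g (Ψ s) (u s) φ + pairing φ (fun x => fHat f (u s x)))) =
        (∫ s in (0)..t, pairing φ (transport g (u s) (shifted Ψ u s))) +
        (∫ s in (0)..t, roughTerm g (Ψ s) (u s) φ) +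
        ∫ s in (0)..t, pairing φ (fun x => fHat f (u s x)) := by
      rw [intervalIntegral.integral_add (i1.add i2) i3, intervalIntegral.integral_add i1 i2]
    rw [hint, ← add_assoc, ← add_assoc]
    exact ⟨fun h => ⟨hext, i0, i1, i2, i3, h⟩, fun h => h.2.2.2.2.2⟩

end

end RoughBurgers

theorem proposition3p4 {Ω : Type*} [MeasurableSpace Ω] (P : Measure Ω) [IsProbabilityMeasure P]
    (n : ℕ) (α : ℝ) (hα : 1 / 3 < α) (hα' : α < 1 / 2) (T : ℝ) (hT : 0 < T)
    (f : RoughBurgers.E n → RoughBurgers.E n) (hf : ContDiff ℝ (⊤ : ℕ∞) f)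
    (g : RoughBurgers.E n → Matrix (Fin n) (Fin n) ℝ)
    (hg : ∀ i j : Fin n, ContDiff ℝ (⊤ : ℕ∞) fun w => g w i j)
    (Ψ : Ω → ℝ → RoughBurgers.RoughPath n α)
    (hΨ : ∀ᵐ ω ∂P, RoughBurgers.ContinuousInRoughPaths T (Ψ ω))
    (u : Ω → ℝ → ℝ → RoughBurgers.E n) :
    RoughBurgers.IsMildSolution P T f g Ψ u ↔ RoughBurgers.IsWeakSolution P T f g Ψ u := by
  refine eventually_congr ?_
  filter_upwards [hΨ] with ω hω
  refine and_congr_right fun hu => and_congr_right fun hv => ?_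
  exact RoughBurgers.mildIdentity_iff_weakIdentity hα hα' hT hf hg hω hu hv
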